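/- Let $H_0$ and $H_1$ be infinite-dimensional real Hilbert spaces with $H_1\subset H_0$ a dense subset and compact inclusion $\iota\colon H_1\to H_0$. Let $\mathcal F\subset\mathcal L(H_1,H_0)$ be the set of all bounded Fredholm operators $A\colon H_1\to H_0$ of index zero which are *symmetrizable*, that is, for which there is an inner product $\langle\cdot,\cdot\rangle$ on $H_0$, equivalent to the given one, such that $\langle Ax,y\rangle=\langle x,Ay\rangle$ for all $x,y\in H_1$. Give $\mathcal F$ the topology of the operator norm. **Interpolation space.** Let $G\colon H_1\to H_1$ be the compact, positive, self-adjoint operator defined by $\langle\xi,\eta\rangle_0=\langle\xi,G\eta\rangle_1$ for all $\xi,\eta\in H_1$. For $x\in H_0$ and an eigenvalue $\kappa>0$ of $G$ let $x_\kappa$ be the $H_0$-orthogonal projection of $x$ to $\ker(G-\kappa)\subset H_0$. Let $H_{1/2}$ be the Hilbert space of all $x\in H_0$ with $\|x\|_{1/2}^2:=\sum_\kappa\kappa^{-1/2}\|x_\kappa\|_0^2<\infty$. **Spectral projections.** For invertible $\mathbb A\in\mathcal F$ let $H^{+}_{1/2}(\mathbb A)$ (resp. $H^{-}_{1/2}(\mathbb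 A)$) be the closure in $H_{1/2}$ of the span of all eigenvectors of $\mathbb A$ with positive (resp. negative) eigenvalue. These closed subspaces of $H_{1/2}$ are complementary; let $\pi_+^{\mathbb A}$ be the projection onto $H^{+}_{1/2}(\mathbb A)$ along $H^{-}_{1/2}(\mathbb A)$, and $\pi_-^{\mathbb A}=\mathrm{Id}-\pi_+^{\mathbb A}$. **Augmented operators.** For real numbers $a<b$ let $P_0([a,b])=L^2([a,b],H_0)$ and $P_1([a,b])=L^2([a,b],H_1)\cap W^{1,2}([a,b],H_0)$, the latter with the norm $\|\xi\|^2=\int_a^b\|\xi'(s)\|_0^2\,ds+\int_a^b\|\xi(s)\|_1^2\,ds$. The (continuous representative of an) element $\xi\in P_1([a,b])$ has values $\xi(t)\in H_{1/2}$, depending boundedly on $\xi$, for all $t\in[a,b]$. For a continuous path $A\colon[a,b]\to\mathcal F$ with $A(a)$ and $A(b)$ invertible define the bounded linear operator $$ \mathfrak D_A\colon P_1([a,b])\to P_0([a,b])\times H^{+}_{1/2}(A(a))\times H^{-}_{1/2}(A(b)), \qquad \xi\mapsto\bigl(\partial_s\xi+A\xi,\ \pi_+^{A(a)}\xi(a),\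 \pi_-^{A(b)}\xi(b)\bigr). $$ **Theorem (path concatenation).** Let $T>0$ and let $A\colon[-T,T]\to\mathcal F$ be a continuous path such that $A(-T)$, $A(0)$ and $A(T)$ are invertible. Then the operators $\mathfrak D_A$, $\mathfrak D_{A|_{[-T,0]}}$ and $\mathfrak D_{A|_{[0,T]}}$ are Fredholm, and $$ \operatorname{ind}\mathfrak D_A=\operatorname{ind}\mathfrak D_{A|_{[-T,0]}}+\operatorname{ind}\mathfrak D_{A|_{[0,T]}}, $$ where $\operatorname{ind}D=\dim\ker D-\dim\operatorname{coker}D$. -/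

import Mathlib

open MeasureTheory Set
open scoped ContDiff InnerProductSpace ENNReal

set_option linter.unusedSectionVars false

/-- A Hilbert space pair `(H₀, H₁)`: two infinite dimensional (real) Hilbert spaces and a compact
injective inclusion map `H₁ → H₀` with dense range. (Completeness of the two spaces is an instance
argument wherever it is used.) -/
structure HilbertPair (H₀ H₁ : Type*) [NormedAddCommGroup H₀] [InnerProductSpace ℝ H₀]
    [NormedAddCommGroup H₁] [InnerProductSpace ℝ H₁] where
  /-- The inclusion of `H₁` into `H₀`. -/
  incl : H₁ →L[ℝ] H₀
  injective_incl : Function.Injective incl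
  denseRange_incl : DenseRange incl
  compact_incl : IsCompactOperator incl
  infinite_zero : ¬ FiniteDimensional ℝ H₀
  infinite_one : ¬ FiniteDimensional ℝ H₁

/-- The index `dim ker D - dim coker D`; it is used for Fredholm operators only. -/
noncomputable def fredholmIndex {X Y : Type*} [NormedAddCommGroup X] [NormedSpace ℝ X]
    [NormedAddCommGroup Y] [NormedSpace ℝ Y] (D : X →L[ℝ] Y) : ℤ :=
  (Module.finrank ℝ D.ker : ℤ) - (Module.finrank ℝ (Y ⧸ D.range) : ℤ)

namespace HilbertPair

section Hessians

variable {H₀ H₁ : Type*} [NormedAddCommGroup H₀] [InnerProductSpace ℝ H₀]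
  [NormedAddCommGroup H₁] [InnerProductSpace ℝ H₁] (P : HilbertPair H₀ H₁)

/-- `A : H₁ → H₀` is symmetrizable: it is symmetric for some inner product `b` on `H₀` which is
equivalent to the given one. -/
def IsSymmetrizable (A : H₁ →L[ℝ] H₀) : Prop :=
  ∃ b : H₀ →ₗ[ℝ] H₀ →ₗ[ℝ] ℝ,
    (∀ x y, b x y = b y x) ∧
    (∃ c : ℝ, 0 < c ∧ ∀ x, c⁻¹ * ‖x‖ ≤ √(b x x) ∧ √(b x x) ≤ c * ‖x‖) ∧
    ∀ x y : H₁, b (A x) (P.incl y) = b (P.incl x) (A y)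

/-- A Hessian: a symmetrizable Fredholm operator of index zero. -/
def IsHessian (A : H₁ →L[ℝ] H₀) : Prop :=
  P.IsSymmetrizable A ∧ A.IsFredholm ∧ fredholmIndex A = 0

/-- The continuous paths of Hessians `[a, b] → 𝓕`. -/
def hessianPaths (a b : ℝ) : Set C(Icc a b, H₁ →L[ℝ] H₀) :=
  {A | ∀ s, P.IsHessian (A s)}

/-- The continuous paths of Hessians `[a, b] → 𝓕` whose two ends are invertible. -/
def hessianPathsStar {a b : ℝ} (hab : a < b) : Set C(Icc a b, H₁ →L[ℝ] H₀) :=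
  {A | A ∈ P.hessianPaths a b ∧ (A ⟨a, left_mem_Icc.2 hab.le⟩).IsInvertible ∧
    (A ⟨b, right_mem_Icc.2 hab.le⟩).IsInvertible}

end Hessians

section Interpolation

variable {H₀ H₁ : Type*} [NormedAddCommGroup H₀] [InnerProductSpace ℝ H₀] [CompleteSpace H₀]
  [NormedAddCommGroup H₁] [InnerProductSpace ℝ H₁] [CompleteSpace H₁] (P : HilbertPair H₀ H₁)

/-- The growth operator `T : H₁ → H₁`, defined by `⟪ξ, η⟫₀ = ⟪ξ, T η⟫₁`. -/
noncomputable def growth : H₁ →L[ℝ] H₁ := P.incl.adjoint ∘L P.incl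

theorem inner_growth (ξ η : H₁) : ⟪ξ, P.growth η⟫_ℝ = ⟪P.incl ξ, P.incl η⟫_ℝ := by
  simp [growth, ContinuousLinearMap.adjoint_inner_right]

/-- The eigenspace `V κ = ker (T - κ)` of the growth operator, as a subspace of `H₀`. It is trivial
unless `κ` is an eigenvalue of `T`, and all eigenvalues of `T` are positive. -/
noncomputable def eigen (κ : ℝ) : Submodule ℝ H₀ :=
  (Module.End.eigenspace (P.growth : Module.End ℝ H₁) κ).map (P.incl : H₁ →ₗ[ℝ] H₀)

theorem mem_eigen {κ : ℝ} {x : H₀} :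
    x ∈ P.eigen κ ↔ ∃ v, P.growth v = κ • v ∧ P.incl v = x := by
  simp [eigen]

theorem norm_incl_sq_of_growth {κ : ℝ} {v : H₁} (hv : P.growth v = κ • v) :
    ‖P.incl v‖ ^ 2 = κ * ‖v‖ ^ 2 := by
  rw [← real_inner_self_eq_norm_sq, ← P.inner_growth, hv, inner_smul_right,
    real_inner_self_eq_norm_sq]

theorem eq_zero_of_growth {κ : ℝ} (hκ : κ ≤ 0) {v : H₁} (hv : P.growth v = κ • v) : v = 0 := by
  have h := P.norm_incl_sq_of_growth hv
  have h0 : ‖P.incl v‖ ^ 2 ≤ 0 := h ▸ mul_nonpos_of_nonpos_of_nonneg hκ (by positivity)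
  have : P.incl v = 0 := by
    have := pow_eq_zero_iff (two_ne_zero) |>.1 (le_antisymm h0 (by positivity))
    simpa using this
  exact P.injective_incl (by simpa using this)

theorem eigen_eq_bot {κ : ℝ} (hκ : κ ≤ 0) : P.eigen κ = ⊥ := by
  rw [eq_bot_iff]
  intro x hx
  obtain ⟨v, hv, rfl⟩ := P.mem_eigen.1 hx
  simp [P.eq_zero_of_growth hκ hv]

theorem isCompactOperator_growth : IsCompactOperator P.growth :=
  P.compact_incl.clm_comp P.incl.adjoint

instance instFiniteDimensionalEigen (κ : ℝ) : FiniteDimensional ℝ (P.eigen κ) := by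
  rcases le_or_gt κ 0 with h | h
  · rw [P.eigen_eq_bot h]; infer_instance
  · have := ContinuousLinearMap.finite_dimensional_eigenspace P.isCompactOperator_growth κ h.ne'
    unfold eigen
    infer_instance

theorem inner_eigen_eq_zero {κ κ' : ℝ} (h : κ ≠ κ') {v w : H₁} (hv : P.growth v = κ • v)
    (hw : P.growth w = κ' • w) : ⟪v, w⟫_ℝ = 0 ∧ ⟪P.incl v, P.incl w⟫_ℝ = 0 := by
  have h1 : ⟪P.incl v, P.incl w⟫_ℝ = κ' * ⟪v, w⟫_ℝ := by
    rw [← P.inner_growth, hw, inner_smul_right]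
  have h2 : ⟪P.incl v, P.incl w⟫_ℝ = κ * ⟪v, w⟫_ℝ := by
    rw [real_inner_comm, ← P.inner_growth, hv, inner_smul_right, real_inner_comm]
  have h3 : (κ - κ') * ⟪v, w⟫_ℝ = 0 := by linarith
  have h4 : ⟪v, w⟫_ℝ = 0 := (mul_eq_zero.1 h3).resolve_left (sub_ne_zero.2 h)
  exact ⟨h4, by rw [h1, h4, mul_zero]⟩

theorem eq_zero_of_starProjection_eigen {x : H₀} (h : ∀ κ, (P.eigen κ).starProjection x = 0) :
    x = 0 := by
  have hs : (P.growth : H₁ →ₗ[ℝ] H₁).IsSymmetric := by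
    intro v w
    change ⟪P.growth v, w⟫_ℝ = ⟪v, P.growth w⟫_ℝ
    rw [real_inner_comm, P.inner_growth, P.inner_growth, real_inner_comm]
  have hT := ContinuousLinearMap.orthogonalComplement_iSup_eigenspaces_eq_bot
    P.isCompactOperator_growth hs
  have h1 : P.incl.adjoint x = 0 := by
    have : P.incl.adjoint x ∈
        (⨆ μ, Module.End.eigenspace (P.growth : Module.End ℝ H₁) μ)ᗮ := by
      rw [← Submodule.iInf_orthogonal, Submodule.mem_iInf]
      intro κ v hv
      rw [ContinuousLinearMap.adjoint_inner_right]
      have h2 := (Submodule.starProjection_apply_eq_zero_iff _).1 (h κ)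
      exact h2 _ (Submodule.mem_map_of_mem hv)
    rw [hT] at this
    simpa using this
  refine P.denseRange_incl.eq_zero_of_inner_left (𝕜 := ℝ) ?_
  intro v
  rw [← ContinuousLinearMap.adjoint_inner_left, h1, inner_zero_left]

/-- The coefficients `κ ^ (-1/4) • x_κ` whose square-sum is the squared `1/2`-norm of `x`; here
`x_κ` is the component of `x` in the eigenspace `V κ`. -/
noncomputable def halfCoeff (x : H₀) : ℝ → H₀ := fun κ =>
  (κ ^ (-(1 / 4 : ℝ))) • (P.eigen κ).starProjection x

/-- The elements `x` of `H₀` with `∑ κ, κ ^ (-1/2) * ‖x_κ‖₀ ^ 2 < ∞`. -/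
noncomputable def halfSubmodule : Submodule ℝ H₀ where
  carrier := {x | Memℓp (P.halfCoeff x) 2}
  zero_mem' := by
    have : P.halfCoeff 0 = 0 := by ext κ; simp [halfCoeff]
    change Memℓp (P.halfCoeff 0) 2
    rw [this]; exact zero_memℓp
  add_mem' {x y} hx hy := by
    have : P.halfCoeff (x + y) = P.halfCoeff x + P.halfCoeff y := by
      ext κ; simp [halfCoeff, smul_add]
    change Memℓp (P.halfCoeff (x + y)) 2
    rw [this]; exact hx.add hy
  smul_mem' c x hx := by
    have : P.halfCoeff (c • x) = c • P.halfCoeff x := by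
      ext κ; simp [halfCoeff, smul_comm c]
    change Memℓp (P.halfCoeff (c • x)) 2
    rw [this]; exact hx.const_smul c

/-- The interpolation space `H_{1/2}`: the completion of the algebraic direct sum of the eigenspaces
`V κ` of the growth operator for the norm `‖x‖ ^ 2 = ∑ κ, κ ^ (-1/2) * ‖x_κ‖₀ ^ 2`, realised as a
subspace of `H₀`, but carrying its own norm (see `Half.norm_sq_eq`). -/
def Half : Type _ := P.halfSubmodule

noncomputable instance : AddCommGroup P.Half := inferInstanceAs (AddCommGroup P.halfSubmodule)
noncomputable instance : Module ℝ P.Half := inferInstanceAs (Module ℝ P.halfSubmodule)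

/-- The inclusion of `H_{1/2}` into `H₀`. -/
noncomputable def Half.val : P.Half →ₗ[ℝ] H₀ := P.halfSubmodule.subtype

/-- The isometric embedding that induces the inner product of `H_{1/2}`. -/
noncomputable def Half.coeff : P.Half →ₗ[ℝ] lp (fun _ : ℝ => H₀) 2 where
  toFun x := ⟨P.halfCoeff (Half.val P x), x.2⟩
  map_add' x y := by
    ext κ
    change P.halfCoeff (Half.val P (x + y)) κ =
      P.halfCoeff (Half.val P x) κ + P.halfCoeff (Half.val P y) κ
    simp [halfCoeff, smul_add]
  map_smul' c x := by
    ext κ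
    change P.halfCoeff (Half.val P (c • x)) κ = c • P.halfCoeff (Half.val P x) κ
    simp [halfCoeff, smul_comm c]

theorem Half.coeff_injective : Function.Injective (Half.coeff P) := by
  rw [← LinearMap.ker_eq_bot, LinearMap.ker_eq_bot']
  intro x hx
  refine Subtype.ext (P.eq_zero_of_starProjection_eigen fun κ => ?_)
  rcases le_or_gt κ 0 with h | h
  · simp [P.eigen_eq_bot h]
  · have := congrFun (congrArg (fun f : lp (fun _ : ℝ => H₀) 2 => (f : ℝ → H₀)) hx) κ
    have h2 : (κ ^ (-(1 / 4 : ℝ))) • (P.eigen κ).starProjection (Half.val P x) = 0 := this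
    exact (smul_eq_zero.1 h2).resolve_left (Real.rpow_pos_of_pos h _).ne'

noncomputable instance : NormedAddCommGroup P.Half :=
  NormedAddCommGroup.induced _ _ (Half.coeff P) (Half.coeff_injective P)

noncomputable instance : InnerProductSpace ℝ P.Half where
  norm_smul_le c x := by
    change ‖Half.coeff P (c • x)‖ ≤ ‖c‖ * ‖Half.coeff P x‖
    rw [map_smul, norm_smul]
  inner x y := ⟪Half.coeff P x, Half.coeff P y⟫_ℝ
  norm_sq_eq_re_inner x := norm_sq_eq_re_inner (𝕜 := ℝ) (Half.coeff P x)
  conj_inner_symm x y := inner_conj_symm (𝕜 := ℝ) (Half.coeff P x) (Half.coeff P y)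
  add_left x y z := by
    change ⟪Half.coeff P (x + y), Half.coeff P z⟫_ℝ = _
    rw [map_add, inner_add_left]
  smul_left x y c := by
    change ⟪Half.coeff P (c • x), Half.coeff P y⟫_ℝ = _
    rw [map_smul, inner_smul_left]

theorem Half.norm_sq_eq (x : P.Half) : ‖x‖ ^ 2 =
    ∑' κ : ℝ, κ ^ (-(1 / 2 : ℝ)) * ‖(P.eigen κ).starProjection (Half.val P x)‖ ^ 2 := by
  change ‖Half.coeff P x‖ ^ 2 = _
  have := lp.norm_rpow_eq_tsum (p := 2) (by norm_num) (Half.coeff P x)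
  simp only [ENNReal.toReal_ofNat, Real.rpow_ofNat] at this
  rw [this]
  congr 1
  ext κ
  change ‖(κ ^ (-(1 / 4 : ℝ))) • (P.eigen κ).starProjection (Half.val P x)‖ ^ 2 = _
  rcases le_or_gt κ 0 with h | h
  · simp [P.eigen_eq_bot h]
  · rw [norm_smul, mul_pow, Real.norm_of_nonneg (Real.rpow_nonneg h.le _), ← Real.rpow_natCast,
      ← Real.rpow_mul h.le]
    norm_num

/-- `H^+_{1/2}(A)`: the closure in `H_{1/2}` of the span of the eigenvectors of `A` with positive
eigenvalues. -/
noncomputable def halfPos (A : H₁ →L[ℝ] H₀) : Submodule ℝ P.Half :=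
  (Submodule.span ℝ {x : P.Half | ∃ a : ℝ, 0 < a ∧ ∃ v : H₁, A v = a • P.incl v ∧
    Half.val P x = P.incl v}).topologicalClosure

/-- `H^-_{1/2}(A)`: the closure in `H_{1/2}` of the span of the eigenvectors of `A` with negative
eigenvalues. -/
noncomputable def halfNeg (A : H₁ →L[ℝ] H₀) : Submodule ℝ P.Half :=
  (Submodule.span ℝ {x : P.Half | ∃ a : ℝ, a < 0 ∧ ∃ v : H₁, A v = a • P.incl v ∧
    Half.val P x = P.incl v}).topologicalClosure

open Classical in
/-- The projection `π_+` of `H_{1/2}` onto `H^+_{1/2}(A)` along `H^-_{1/2}(A)`. For an invertible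
Hessian `A` these two subspaces are topological complements of each other in `H_{1/2}`; for other
operators the value is irrelevant. -/
noncomputable def projPos (A : H₁ →L[ℝ] H₀) : P.Half →L[ℝ] P.halfPos A :=
  if h : (P.halfPos A).IsTopCompl (P.halfNeg A) then
    (P.halfPos A).projectionOntoL (P.halfNeg A) h else 0

open Classical in
/-- The projection `π_-` of `H_{1/2}` onto `H^-_{1/2}(A)` along `H^+_{1/2}(A)`. -/
noncomputable def projNeg (A : H₁ →L[ℝ] H₀) : P.Half →L[ℝ] P.halfNeg A :=
  if h : (P.halfNeg A).IsTopCompl (P.halfPos A) then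
    (P.halfNeg A).projectionOntoL (P.halfPos A) h else 0

end Interpolation

section WeakDerivative

variable {E : Type*} [NormedAddCommGroup E] [InnerProductSpace ℝ E] [CompleteSpace E]

/-- `v` is the weak derivative of `u` on the interval `(a, b)`. -/
def IsWeakDeriv (a b : ℝ) (u v : ℝ → E) : Prop :=
  ∀ φ : ℝ → ℝ, ContDiff ℝ ∞ φ → HasCompactSupport φ → tsupport φ ⊆ Ioo a b →
    ∫ s in Icc a b, deriv φ s • u s = -∫ s in Icc a b, φ s • v s

theorem integrable_smul_of_test {a b : ℝ} {ψ : ℝ → ℝ} (h1 : Continuous ψ)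
    (h2 : HasCompactSupport ψ) {u : ℝ → E} (hu : IntegrableOn u (Icc a b)) :
    IntegrableOn (fun s => ψ s • u s) (Icc a b) := by
  obtain ⟨C, hC⟩ := h2.exists_bound_of_continuous h1
  exact Integrable.bdd_smul hu C h1.aestronglyMeasurable (Filter.Eventually.of_forall hC)

/-- Integration by parts for a primitive. -/
theorem integral_test_primitive {a b : ℝ} (hab : a < b) {v : ℝ → E}
    (hv : IntegrableOn v (Icc a b)) {φ : ℝ → ℝ} (h1 : ContDiff ℝ ∞ φ)
    (h2 : HasCompactSupport φ) (h3 : tsupport φ ⊆ Ioo a b) :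
    ∫ s in Icc a b, deriv φ s • (∫ r in a..s, v r) = -∫ s in Icc a b, φ s • v s := by
  have hvi : IntervalIntegrable v volume a b :=
    (intervalIntegrable_iff_integrableOn_Icc_of_le hab.le).2 hv
  have hφa : φ a = 0 := by
    by_contra h
    exact absurd (h3 (subset_tsupport _ h)) (by simp)
  have hφb : φ b = 0 := by
    by_contra h
    exact absurd (h3 (subset_tsupport _ h)) (by simp)
  have hφ' : Continuous (deriv φ) := h1.continuous_deriv (by simp)
  have hprim : ContinuousOn (fun s => ∫ r in a..s, v r) (Icc a b) := by
    have := intervalIntegral.continuousOn_primitive_interval (a := a) (b := b) (f := v)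
      (by simpa [uIcc_of_le hab.le] using hv)
    simpa [uIcc_of_le hab.le] using this
  refine ext_inner_left ℝ fun h => ?_
  have hg : IntervalIntegrable (fun r => ⟪h, v r⟫_ℝ) volume a b :=
    (intervalIntegrable_iff_integrableOn_Icc_of_le hab.le).2 (hv.const_inner h)
  have hG := hg.absolutelyContinuousOnInterval_intervalIntegral (c := a) (by simp)
  have hφac : AbsolutelyContinuousOnInterval φ a b :=
    ContDiffOn.absolutelyContinuousOnInterval (h1.of_le (by simp)).contDiffOn
  have key := hφac.integral_mul_deriv_eq_deriv_mul hG
  have e1 : ∫ x in a..b, φ x * deriv (fun x => ∫ r in a..x, ⟪h, v r⟫_ℝ) x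
      = ∫ x in a..b, φ x * ⟪h, v x⟫_ℝ := by
    apply intervalIntegral.integral_congr_ae
    filter_upwards [hg.ae_hasDerivAt_integral] with x hx hx2
    rw [(hx (uIoc_subset_uIcc hx2) a (by simp)).deriv]
  rw [e1, hφa, hφb] at key
  have e2 : ⟪h, ∫ s in Icc a b, φ s • v s⟫_ℝ = ∫ x in a..b, φ x * ⟪h, v x⟫_ℝ := by
    rw [intervalIntegral.integral_of_le hab.le, ← integral_Icc_eq_integral_Ioc,
      ← integral_inner (integrable_smul_of_test h1.continuous h2 hv)]
    simp [inner_smul_right]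
  have e3 : ⟪h, ∫ s in Icc a b, deriv φ s • (∫ r in a..s, v r)⟫_ℝ =
      ∫ x in a..b, deriv φ x * ∫ r in a..x, ⟪h, v r⟫_ℝ := by
    rw [intervalIntegral.integral_of_le hab.le, ← integral_Icc_eq_integral_Ioc,
      ← integral_inner (integrable_smul_of_test hφ' h2.deriv
        (hprim.integrableOn_compact isCompact_Icc))]
    refine setIntegral_congr_fun measurableSet_Icc fun s hs => ?_
    have : IntervalIntegrable v volume a s :=
      hvi.mono_set (by rw [uIcc_of_le hab.le, uIcc_of_le hs.1]; exact Icc_subset_Icc_right hs.2)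
    simp only [inner_smul_right]
    rw [intervalIntegral.integral_of_le hs.1, intervalIntegral.integral_of_le hs.1,
      ← integral_inner this.1]
  rw [inner_neg_right, e2, e3]
  linarith

/-- A function with an integrable weak derivative is a.e. equal to a primitive of it. -/
theorem IsWeakDeriv.exists_primitive {a b : ℝ} (hab : a < b) {u v : ℝ → E}
    (hu : IntegrableOn u (Icc a b)) (hv : IntegrableOn v (Icc a b)) (h : IsWeakDeriv a b u v) :
    ∃ c : E, ∀ᵐ s ∂volume.restrict (Icc a b), u s = c + ∫ r in a..s, v r := by
  have hprim : ContinuousOn (fun s => ∫ r in a..s, v r) (Icc a b) := by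
    have := intervalIntegral.continuousOn_primitive_interval (a := a) (b := b) (f := v)
      (by simpa [uIcc_of_le hab.le] using hv)
    simpa [uIcc_of_le hab.le] using this
  set f : ℝ → E := fun s => u s - ∫ r in a..s, v r with hf
  have hprimI : IntegrableOn (fun s => ∫ r in a..s, v r) (Icc a b) :=
    hprim.integrableOn_compact isCompact_Icc
  have hfI : IntegrableOn f (Icc a b) := hu.sub hprimI
  have hf0 : ∀ φ : ℝ → ℝ, ContDiff ℝ ∞ φ → HasCompactSupport φ → tsupport φ ⊆ Ioo a b →
      ∫ s in Icc a b, deriv φ s • f s = 0 := by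
    intro φ h1 h2 h3
    have hφ' : Continuous (deriv φ) := h1.continuous_deriv (by simp)
    simp only [hf, smul_sub]
    rw [integral_sub (integrable_smul_of_test hφ' h2.deriv hu)
      (integrable_smul_of_test hφ' h2.deriv hprimI), h φ h1 h2 h3,
      integral_test_primitive hab hv h1 h2 h3, sub_self]
  -- a normalised bump function
  let ψ : ContDiffBump ((a + b) / 2) := ⟨(b - a) / 8, (b - a) / 4, by linarith, by linarith⟩
  set ψ₀ : ℝ → ℝ := ψ.normed volume with hψ₀
  have hψs : ContDiff ℝ ∞ ψ₀ := ψ.contDiff_normed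
  have hψc : HasCompactSupport ψ₀ := ψ.hasCompactSupport_normed
  have hψt : tsupport ψ₀ ⊆ Ioo a b := by
    rw [hψ₀, ψ.tsupport_normed_eq, Real.closedBall_eq_Icc]
    intro x hx
    have h1 : (a + b) / 2 - (b - a) / 4 ≤ x := hx.1
    have h2 : x ≤ (a + b) / 2 + (b - a) / 4 := hx.2
    constructor <;> linarith
  have hψi : ∫ x, ψ₀ x = 1 := ψ.integral_normed
  set c : E := ∫ s in Icc a b, ψ₀ s • f s with hc
  have supp_int : ∀ g : ℝ → ℝ, tsupport g ⊆ Ioo a b → ∫ s in Icc a b, g s = ∫ s, g s := by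
    intro g hg
    refine setIntegral_eq_integral_of_forall_compl_eq_zero fun x hx => ?_
    by_contra hne
    exact hx (Ioo_subset_Icc_self (hg (subset_tsupport _ hne)))
  refine ⟨c, ?_⟩
  have main : ∀ᵐ x, x ∈ Ioo a b → f x - c = 0 := by
    refine isOpen_Ioo.ae_eq_zero_of_integral_contDiff_smul_eq_zero
      (f := fun x => f x - c) ?_ ?_
    · refine IntegrableOn.locallyIntegrableOn ?_
      exact ((hfI.sub (integrableOn_const (by simp))).mono_set Ioo_subset_Icc_self)
    · intro g g1 g2 g3
      -- the primitive of `g - (∫ g) ψ₀` is a test function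
      set m : ℝ := ∫ x, g x with hm
      set k : ℝ → ℝ := fun x => g x - m * ψ₀ x with hk
      have hkc : ContDiff ℝ ∞ k := g1.sub (contDiff_const.mul hψs)
      have hk1 : Continuous k := hkc.continuous
      have hkI : ∀ x y, IntervalIntegrable k volume x y := fun x y => hk1.intervalIntegrable x y
      set φ : ℝ → ℝ := fun x => ∫ r in a..x, k r with hφ
      have hφd : deriv φ = k := by
        ext x
        exact (intervalIntegral.integral_hasDerivAt_right (hkI a x)
          (hk1.stronglyMeasurableAtFilter _ _) hk1.continuousAt).deriv
      have hφD : Differentiable ℝ φ := fun x =>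
        (intervalIntegral.integral_hasDerivAt_right (hkI a x)
          (hk1.stronglyMeasurableAtFilter _ _) hk1.continuousAt).differentiableAt
      have hφs : ContDiff ℝ ∞ φ := by
        rw [contDiff_infty_iff_deriv, hφd]
        exact ⟨hφD, hkc⟩
      set K : Set ℝ := tsupport g ∪ tsupport ψ₀ with hK
      have hKc : IsCompact K := g2.isCompact.union hψc.isCompact
      have hKs : K ⊆ Ioo a b := union_subset g3 hψt
      have hk0 : ∀ x, x ∉ K → k x = 0 := by
        intro x hx
        have hx1 : g x = 0 := by
          by_contra hne; exact hx (Or.inl (subset_tsupport _ hne))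
        have hx2 : ψ₀ x = 0 := by
          by_contra hne; exact hx (Or.inr (subset_tsupport _ hne))
        simp [hk, hx1, hx2]
      have hgI : Integrable g := g1.continuous.integrable_of_hasCompactSupport g2
      have hψI : Integrable ψ₀ := hψs.continuous.integrable_of_hasCompactSupport hψc
      have hktot : ∫ x, k x = 0 := by
        simp only [hk]
        rw [integral_sub hgI (hψI.const_mul m), integral_const_mul, hψi]
        simp [hm]
      obtain ⟨α, β, hα, hβ, hαβ, hKαβ⟩ : ∃ α β, a < α ∧ β < b ∧ α ≤ β ∧ K ⊆ Icc α β := by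
        rcases K.eq_empty_or_nonempty with h0 | h0
        · exact ⟨(a + b) / 2, (a + b) / 2, by linarith, by linarith, le_rfl, by simp [h0]⟩
        · refine ⟨sInf K, sSup K, (hKs (hKc.sInf_mem h0)).1, (hKs (hKc.sSup_mem h0)).2, ?_, ?_⟩
          · exact csInf_le_csSup h0 hKc.bddBelow hKc.bddAbove
          · exact fun x hx => ⟨csInf_le hKc.bddBelow hx, le_csSup hKc.bddAbove hx⟩
      have hφ0 : ∀ x, x ∉ Icc α β → φ x = 0 := by
        intro x hx
        rcases lt_or_ge x α with hxα | hxα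
        · have : ∀ r ∈ uIcc a x, k r = 0 := by
            intro r hr
            refine hk0 r fun hrK => ?_
            have h1 := (hKαβ hrK).1
            have h2 : r ≤ max a x := hr.2
            have h3 : max a x < α := max_lt hα hxα
            linarith
          simp only [hφ]
          rw [intervalIntegral.integral_congr (g := fun _ => (0 : ℝ)) this]
          simp
        · have hxβ : β < x := by
            by_contra hcon
            exact hx ⟨hxα, not_lt.1 hcon⟩
          simp only [hφ]
          rw [intervalIntegral.integral_of_le (by linarith), ← hktot]
          refine setIntegral_eq_integral_of_forall_compl_eq_zero fun r hr => ?_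
          refine hk0 r fun hrK => hr ⟨?_, ?_⟩
          · exact hα.trans_le (hKαβ hrK).1
          · exact (hKαβ hrK).2.trans hxβ.le
      have hφt : tsupport φ ⊆ Icc α β := by
        refine closure_minimal (fun x hx => ?_) isClosed_Icc
        by_contra hcon
        exact hx (hφ0 x hcon)
      have hφc : HasCompactSupport φ := HasCompactSupport.of_support_subset_isCompact
        isCompact_Icc ((subset_tsupport _).trans hφt)
      have hz := hf0 φ hφs hφc (hφt.trans (Icc_subset_Ioo hα hβ))
      rw [hφd] at hz
      have hgf := integrable_smul_of_test g1.continuous g2 hfI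
      have hψf := integrable_smul_of_test hψs.continuous hψc hfI
      have hz2 : ∫ s in Icc a b, g s • f s = m • c := by
        have : ∫ s in Icc a b, k s • f s
            = (∫ s in Icc a b, g s • f s) - m • ∫ s in Icc a b, ψ₀ s • f s := by
          rw [← integral_smul, ← integral_sub hgf (by exact hψf.smul m)]
          refine integral_congr_ae (Filter.Eventually.of_forall fun s => ?_)
          simp [hk, sub_smul, mul_smul]
        rw [hz] at this
        exact (sub_eq_zero.1 this.symm)
      have hz3 : ∫ x, g x • (f x - c) = ∫ s in Icc a b, g s • (f s - c) := by
        refine (setIntegral_eq_integral_of_forall_compl_eq_zero fun x hx => ?_).symm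
        have : g x = 0 := by
          by_contra hne
          exact hx (Ioo_subset_Icc_self (g3 (subset_tsupport _ hne)))
        simp [this]
      rw [hz3]
      simp only [smul_sub]
      rw [integral_sub hgf (hgI.integrableOn.smul_const c), hz2, integral_smul_const,
        supp_int g g3, sub_self]
  have hIoo : ∀ᵐ s ∂volume.restrict (Icc a b), s ∈ Ioo a b := by
    rw [← Measure.restrict_congr_set (Ioo_ae_eq_Icc (a := a) (b := b) (μ := volume))]
    exact ae_restrict_mem measurableSet_Ioo
  filter_upwards [hIoo, ae_restrict_of_ae main] with s hs hs2
  have := hs2 hs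
  simp only [hf] at this
  rw [sub_sub, sub_eq_zero] at this
  rw [this, add_comm]

end WeakDerivative

/-- `L²([a, b], H)`. -/
abbrev PathL2 (a b : ℝ) (H : Type*) [NormedAddCommGroup H] : Type _ :=
  Lp H 2 ((volume : Measure ℝ).restrict (Icc a b))

theorem integrableOn_pathL2 {a b : ℝ} {H : Type*} [NormedAddCommGroup H] (f : PathL2 a b H) :
    IntegrableOn f (Icc a b) :=
  (Lp.memLp f).integrable (by norm_num)

theorem integrableOn_norm_sq_pathL2 {a b : ℝ} {H : Type*} [NormedAddCommGroup H]
    (f : PathL2 a b H) : IntegrableOn (fun s => ‖f s‖ ^ 2) (Icc a b) :=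
  (memLp_two_iff_integrable_sq_norm (Lp.aestronglyMeasurable f)).1 (Lp.memLp f)

theorem norm_sq_pathL2 {a b : ℝ} {H : Type*} [NormedAddCommGroup H] [InnerProductSpace ℝ H]
    (f : PathL2 a b H) : ‖f‖ ^ 2 = ∫ s in Icc a b, ‖f s‖ ^ 2 := by
  rw [← real_inner_self_eq_norm_sq, L2.inner_def]
  simp

theorem sum_norm_sq_le_of_orthogonal {ι E : Type*} [NormedAddCommGroup E] [InnerProductSpace ℝ E]
    (F : Finset ι) (q : ι → E) (hq : ∀ i ∈ F, ∀ j ∈ F, i ≠ j → ⟪q i, q j⟫_ℝ = 0) (y : E)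
    (hy : ∀ i ∈ F, ⟪y, q i⟫_ℝ = ‖q i‖ ^ 2) : ∑ i ∈ F, ‖q i‖ ^ 2 ≤ ‖y‖ ^ 2 := by
  classical
  set S := ∑ i ∈ F, ‖q i‖ ^ 2 with hS
  have h1 : ⟪y, ∑ i ∈ F, q i⟫_ℝ = S := by
    rw [inner_sum]; exact Finset.sum_congr rfl hy
  have h2 : ‖∑ i ∈ F, q i‖ ^ 2 = S := by
    rw [← real_inner_self_eq_norm_sq, sum_inner]
    refine Finset.sum_congr rfl fun i hi => ?_
    rw [inner_sum, Finset.sum_eq_single i (fun j hj hji => hq i hi j hj hji.symm)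
      (fun h => absurd hi h), real_inner_self_eq_norm_sq]
  have h3 := norm_sub_sq_real y (∑ i ∈ F, q i)
  rw [h1, h2] at h3
  nlinarith [sq_nonneg ‖y - ∑ i ∈ F, q i‖]

/-- An elementary one-dimensional trace estimate. -/
theorem trace_estimate {E : Type*} [NormedAddCommGroup E] [NormedSpace ℝ E]
    {a b t δ : ℝ} (ht : t ∈ Icc a b) (hδ : 0 < δ) (hδ' : δ ≤ b - a) {f v : ℝ → E}
    (hf : ContinuousOn f (Icc a b)) (hv : IntegrableOn v (Icc a b))
    (hv2 : IntegrableOn (fun s => ‖v s‖ ^ 2) (Icc a b))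
    (hfv : ∀ s ∈ Icc a b, f t = f s + ∫ r in s..t, v r) :
    δ * ‖f t‖ ^ 2 ≤ 2 * (∫ s in Icc a b, ‖f s‖ ^ 2) + 2 * δ ^ 2 * ∫ s in Icc a b, ‖v s‖ ^ 2 := by
  obtain ⟨α, hα, htα, htβ, hβ⟩ : ∃ α, a ≤ α ∧ α ≤ t ∧ t ≤ α + δ ∧ α + δ ≤ b := by
    refine ⟨max a (t - δ), le_max_left _ _, max_le ht.1 (by linarith), ?_, ?_⟩
    · have := le_max_right a (t - δ); linarith
    · have : max a (t - δ) ≤ b - δ := max_le (by linarith) (by linarith [ht.2])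
      linarith
  set J := Icc α (α + δ) with hJ
  have hJs : J ⊆ Icc a b := Icc_subset_Icc hα hβ
  have htJ : t ∈ J := ⟨htα, htβ⟩
  have hvol : (volume : Measure ℝ).real J = δ := by
    simp [hJ, hδ.le]
  have hvJ : IntegrableOn v J := hv.mono_set hJs
  have hv2J : IntegrableOn (fun s => ‖v s‖ ^ 2) J := hv2.mono_set hJs
  set m := ∫ r in J, ‖v r‖ with hm
  have hm0 : 0 ≤ m := integral_nonneg fun _ => norm_nonneg _
  have hCS : m ^ 2 ≤ δ * ∫ r in J, ‖v r‖ ^ 2 := by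
    have h0 : 0 ≤ ∫ r in J, (‖v r‖ - m / δ) ^ 2 := integral_nonneg fun _ => sq_nonneg _
    have h1 : ∫ r in J, (‖v r‖ - m / δ) ^ 2 =
        (∫ r in J, ‖v r‖ ^ 2) - 2 * (m / δ) * m + δ * (m / δ) ^ 2 := by
      have e : (fun r => (‖v r‖ - m / δ) ^ 2) =
          fun r => (‖v r‖ ^ 2 - 2 * (m / δ) * ‖v r‖) + (m / δ) ^ 2 := by
        ext r; ring
      have i1 : IntegrableOn (fun r => 2 * (m / δ) * ‖v r‖) J := hvJ.norm.const_mul _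
      have i2 : IntegrableOn (fun _ : ℝ => (m / δ) ^ 2) J := integrableOn_const (by simp [hJ])
      rw [e, integral_add (by exact hv2J.sub i1) i2, integral_sub hv2J i1, integral_const_mul,
        setIntegral_const, hvol, smul_eq_mul]
    rw [h1] at h0
    have h2 : δ * (m / δ) ^ 2 = m ^ 2 / δ := by field_simp
    have h3 : 2 * (m / δ) * m = 2 * (m ^ 2 / δ) := by ring
    rw [h2, h3] at h0
    have h4 : m ^ 2 / δ ≤ ∫ r in J, ‖v r‖ ^ 2 := by linarith
    rw [div_le_iff₀ hδ] at h4
    linarith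
  have hpt : ∀ s ∈ J, ‖f t‖ ^ 2 ≤ 2 * ‖f s‖ ^ 2 + 2 * m ^ 2 := by
    intro s hs
    have h1 : ‖∫ r in s..t, v r‖ ≤ m := by
      refine (intervalIntegral.norm_integral_le_integral_norm_uIoc).trans ?_
      refine setIntegral_mono_set hvJ.norm (Filter.Eventually.of_forall fun _ => norm_nonneg _) ?_
      refine LE.le.eventuallyLE (uIoc_subset_uIcc.trans ?_)
      exact (ordConnected_Icc).uIcc_subset hs htJ
    have h2 : ‖f t‖ ≤ ‖f s‖ + m := by
      rw [hfv s (hJs hs)]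
      exact (norm_add_le _ _).trans (by linarith)
    nlinarith [norm_nonneg (f t), norm_nonneg (f s), sq_nonneg (‖f s‖ - m)]
  have hf2 : ContinuousOn (fun s => ‖f s‖ ^ 2) (Icc a b) := (hf.norm).pow 2
  have hf2I : IntegrableOn (fun s => ‖f s‖ ^ 2) (Icc a b) :=
    hf2.integrableOn_compact isCompact_Icc
  have hint : ∫ _ in J, ‖f t‖ ^ 2 ≤ ∫ s in J, (2 * ‖f s‖ ^ 2 + 2 * m ^ 2) := by
    refine setIntegral_mono_on (integrableOn_const (by simp [hJ])) ?_ measurableSet_Icc hpt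
    exact ((hf2I.mono_set hJs).const_mul 2).add (integrableOn_const (by simp [hJ]))
  rw [setIntegral_const, hvol, integral_add ((hf2I.mono_set hJs).const_mul 2)
    (integrableOn_const (by simp [hJ])), integral_const_mul, setIntegral_const, hvol] at hint
  simp only [smul_eq_mul] at hint
  have hA : ∫ s in J, ‖f s‖ ^ 2 ≤ ∫ s in Icc a b, ‖f s‖ ^ 2 :=
    setIntegral_mono_set hf2I (Filter.Eventually.of_forall fun _ => by positivity)
      (LE.le.eventuallyLE hJs)
  have hB : ∫ s in J, ‖v s‖ ^ 2 ≤ ∫ s in Icc a b, ‖v s‖ ^ 2 :=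
    setIntegral_mono_set hv2 (Filter.Eventually.of_forall fun _ => by positivity)
      (LE.le.eventuallyLE hJs)
  have hC : m ^ 2 ≤ δ * ∫ s in Icc a b, ‖v s‖ ^ 2 :=
    hCS.trans (mul_le_mul_of_nonneg_left hB hδ.le)
  nlinarith [mul_le_mul_of_nonneg_left hC hδ.le]

section Paths

variable {H₀ H₁ : Type*} [NormedAddCommGroup H₀] [InnerProductSpace ℝ H₀] [CompleteSpace H₀]
  [NormedAddCommGroup H₁] [InnerProductSpace ℝ H₁] [CompleteSpace H₁] (P : HilbertPair H₀ H₁)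

/-- The path space `P₁([a, b]) = L²([a, b], H₁) ∩ W^{1,2}([a, b], H₀)`: an element is a pair of a
path `ξ ∈ L²([a, b], H₁)` and its (unique) weak derivative `ξ' ∈ L²([a, b], H₀)`, and the inner
product is `∫ ⟪ξ', η'⟫₀ + ∫ ⟪ξ, η⟫₁`. -/
noncomputable def pathSpace (a b : ℝ) : Submodule ℝ (WithLp 2 (PathL2 a b H₁ × PathL2 a b H₀)) where
  carrier := {x | IsWeakDeriv a b (fun s => P.incl (x.fst s)) x.snd}
  zero_mem' := by
    intro φ h1 h2 h3
    have e1 : ∫ s in Icc a b, deriv φ s • P.incl ((0 : PathL2 a b H₁) s) = 0 := by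
      refine integral_eq_zero_of_ae ?_
      filter_upwards [Lp.coeFn_zero H₁ 2 ((volume : Measure ℝ).restrict (Icc a b))] with s hs
      rw [hs]; simp
    have e2 : ∫ s in Icc a b, φ s • (0 : PathL2 a b H₀) s = 0 := by
      refine integral_eq_zero_of_ae ?_
      filter_upwards [Lp.coeFn_zero H₀ 2 ((volume : Measure ℝ).restrict (Icc a b))] with s hs
      rw [hs]; simp
    change ∫ s in Icc a b, deriv φ s • P.incl ((0 : PathL2 a b H₁) s) =
      -∫ s in Icc a b, φ s • (0 : PathL2 a b H₀) s
    rw [e1, e2, neg_zero]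
  add_mem' {x y} hx hy := by
    intro φ h1 h2 h3
    have hφ' : Continuous (deriv φ) := h1.continuous_deriv (by simp)
    have i1 := fun f : PathL2 a b H₁ => integrable_smul_of_test (E := H₀) hφ' h2.deriv
      (u := fun s => P.incl (f s)) (P.incl.integrable_comp (integrableOn_pathL2 f))
    have i2 := fun f : PathL2 a b H₀ => integrable_smul_of_test h1.continuous h2
      (integrableOn_pathL2 f)
    have e1 : ∫ s in Icc a b, deriv φ s • P.incl ((x.fst + y.fst) s) =
        (∫ s in Icc a b, deriv φ s • P.incl (x.fst s)) +
          ∫ s in Icc a b, deriv φ s • P.incl (y.fst s) := by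
      rw [← integral_add (i1 _) (i1 _)]
      refine integral_congr_ae ?_
      filter_upwards [Lp.coeFn_add x.fst y.fst] with s hs
      rw [hs, Pi.add_apply, map_add, smul_add]
    have e2 : ∫ s in Icc a b, φ s • (x.snd + y.snd) s =
        (∫ s in Icc a b, φ s • x.snd s) + ∫ s in Icc a b, φ s • y.snd s := by
      rw [← integral_add (i2 _) (i2 _)]
      refine integral_congr_ae ?_
      filter_upwards [Lp.coeFn_add x.snd y.snd] with s hs
      rw [hs, Pi.add_apply, smul_add]
    change ∫ s in Icc a b, deriv φ s • P.incl ((x.fst + y.fst) s) =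
      -∫ s in Icc a b, φ s • (x.snd + y.snd) s
    rw [e1, e2, hx φ h1 h2 h3, hy φ h1 h2 h3, neg_add]
  smul_mem' c x hx := by
    intro φ h1 h2 h3
    have e1 : ∫ s in Icc a b, deriv φ s • P.incl ((c • x.fst) s) =
        c • ∫ s in Icc a b, deriv φ s • P.incl (x.fst s) := by
      rw [← integral_smul]
      refine integral_congr_ae ?_
      filter_upwards [Lp.coeFn_smul c x.fst] with s hs
      rw [hs, Pi.smul_apply, map_smul, smul_comm]
    have e2 : ∫ s in Icc a b, φ s • (c • x.snd) s = c • ∫ s in Icc a b, φ s • x.snd s := by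
      rw [← integral_smul]
      refine integral_congr_ae ?_
      filter_upwards [Lp.coeFn_smul c x.snd] with s hs
      rw [hs, Pi.smul_apply, smul_comm]
    change ∫ s in Icc a b, deriv φ s • P.incl ((c • x.fst) s) =
      -∫ s in Icc a b, φ s • (c • x.snd) s
    rw [e1, e2, hx φ h1 h2 h3, smul_neg]

/-- The path `ξ ∈ L²([a, b], H₁)` underlying an element of `P₁([a, b])`. -/
noncomputable def path (a b : ℝ) : P.pathSpace a b →L[ℝ] PathL2 a b H₁ :=
  WithLp.fstL 2 ℝ _ _ ∘L (P.pathSpace a b).subtypeL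

/-- The weak derivative `ξ' ∈ L²([a, b], H₀)` of an element of `P₁([a, b])`. -/
noncomputable def pathDeriv (a b : ℝ) : P.pathSpace a b →L[ℝ] PathL2 a b H₀ :=
  WithLp.sndL 2 ℝ _ _ ∘L (P.pathSpace a b).subtypeL

theorem norm_sq_pathSpace {a b : ℝ} (x : P.pathSpace a b) :
    ‖x‖ ^ 2 = ‖P.path a b x‖ ^ 2 + ‖P.pathDeriv a b x‖ ^ 2 :=
  WithLp.prod_norm_sq_eq_of_L2 x.1

variable {a b : ℝ}

/-- Every element of `P₁([a, b])` has a (unique) absolutely continuous representative with values in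
`H₀`. -/
theorem exists_initial (hab : a < b) (x : P.pathSpace a b) :
    ∃ c : H₀, ∀ᵐ s ∂volume.restrict (Icc a b),
      P.incl (P.path a b x s) = c + ∫ r in a..s, P.pathDeriv a b x r :=
  IsWeakDeriv.exists_primitive hab (P.incl.integrable_comp (integrableOn_pathL2 _))
    (integrableOn_pathL2 _) x.2

/-- The continuous representative `[a, b] → H₀` of an element of `P₁([a, b])`. -/
noncomputable def rep (hab : a < b) (x : P.pathSpace a b) (s : ℝ) : H₀ :=
  (P.exists_initial hab x).choose + ∫ r in a..s, P.pathDeriv a b x r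

theorem rep_ae_eq (hab : a < b) (x : P.pathSpace a b) :
    ∀ᵐ s ∂volume.restrict (Icc a b), P.incl (P.path a b x s) = P.rep hab x s :=
  (P.exists_initial hab x).choose_spec

theorem continuousOn_rep (hab : a < b) (x : P.pathSpace a b) :
    ContinuousOn (P.rep hab x) (Icc a b) := by
  have := intervalIntegral.continuousOn_primitive_interval (a := a) (b := b)
    (f := P.pathDeriv a b x) (by simpa [uIcc_of_le hab.le] using integrableOn_pathL2 _)
  rw [uIcc_of_le hab.le] at this
  exact continuousOn_const.add this

theorem eqOn_of_ae_eq (hab : a < b) {f g : ℝ → H₀} (hf : ContinuousOn f (Icc a b))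
    (hg : ContinuousOn g (Icc a b)) (h : ∀ᵐ s ∂volume.restrict (Icc a b), f s = g s) :
    EqOn f g (Icc a b) :=
  Measure.eqOn_Icc_of_ae_eq volume hab.ne h hf hg

theorem rep_add (hab : a < b) (x y : P.pathSpace a b) {t : ℝ} (ht : t ∈ Icc a b) :
    P.rep hab (x + y) t = P.rep hab x t + P.rep hab y t := by
  refine eqOn_of_ae_eq (f := P.rep hab (x + y)) (g := fun t => P.rep hab x t + P.rep hab y t) hab
    (P.continuousOn_rep hab _) ((P.continuousOn_rep hab _).add (P.continuousOn_rep hab _)) ?_ ht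
  filter_upwards [P.rep_ae_eq hab x, P.rep_ae_eq hab y, P.rep_ae_eq hab (x + y),
    Lp.coeFn_add (P.path a b x) (P.path a b y)] with s h1 h2 h3 h4
  rw [← h1, ← h2, ← h3, map_add, h4, Pi.add_apply, map_add]

theorem rep_smul (hab : a < b) (c : ℝ) (x : P.pathSpace a b) {t : ℝ} (ht : t ∈ Icc a b) :
    P.rep hab (c • x) t = c • P.rep hab x t := by
  refine eqOn_of_ae_eq (f := P.rep hab (c • x)) (g := fun t => c • P.rep hab x t) hab
    (P.continuousOn_rep hab _) ((P.continuousOn_rep hab _).const_smul c) ?_ ht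
  filter_upwards [P.rep_ae_eq hab x, P.rep_ae_eq hab (c • x),
    Lp.coeFn_smul c (P.path a b x)] with s h1 h2 h4
  rw [← h1, ← h2, map_smul, h4, Pi.smul_apply, map_smul]

theorem sum_starProjection_le (F : Finset ℝ) (y : H₀) :
    ∑ κ ∈ F, ‖(P.eigen κ).starProjection y‖ ^ 2 ≤ ‖y‖ ^ 2 := by
  refine sum_norm_sq_le_of_orthogonal F _ (fun κ _ κ' _ h => ?_) y fun κ _ => ?_
  · obtain ⟨v, hv, hv2⟩ := P.mem_eigen.1 ((P.eigen κ).starProjection_apply_mem y)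
    obtain ⟨w, hw, hw2⟩ := P.mem_eigen.1 ((P.eigen κ').starProjection_apply_mem y)
    rw [← hv2, ← hw2]
    exact (P.inner_eigen_eq_zero h hv hw).2
  · have := Submodule.starProjection_inner_eq_zero (K := P.eigen κ) y _
      ((P.eigen κ).starProjection_apply_mem y)
    rw [inner_sub_left, real_inner_self_eq_norm_sq] at this
    linarith

theorem sum_starProjection_incl_le (F : Finset ℝ) (y : H₁) :
    ∑ κ ∈ F, κ⁻¹ * ‖(P.eigen κ).starProjection (P.incl y)‖ ^ 2 ≤ ‖y‖ ^ 2 := by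
  choose q hq hq2 using fun κ =>
    P.mem_eigen.1 ((P.eigen κ).starProjection_apply_mem (P.incl y))
  have hn : ∀ κ, κ⁻¹ * ‖(P.eigen κ).starProjection (P.incl y)‖ ^ 2 = ‖q κ‖ ^ 2 := by
    intro κ
    rcases le_or_gt κ 0 with h | h
    · rw [← hq2 κ, P.eq_zero_of_growth h (hq κ)]; simp
    · rw [← hq2 κ, P.norm_incl_sq_of_growth (hq κ), inv_mul_cancel_left₀ h.ne']
  simp only [hn]
  refine sum_norm_sq_le_of_orthogonal F q (fun κ _ κ' _ h => ?_) y fun κ _ => ?_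
  · exact (P.inner_eigen_eq_zero h (hq κ) (hq κ')).1
  · rcases le_or_gt κ 0 with h | h
    · rw [P.eq_zero_of_growth h (hq κ)]; simp
    · have h1 : ⟪P.incl y, P.incl (q κ)⟫_ℝ = ‖P.incl (q κ)‖ ^ 2 := by
        have := Submodule.starProjection_inner_eq_zero (K := P.eigen κ) (P.incl y) _
          ((P.eigen κ).starProjection_apply_mem (P.incl y))
        rw [inner_sub_left, real_inner_self_eq_norm_sq, ← hq2 κ] at this
        linarith
      rw [← P.inner_growth, hq κ, inner_smul_right, P.norm_incl_sq_of_growth (hq κ)] at h1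
      exact mul_left_cancel₀ h.ne' h1

theorem sum_halfCoeff_rep_le (hab : a < b) (x : P.pathSpace a b) {t : ℝ} (ht : t ∈ Icc a b)
    (F : Finset ℝ) : ∑ κ ∈ F, ‖P.halfCoeff (P.rep hab x t) κ‖ ^ 2 ≤
      (2 / ((b - a) / √(‖P.incl‖ ^ 2 + 1)) + 2 * ((b - a) / √(‖P.incl‖ ^ 2 + 1))) * ‖x‖ ^ 2 := by
  set M : ℝ := ‖P.incl‖ ^ 2 + 1 with hM
  have hM0 : 0 < M := by positivity
  set c : ℝ := (b - a) / √M with hc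
  have hc0 : 0 < c := div_pos (by linarith) (Real.sqrt_pos.2 hM0)
  set f := P.path a b x with hf
  set v := P.pathDeriv a b x with hv
  have hvI : IntegrableOn v (Icc a b) := integrableOn_pathL2 v
  have hprojI1 : ∀ κ, IntegrableOn
      (fun s => ‖(P.eigen κ).starProjection (P.incl (f s))‖ ^ 2) (Icc a b) := fun κ =>
    integrableOn_norm_sq_pathL2
      (((P.eigen κ).starProjection ∘L P.incl).compLp f) |>.congr (by
        filter_upwards [((P.eigen κ).starProjection ∘L P.incl).coeFn_compLp f] with s hs
        simp [hs])
  have hprojI2 : ∀ κ, IntegrableOn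
      (fun s => ‖(P.eigen κ).starProjection (v s)‖ ^ 2) (Icc a b) := fun κ =>
    integrableOn_norm_sq_pathL2 (((P.eigen κ).starProjection).compLp v) |>.congr (by
        filter_upwards [((P.eigen κ).starProjection).coeFn_compLp v] with s hs
        simp [hs])
  have hcomp : ∀ κ, ‖P.halfCoeff (P.rep hab x t) κ‖ ^ 2 ≤
      (2 / c) * (∫ s in Icc a b, κ⁻¹ * ‖(P.eigen κ).starProjection (P.incl (f s))‖ ^ 2) +
        2 * c * ∫ s in Icc a b, ‖(P.eigen κ).starProjection (v s)‖ ^ 2 := by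
    intro κ
    by_cases hbot : P.eigen κ = ⊥
    · have : P.halfCoeff (P.rep hab x t) κ = 0 := by simp [halfCoeff, hbot]
      rw [this]
      simp [hbot]
    have hκ : 0 < κ := by
      by_contra hcon
      exact hbot (P.eigen_eq_bot (not_lt.1 hcon))
    have hκM : κ ≤ M := by
      obtain ⟨y, hy, hy0⟩ := Submodule.exists_mem_ne_zero_of_ne_bot hbot
      obtain ⟨w, hw, rfl⟩ := P.mem_eigen.1 hy
      have hw0 : w ≠ 0 := by rintro rfl; simp at hy0
      have h1 := P.norm_incl_sq_of_growth hw
      have h2 : ‖P.incl w‖ ^ 2 ≤ ‖P.incl‖ ^ 2 * ‖w‖ ^ 2 := by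
        rw [← mul_pow]
        exact pow_le_pow_left₀ (norm_nonneg _) (P.incl.le_opNorm w) 2
      rw [h1] at h2
      have h3 := le_of_mul_le_mul_right h2 (by positivity)
      linarith
    set δ : ℝ := c * √κ with hδ
    have hsκ : 0 < √κ := Real.sqrt_pos.2 hκ
    have hδ0 : 0 < δ := mul_pos hc0 hsκ
    have hδ1 : δ ≤ b - a := by
      have h1 : √κ ≤ √M := Real.sqrt_le_sqrt hκM
      calc δ ≤ c * √M := mul_le_mul_of_nonneg_left h1 hc0.le
        _ = b - a := div_mul_cancel₀ _ (Real.sqrt_pos.2 hM0).ne'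
    have hvint : ∀ s ∈ Icc a b, IntervalIntegrable v volume a s := fun s hs =>
      (intervalIntegrable_iff_integrableOn_Icc_of_le hs.1).2
        (hvI.mono_set (Icc_subset_Icc_right hs.2))
    have key := trace_estimate (E := H₀) ht hδ0 hδ1
      (f := fun s => (P.eigen κ).starProjection (P.rep hab x s))
      (v := fun s => (P.eigen κ).starProjection (v s))
      ((P.eigen κ).starProjection.continuous.comp_continuousOn (P.continuousOn_rep hab x))
      ((P.eigen κ).starProjection.integrable_comp hvI) (hprojI2 κ)
      (by
        intro s hs
        have hst : IntervalIntegrable v volume s t := (hvint s hs).symm.trans (hvint t ht)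
        rw [ContinuousLinearMap.intervalIntegral_comp_comm _ hst, ← map_add]
        congr 1
        simp only [rep]
        rw [add_assoc, intervalIntegral.integral_add_adjacent_intervals (hvint s hs) hst])
    have e1 : ∫ s in Icc a b, ‖(P.eigen κ).starProjection (P.rep hab x s)‖ ^ 2 =
        ∫ s in Icc a b, ‖(P.eigen κ).starProjection (P.incl (f s))‖ ^ 2 := by
      refine integral_congr_ae ?_
      filter_upwards [P.rep_ae_eq hab x] with s hs
      rw [hs]
    rw [e1] at key
    set I1 := ∫ s in Icc a b, ‖(P.eigen κ).starProjection (P.incl (f s))‖ ^ 2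
    set I2 := ∫ s in Icc a b, ‖(P.eigen κ).starProjection (v s)‖ ^ 2
    rw [integral_const_mul]
    have e2 : ‖P.halfCoeff (P.rep hab x t) κ‖ ^ 2 =
        (√κ)⁻¹ * ‖(P.eigen κ).starProjection (P.rep hab x t)‖ ^ 2 := by
      rw [halfCoeff, norm_smul, mul_pow, Real.norm_of_nonneg (Real.rpow_nonneg hκ.le _),
        ← Real.rpow_natCast, ← Real.rpow_mul hκ.le, Real.sqrt_eq_rpow, ← Real.rpow_neg hκ.le]
      norm_num
    rw [e2]
    have hκs : κ = √κ * √κ := (Real.mul_self_sqrt hκ.le).symm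
    have h5 : ‖(P.eigen κ).starProjection (P.rep hab x t)‖ ^ 2 ≤ (2 * I1 + 2 * δ ^ 2 * I2) / δ := by
      rw [le_div_iff₀ hδ0]; linarith
    calc (√κ)⁻¹ * ‖(P.eigen κ).starProjection (P.rep hab x t)‖ ^ 2
        ≤ (√κ)⁻¹ * ((2 * I1 + 2 * δ ^ 2 * I2) / δ) :=
          mul_le_mul_of_nonneg_left h5 (by positivity)
      _ = 2 / c * ((√κ * √κ)⁻¹ * I1) + 2 * c * I2 := by
          rw [hδ]; field_simp
      _ = 2 / c * (κ⁻¹ * I1) + 2 * c * I2 := by rw [← hκs]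
  have s1 : ∑ κ ∈ F, ∫ s in Icc a b, κ⁻¹ * ‖(P.eigen κ).starProjection (P.incl (f s))‖ ^ 2 ≤
      ‖f‖ ^ 2 := by
    rw [← integral_finsetSum F fun κ _ => (hprojI1 κ).const_mul _, norm_sq_pathL2]
    exact integral_mono (integrable_finsetSum F fun κ _ => (hprojI1 κ).const_mul _)
      (integrableOn_norm_sq_pathL2 f) fun s => P.sum_starProjection_incl_le F (f s)
  have s2 : ∑ κ ∈ F, ∫ s in Icc a b, ‖(P.eigen κ).starProjection (v s)‖ ^ 2 ≤ ‖v‖ ^ 2 := by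
    rw [← integral_finsetSum F fun κ _ => hprojI2 κ, norm_sq_pathL2]
    exact integral_mono (integrable_finsetSum F fun κ _ => hprojI2 κ)
      (integrableOn_norm_sq_pathL2 v) fun s => P.sum_starProjection_le F (v s)
  refine (Finset.sum_le_sum fun κ _ => hcomp κ).trans ?_
  rw [Finset.sum_add_distrib, ← Finset.mul_sum, ← Finset.mul_sum, P.norm_sq_pathSpace]
  have t1 := mul_le_mul_of_nonneg_left s1 (show 0 ≤ 2 / c by positivity)
  have t2 := mul_le_mul_of_nonneg_left s2 (show 0 ≤ 2 * c by positivity)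
  have t3 : 0 ≤ 2 / c * ‖v‖ ^ 2 := by positivity
  have t4 : 0 ≤ 2 * c * ‖f‖ ^ 2 := by positivity
  nlinarith

/-- The linear evaluation map `P₁([a, b]) → H_{1/2}`, `ξ ↦ ξ(t)`. -/
noncomputable def evalLinear (hab : a < b) (t : Icc a b) : P.pathSpace a b →ₗ[ℝ] P.Half where
  toFun x := ⟨P.rep hab x t, memℓp_gen' (C := (2 / ((b - a) / √(‖P.incl‖ ^ 2 + 1)) +
    2 * ((b - a) / √(‖P.incl‖ ^ 2 + 1))) * ‖x‖ ^ 2) fun F => by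
      simpa using P.sum_halfCoeff_rep_le hab x t.2 F⟩
  map_add' x y := Subtype.ext (P.rep_add hab x y t.2)
  map_smul' c x := Subtype.ext (P.rep_smul hab c x t.2)

/-- The bounded evaluation map `P₁([a, b]) → H_{1/2}`, `ξ ↦ ξ(t)`, where `ξ(t)` is the value at `t`
of the continuous representative. -/
noncomputable def eval (hab : a < b) (t : Icc a b) : P.pathSpace a b →L[ℝ] P.Half :=
  (P.evalLinear hab t).mkContinuous (√(2 / ((b - a) / √(‖P.incl‖ ^ 2 + 1)) +
    2 * ((b - a) / √(‖P.incl‖ ^ 2 + 1)))) fun x => by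
      have hc : 0 < (b - a) / √(‖P.incl‖ ^ 2 + 1) := div_pos (by linarith) (by positivity)
      have h1 : ‖P.evalLinear hab t x‖ ^ 2 ≤ (2 / ((b - a) / √(‖P.incl‖ ^ 2 + 1)) +
          2 * ((b - a) / √(‖P.incl‖ ^ 2 + 1))) * ‖x‖ ^ 2 := by
        change ‖Half.coeff P (P.evalLinear hab t x)‖ ^ 2 ≤ _
        have h2 := lp.norm_rpow_eq_tsum (p := 2) (by norm_num)
          (Half.coeff P (P.evalLinear hab t x))
        simp only [ENNReal.toReal_ofNat, Real.rpow_ofNat] at h2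
        rw [h2]
        exact Real.tsum_le_of_sum_le (fun _ => by positivity)
          fun F => P.sum_halfCoeff_rep_le hab x t.2 F
      refine le_of_sq_le_sq ?_ (by positivity)
      rw [mul_pow, Real.sq_sqrt (by positivity)]
      exact h1

theorem val_eval (hab : a < b) (t : Icc a b) (x : P.pathSpace a b) :
    Half.val P (P.eval hab t x) = P.rep hab x t := rfl

theorem norm_IccExtend_le (hab : a < b) (A : C(Icc a b, H₁ →L[ℝ] H₀)) (s : ℝ) (x : H₁) :
    ‖IccExtend hab.le A s x‖ ≤ ‖A‖ * ‖x‖ :=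
  ((IccExtend hab.le A s).le_opNorm _).trans
    (mul_le_mul_of_nonneg_right (A.norm_coe_le_norm _) (norm_nonneg _))

theorem memLp_mul (hab : a < b) (A : C(Icc a b, H₁ →L[ℝ] H₀)) (ξ : PathL2 a b H₁) :
    MemLp (fun s => IccExtend hab.le A s (ξ s)) 2 ((volume : Measure ℝ).restrict (Icc a b)) :=
  (Lp.memLp ξ).of_le_mul (c := ‖A‖)
    (isBoundedBilinearMap_apply.continuous.comp_aestronglyMeasurable
      ((A.continuous.Icc_extend' (h := hab.le)).aestronglyMeasurable.prodMk
        (Lp.aestronglyMeasurable ξ)))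
    (Filter.Eventually.of_forall fun s => norm_IccExtend_le hab A s (ξ s))

/-- The multiplication operator `L²([a, b], H₁) → L²([a, b], H₀)`, `(A ξ)(s) = A(s) ξ(s)`. (The
values of `IccExtend` outside of `[a, b]` play no role.) -/
noncomputable def mulOp (hab : a < b) (A : C(Icc a b, H₁ →L[ℝ] H₀)) :
    PathL2 a b H₁ →L[ℝ] PathL2 a b H₀ :=
  LinearMap.mkContinuous
    { toFun := fun ξ => (memLp_mul hab A ξ).toLp
      map_add' := fun ξ η => by
        rw [← MemLp.toLp_add]
        refine MemLp.toLp_congr _ _ ?_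
        filter_upwards [Lp.coeFn_add ξ η] with s hs
        rw [hs, Pi.add_apply, map_add, Pi.add_apply]
      map_smul' := fun c ξ => by
        rw [RingHom.id_apply, ← MemLp.toLp_const_smul]
        refine MemLp.toLp_congr _ _ ?_
        filter_upwards [Lp.coeFn_smul c ξ] with s hs
        rw [hs, Pi.smul_apply, map_smul, Pi.smul_apply] } ‖A‖ fun ξ => by
      refine Lp.norm_le_mul_norm_of_ae_le_mul ?_
      filter_upwards [(memLp_mul hab A ξ).coeFn_toLp] with s hs
      simp only [LinearMap.coe_mk, AddHom.coe_mk]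
      rw [hs]
      exact norm_IccExtend_le hab A s (ξ s)

theorem mulOp_ae_eq (hab : a < b) (A : C(Icc a b, H₁ →L[ℝ] H₀)) (ξ : PathL2 a b H₁) :
    ∀ᵐ s ∂volume.restrict (Icc a b), mulOp hab A ξ s = IccExtend hab.le A s (ξ s) :=
  (memLp_mul hab A ξ).coeFn_toLp

/-- The operator `D_A = ∂_s + A : P₁([a, b]) → P₀([a, b]) = L²([a, b], H₀)`. -/
noncomputable def opD (hab : a < b) (A : C(Icc a b, H₁ →L[ℝ] H₀)) :
    P.pathSpace a b →L[ℝ] PathL2 a b H₀ :=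
  P.pathDeriv a b + mulOp hab A ∘L P.path a b

/-- The restriction of a path on `[a, b]` to a subinterval `[c, d]`. -/
noncomputable def restrictPath {c d : ℝ} (A : C(Icc a b, H₁ →L[ℝ] H₀)) (h : Icc c d ⊆ Icc a b) :
    C(Icc c d, H₁ →L[ℝ] H₀) :=
  A.comp (ContinuousMap.inclusion h)

/-- The augmented operator `𝔇_A : P₁([a, b]) → P₀([a, b]) × H^+_{1/2}(A(a)) × H^-_{1/2}(A(b))`,
`ξ ↦ (D_A ξ, π_+ ξ(a), π_- ξ(b))`. -/
noncomputable def augmented (hab : a < b) (A : C(Icc a b, H₁ →L[ℝ] H₀)) :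
    P.pathSpace a b →L[ℝ] PathL2 a b H₀ ×
      P.halfPos (A ⟨a, left_mem_Icc.2 hab.le⟩) × P.halfNeg (A ⟨b, right_mem_Icc.2 hab.le⟩) :=
  (P.opD hab A).prod
    ((P.projPos (A ⟨a, left_mem_Icc.2 hab.le⟩) ∘L P.eval hab ⟨a, left_mem_Icc.2 hab.le⟩).prod
      (P.projNeg (A ⟨b, right_mem_Icc.2 hab.le⟩) ∘L P.eval hab ⟨b, right_mem_Icc.2 hab.le⟩))

end Paths

end HilbertPair

/-! ### Linear algebra of the index. -/

section AlgebraicIndex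

variable {U V W : Type*} [AddCommGroup U] [Module ℝ U] [AddCommGroup V] [Module ℝ V]
  [AddCommGroup W] [Module ℝ W]

/-! Everything is compared with the constant path at an invertible Hessian 𝔸. Such an 𝔸 is diagonal
in suitable ℓ² coordinates of H₀, because 𝔸⁻¹ followed by the inclusion is compact, and symmetric
for an equivalent inner product (`nonempty_spectralFrame`). In each coordinate ∂ₛ + 𝔸 becomes u' +
λu, and the energy identity ‖u' + λu‖² = ‖u'‖² + ‖λu‖² + λ(u(b)² − u(a)²) shows that u is controlled
once u(a) is prescribed for λ > 0 and u(b) for λ < 0. The weight |λ| of these boundary terms is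
bounded by the norm of H_{1/2}. Hence ∂ₛ + 𝔸 with its own spectral boundary conditions is an
isomorphism (`exists_equiv_bdryOp_const`).

Fredholm property. The inclusion of P₁ into L²([a,b], H₀) is a norm limit of finite rank operators
(`isApproximable_pathIncl`), so terms that factor through it are harmless. Every Hessian becomes
invertible after adding a bounded operator of H₀ (`exists_add_isInvertible`); therefore a path that
stays near one Hessian gives a Fredholm operator for some auxiliary boundary conditions.
Multiplication with a cutoff function χ commutes with ∂ₛ + A up to χ', which is again harmless, so
that partitions of unity patch such local results together (`isFredholm_bdryOp_of_glue`,
`isFredholm_bdryOp`). For this purpose `bdryOp` lets the boundary operators be independent of the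
path; `augmented` is the case where they are its end values.

Index. A path on [−T, T] is a pair of paths on the two halves whose jump at 0 vanishes in H_{1/2},
and every element of H_{1/2} is a jump. So 𝔇_A has the same index as the operator on pairs that has
the jump as an additional component of its value (`algIndex_of_constraint`). Splitting the jump by
the projections π_± of 𝔸 = A(0) turns this operator into the direct sum of the two augmented
operators minus the coupling terms π_+ x(0) and π_- y(0) (`coupledOp`,
`fredholmIndex_bdryOp_eq_coupledOp`).

The coupling terms are neither small nor compact. However, solutions of ∂ₛ + 𝔸 respect the spectral
splitting, so if χ is 1 at the common end and vanishes at the other one, π_+ x(0) can be computed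
from (∂ₛ + 𝔸)(χx) = χ(∂ₛ + A)x − χ(A − 𝔸)x + χ'x by a fixed bounded operator. The first term depends
only on the value of the operator at x, the second is small if χ is supported close to 0, the third
is approximable (`exists_projPos_eval_right_approx`, `exists_projNeg_eval_left_approx`). Thus the
coupled operator is (1 − M) composed with the direct sum, where M² = 0, up to small and approximable
terms, and the index is that of the direct sum (`fredholmIndex_coupling`). -/

/-- The algebraic index `dim ker f - dim coker f` of a linear map. -/
noncomputable def LinearMap.algIndex (f : U →ₗ[ℝ] V) : ℤ :=
  (Module.finrank ℝ f.ker : ℤ) - (Module.finrank ℝ (V ⧸ f.range) : ℤ)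

/-- The maps φ, ψ, χ, θ below are the inner maps of the exact sequence 0 → ker T → ker ST → ker S →
coker T → coker ST → coker S → 0. The alternating sum of the dimensions vanishes by rank-nullity for
each of them. -/
theorem LinearMap.algIndex_comp (S : V →ₗ[ℝ] W) (T : U →ₗ[ℝ] V)
    [FiniteDimensional ℝ S.ker] [FiniteDimensional ℝ (V ⧸ T.range)]
    [FiniteDimensional ℝ (S ∘ₗ T).ker] [FiniteDimensional ℝ (W ⧸ (S ∘ₗ T).range)] :
    (S ∘ₗ T).algIndex = S.algIndex + T.algIndex := by
  have hφ0 : ∀ x ∈ (S ∘ₗ T).ker, T x ∈ S.ker := fun x hx => by simpa using hx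
  set φ : (S ∘ₗ T).ker →ₗ[ℝ] S.ker := T.restrict hφ0 with hφ
  set ψ : S.ker →ₗ[ℝ] V ⧸ T.range := T.range.mkQ ∘ₗ S.ker.subtype with hψ
  have hχ0 : T.range ≤ (S ∘ₗ T).range.comap S := by
    rintro _ ⟨x, rfl⟩; exact ⟨x, rfl⟩
  set χ : (V ⧸ T.range) →ₗ[ℝ] W ⧸ (S ∘ₗ T).range := T.range.mapQ _ S hχ0 with hχ
  have hθ0 : (S ∘ₗ T).range ≤ S.range := by
    rintro _ ⟨x, rfl⟩; exact ⟨T x, rfl⟩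
  set θ : (W ⧸ (S ∘ₗ T).range) →ₗ[ℝ] W ⧸ S.range := Submodule.factor hθ0 with hθ
  have r1 := φ.finrank_range_add_finrank_ker
  have r2 := ψ.finrank_range_add_finrank_ker
  have r3 := χ.finrank_range_add_finrank_ker
  have r4 := θ.finrank_range_add_finrank_ker
  have e1 : Module.finrank ℝ φ.ker = Module.finrank ℝ T.ker := by
    refine LinearEquiv.finrank_eq (LinearEquiv.ofBijective
      (LinearMap.restrict (S ∘ₗ T).ker.subtype (p := φ.ker) (q := T.ker) ?_) ⟨?_, ?_⟩)
    · rintro ⟨x, hx⟩ h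
      have := congrArg Subtype.val (LinearMap.mem_ker.1 h)
      simpa [hφ] using this
    · rintro ⟨⟨x, hx⟩, h⟩ ⟨⟨y, hy⟩, h'⟩ hxy
      have := congrArg Subtype.val hxy
      simpa using this
    · rintro ⟨x, hx⟩
      have hx' : T x = 0 := hx
      refine ⟨⟨⟨x, by simp [hx']⟩, ?_⟩, rfl⟩
      exact Subtype.ext hx'
  have e2 : ψ.ker = φ.range := by
    ext ⟨y, hy⟩
    simp only [hψ, LinearMap.mem_ker, LinearMap.comp_apply, Submodule.mkQ_apply,
      Submodule.Quotient.mk_eq_zero, LinearMap.mem_range, Submodule.subtype_apply]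
    constructor
    · rintro ⟨x, rfl⟩
      exact ⟨⟨x, by simpa using hy⟩, rfl⟩
    · rintro ⟨x, hx⟩
      exact ⟨x, congrArg Subtype.val hx⟩
  have e3 : χ.ker = ψ.range := by
    ext z
    obtain ⟨y, rfl⟩ := T.range.mkQ_surjective z
    simp only [hχ, LinearMap.mem_ker, Submodule.mkQ_apply, Submodule.mapQ_apply,
      Submodule.Quotient.mk_eq_zero, LinearMap.mem_range, LinearMap.comp_apply, hψ,
      Submodule.subtype_apply]
    constructor
    · rintro ⟨x, hx⟩
      refine ⟨⟨y - T x, by simp [hx]⟩, ?_⟩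
      rw [Submodule.Quotient.eq]
      exact ⟨-x, by simp⟩
    · rintro ⟨⟨w, hw⟩, h⟩
      rw [Submodule.Quotient.eq] at h
      obtain ⟨x, hx⟩ := h
      have hw' : S w = 0 := hw
      refine ⟨-x, ?_⟩
      simp only at hx
      rw [map_neg, hx, map_neg, map_sub, hw']; simp
  have e4 : θ.ker = χ.range := by
    ext z
    obtain ⟨w, rfl⟩ := (S ∘ₗ T).range.mkQ_surjective z
    have hz : θ ((S ∘ₗ T).range.mkQ w) = S.range.mkQ w := rfl
    rw [LinearMap.mem_ker, hz, Submodule.mkQ_apply, Submodule.Quotient.mk_eq_zero]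
    simp only [LinearMap.mem_range, hχ]
    constructor
    · rintro ⟨y, rfl⟩
      exact ⟨T.range.mkQ y, by simp⟩
    · rintro ⟨y, hy⟩
      obtain ⟨v, rfl⟩ := T.range.mkQ_surjective y
      simp only [Submodule.mkQ_apply, Submodule.mapQ_apply] at hy
      rw [Submodule.Quotient.eq] at hy
      obtain ⟨x, hx⟩ := hy
      refine ⟨v - T x, ?_⟩
      rw [LinearMap.comp_apply] at hx
      rw [map_sub, hx]; abel
  have e5 : Module.finrank ℝ θ.range = Module.finrank ℝ (W ⧸ S.range) := by
    rw [LinearMap.range_eq_top.2 (Submodule.factor_surjective hθ0), finrank_top]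
  rw [e1] at r1
  rw [e2] at r2
  rw [e3] at r3
  rw [e4, e5] at r4
  simp only [LinearMap.algIndex]
  omega

theorem LinearMap.algIndex_of_equiv {U' V' : Type*} [AddCommGroup U'] [Module ℝ U']
    [AddCommGroup V'] [Module ℝ V'] (f : U →ₗ[ℝ] V) (g : U' →ₗ[ℝ] V') (e : U ≃ₗ[ℝ] U')
    (e' : V ≃ₗ[ℝ] V') (h : ∀ x, g (e x) = e' (f x)) : f.algIndex = g.algIndex := by
  have h1 : Module.finrank ℝ f.ker = Module.finrank ℝ g.ker := by
    have : f.ker.map (e : U →ₗ[ℝ] U') = g.ker := by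
      ext y
      simp only [Submodule.mem_map, LinearMap.mem_ker]
      constructor
      · rintro ⟨x, hx, rfl⟩
        have := h x
        rw [hx, map_zero] at this
        simpa using this
      · intro hy
        refine ⟨e.symm y, ?_, by simp⟩
        have := h (e.symm y)
        rw [LinearEquiv.apply_symm_apply, hy] at this
        exact e'.injective (by rw [← this, map_zero])
    rw [← this]
    exact (e.submoduleMap f.ker).finrank_eq
  have h2 : Module.finrank ℝ (V ⧸ f.range) = Module.finrank ℝ (V' ⧸ g.range) := by
    refine (Submodule.Quotient.equiv f.range g.range e' ?_).finrank_eq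
    ext y
    simp only [Submodule.mem_map, LinearMap.mem_range]
    constructor
    · rintro ⟨_, ⟨x, rfl⟩, rfl⟩
      exact ⟨e x, h x⟩
    · rintro ⟨x, rfl⟩
      refine ⟨f (e.symm x), ⟨_, rfl⟩, ?_⟩
      rw [LinearEquiv.coe_coe, ← h, LinearEquiv.apply_symm_apply]
  simp [LinearMap.algIndex, h1, h2]

/-- A finite rank perturbation of the identity has index zero. -/
theorem LinearMap.algIndex_id_add (F : V →ₗ[ℝ] V) [FiniteDimensional ℝ F.range] :
    (LinearMap.id + F).algIndex = 0 := by
  set G : V →ₗ[ℝ] V := LinearMap.id + F with hG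
  have hGx : ∀ x, G x = x + F x := fun x => rfl
  have hmaps : ∀ x ∈ F.range, G x ∈ F.range := fun x hx =>
    F.range.add_mem hx ⟨x, rfl⟩
  -- The range of `F` is invariant under 1 + F. The kernel and the cokernel of 1 + F agree with
  -- those of its restriction `g`, an endomorphism of a finite dimensional space.
  set g : F.range →ₗ[ℝ] F.range := G.restrict hmaps with hg
  have hgx : ∀ x : F.range, (g x : V) = G x := fun x => rfl
  have r := g.finrank_range_add_finrank_ker
  have r' := g.range.finrank_quotient_add_finrank
  have e1 : Module.finrank ℝ g.ker = Module.finrank ℝ G.ker := by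
    refine LinearEquiv.finrank_eq (LinearEquiv.ofBijective
      (LinearMap.restrict F.range.subtype (p := g.ker) (q := G.ker) ?_) ⟨?_, ?_⟩)
    · intro x h
      have := congrArg Subtype.val (LinearMap.mem_ker.1 h)
      rw [hgx] at this
      simpa using this
    · rintro ⟨⟨x, hx⟩, h⟩ ⟨⟨y, hy⟩, h'⟩ hxy
      have := congrArg Subtype.val hxy
      simpa using this
    · rintro ⟨x, hx⟩
      have hx' : G x = 0 := hx
      have hx2 : x ∈ F.range := ⟨-x, by
        rw [hGx] at hx'; rw [map_neg]; exact (eq_neg_of_add_eq_zero_left hx').symm⟩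
      exact ⟨⟨⟨x, hx2⟩, Subtype.ext hx'⟩, rfl⟩
  have hq : g.range ≤ G.range.comap F.range.subtype := by
    rintro _ ⟨x, rfl⟩; exact ⟨x, rfl⟩
  have e2 : Module.finrank ℝ (F.range ⧸ g.range) = Module.finrank ℝ (V ⧸ G.range) := by
    refine LinearEquiv.finrank_eq (LinearEquiv.ofBijective
      (g.range.mapQ G.range F.range.subtype hq) ⟨?_, ?_⟩)
    · rw [← LinearMap.ker_eq_bot, LinearMap.ker_eq_bot']
      intro z hz
      obtain ⟨⟨y, hy⟩, rfl⟩ := g.range.mkQ_surjective z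
      rw [Submodule.mkQ_apply] at hz ⊢
      rw [Submodule.mapQ_apply, Submodule.Quotient.mk_eq_zero] at hz
      rw [Submodule.Quotient.mk_eq_zero]
      obtain ⟨x, hx⟩ := hz
      have hx2 : x ∈ F.range := by
        have : x = y - F x := by rw [eq_sub_iff_add_eq, ← hGx, hx]; rfl
        rw [this]
        exact F.range.sub_mem hy ⟨x, rfl⟩
      exact ⟨⟨x, hx2⟩, Subtype.ext hx⟩
    · intro z
      obtain ⟨y, rfl⟩ := G.range.mkQ_surjective z
      -- Since y + F y lies in the range of `G`, the class of y is represented by −F y.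
      refine ⟨g.range.mkQ ⟨-F y, -y, by simp⟩, ?_⟩
      rw [Submodule.mkQ_apply, Submodule.mapQ_apply, Submodule.mkQ_apply, Submodule.Quotient.eq]
      refine ⟨-y, ?_⟩
      rw [hGx]
      simp only [map_neg, Submodule.subtype_apply]
      abel
  simp only [LinearMap.algIndex]
  omega

/-- The index of an operator is not changed when it is extended by a surjective constraint and
restricted to the kernel of this constraint. -/
theorem LinearMap.algIndex_of_constraint {X X' Z Z' Q : Type*}
    [AddCommGroup X] [Module ℝ X] [AddCommGroup X'] [Module ℝ X'] [AddCommGroup Z] [Module ℝ Z]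
    [AddCommGroup Z'] [Module ℝ Z'] [AddCommGroup Q] [Module ℝ Q]
    (D : X →ₗ[ℝ] Z) (ρ : X →ₗ[ℝ] X') (hρ : Function.Injective ρ) (δ : X' →ₗ[ℝ] Q)
    (hδ : Function.Surjective δ) (hρδ : ρ.range = δ.ker) (F : X' →ₗ[ℝ] Z') (r : Z ≃ₗ[ℝ] Z')
    (h : ∀ x, F (ρ x) = r (D x)) : (F.prod δ).algIndex = D.algIndex := by
  have hk : ∀ x, δ (ρ x) = 0 := fun x => by
    have : ρ x ∈ δ.ker := hρδ ▸ LinearMap.mem_range_self ρ x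
    exact this
  have e1 : Module.finrank ℝ D.ker = Module.finrank ℝ (F.prod δ).ker := by
    have : D.ker.map ρ = (F.prod δ).ker := by
      ext y
      simp only [Submodule.mem_map, LinearMap.mem_ker, LinearMap.prod_apply, Function.prod,
        Prod.mk_eq_zero]
      constructor
      · rintro ⟨x, hx, rfl⟩
        exact ⟨by rw [h, hx, map_zero], hk x⟩
      · rintro ⟨h1, h2⟩
        have : y ∈ ρ.range := hρδ ▸ h2
        obtain ⟨x, rfl⟩ := this
        refine ⟨x, r.injective ?_, rfl⟩
        rw [← h, h1, map_zero]
    rw [← this]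
    exact (Submodule.equivMapOfInjective ρ hρ D.ker).finrank_eq
  have hq : D.range ≤ (F.prod δ).range.comap (LinearMap.inl ℝ Z' Q ∘ₗ (r : Z →ₗ[ℝ] Z')) := by
    rintro _ ⟨x, rfl⟩
    exact ⟨ρ x, by simp [h, hk]⟩
  have e2 : Module.finrank ℝ (Z ⧸ D.range) = Module.finrank ℝ ((Z' × Q) ⧸ (F.prod δ).range) := by
    refine LinearEquiv.finrank_eq (LinearEquiv.ofBijective
      (D.range.mapQ _ (LinearMap.inl ℝ Z' Q ∘ₗ (r : Z →ₗ[ℝ] Z')) hq) ⟨?_, ?_⟩)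
    · rw [← LinearMap.ker_eq_bot, LinearMap.ker_eq_bot']
      intro z hz
      obtain ⟨y, rfl⟩ := D.range.mkQ_surjective z
      rw [Submodule.mkQ_apply] at hz ⊢
      rw [Submodule.mapQ_apply, Submodule.Quotient.mk_eq_zero] at hz
      rw [Submodule.Quotient.mk_eq_zero]
      obtain ⟨w, hw⟩ := hz
      simp only [LinearMap.prod_apply, Function.prod, LinearMap.comp_apply, LinearMap.inl_apply,
        Prod.mk.injEq] at hw
      have : w ∈ ρ.range := hρδ ▸ hw.2
      obtain ⟨x, rfl⟩ := this
      refine ⟨x, r.injective ?_⟩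
      rw [← h, hw.1]; rfl
    · intro z
      obtain ⟨⟨y, q⟩, rfl⟩ := (F.prod δ).range.mkQ_surjective z
      obtain ⟨w, hw⟩ := hδ q
      -- Subtracting the image of a lift w of q makes the constraint component of (y, q) zero.
      refine ⟨D.range.mkQ (r.symm (y - F w)), ?_⟩
      rw [Submodule.mkQ_apply, Submodule.mapQ_apply, Submodule.mkQ_apply, Submodule.Quotient.eq]
      refine ⟨-w, ?_⟩
      simp [hw]
  simp [LinearMap.algIndex, e1, e2]

theorem LinearMap.algIndex_prodMap {U' V' : Type*} [AddCommGroup U'] [Module ℝ U']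
    [AddCommGroup V'] [Module ℝ V'] (f : U →ₗ[ℝ] V) (g : U' →ₗ[ℝ] V')
    [FiniteDimensional ℝ f.ker] [FiniteDimensional ℝ (V ⧸ f.range)]
    [FiniteDimensional ℝ g.ker] [FiniteDimensional ℝ (V' ⧸ g.range)] :
    (f.prodMap g).algIndex = f.algIndex + g.algIndex := by
  have h1 : Module.finrank ℝ (f.prodMap g).ker =
      Module.finrank ℝ f.ker + Module.finrank ℝ g.ker := by
    rw [LinearMap.ker_prodMap, ← Module.finrank_prod]
    have := LinearMap.range_prodMap f.ker.subtype g.ker.subtype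
    rw [Submodule.range_subtype, Submodule.range_subtype] at this
    rw [← this]
    exact (LinearEquiv.ofInjective _
      (f.ker.injective_subtype.prodMap g.ker.injective_subtype)).symm.finrank_eq
  have h2 : Module.finrank ℝ ((V × V') ⧸ (f.prodMap g).range) =
      Module.finrank ℝ (V ⧸ f.range) + Module.finrank ℝ (V' ⧸ g.range) := by
    have hk : (f.prodMap g).range = (f.range.mkQ.prodMap g.range.mkQ).ker := by
      rw [LinearMap.range_prodMap, LinearMap.ker_prodMap, Submodule.ker_mkQ, Submodule.ker_mkQ]
    rw [hk, ← Module.finrank_prod]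
    exact (LinearMap.quotKerEquivOfSurjective (f.range.mkQ.prodMap g.range.mkQ)
      (f.range.mkQ_surjective.prodMap g.range.mkQ_surjective)).finrank_eq
  simp only [LinearMap.algIndex, h1, h2]
  push_cast
  ring

end AlgebraicIndex

/-! ### Approximable operators and perturbation of Fredholm operators. -/

section Approximable

variable {X Y Z : Type*} [NormedAddCommGroup X] [NormedSpace ℝ X] [NormedAddCommGroup Y]
  [NormedSpace ℝ Y] [NormedAddCommGroup Z] [NormedSpace ℝ Z]

namespace ContinuousLinearMap

/-- An operator is approximable if it is a norm limit of operators of finite rank. -/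
def IsApproximable (T : X →L[ℝ] Y) : Prop :=
  ∀ ε : ℝ, 0 < ε → ∃ F : X →L[ℝ] Y, F.toLinearMap.HasFiniteRange ∧ ‖T - F‖ < ε

theorem IsApproximable.of_hasFiniteRange {T : X →L[ℝ] Y} (h : T.toLinearMap.HasFiniteRange) :
    T.IsApproximable := fun ε hε => ⟨T, h, by simpa using hε⟩

theorem IsApproximable.zero : (0 : X →L[ℝ] Y).IsApproximable :=
  .of_hasFiniteRange LinearMap.HasFiniteRange.zero

theorem IsApproximable.of_forall_exists {T : X →L[ℝ] Y}
    (h : ∀ ε : ℝ, 0 < ε → ∃ S : X →L[ℝ] Y, S.IsApproximable ∧ ‖T - S‖ < ε) :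
    T.IsApproximable := by
  intro ε hε
  obtain ⟨S, hS, h1⟩ := h (ε / 2) (by positivity)
  obtain ⟨F, hF, h2⟩ := hS (ε / 2) (by positivity)
  refine ⟨F, hF, ?_⟩
  calc ‖T - F‖ = ‖(T - S) + (S - F)‖ := by simp
    _ ≤ ‖T - S‖ + ‖S - F‖ := norm_add_le _ _
    _ < ε := by linarith

theorem IsApproximable.add {T S : X →L[ℝ] Y} (hT : T.IsApproximable) (hS : S.IsApproximable) :
    (T + S).IsApproximable := by
  intro ε hε
  obtain ⟨F, hF, h1⟩ := hT (ε / 2) (by positivity)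
  obtain ⟨G, hG, h2⟩ := hS (ε / 2) (by positivity)
  refine ⟨F + G, hF.add hG, ?_⟩
  calc ‖T + S - (F + G)‖ = ‖(T - F) + (S - G)‖ := by congr 1; abel
    _ ≤ ‖T - F‖ + ‖S - G‖ := norm_add_le _ _
    _ < ε := by linarith

theorem IsApproximable.comp_left {T : X →L[ℝ] Y} (hT : T.IsApproximable) (S : Y →L[ℝ] Z) :
    (S ∘L T).IsApproximable := by
  intro ε hε
  obtain ⟨F, hF, h1⟩ := hT (ε / (‖S‖ + 1)) (by positivity)
  refine ⟨S ∘L F, hF.comp_left S.toLinearMap, ?_⟩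
  calc ‖S ∘L T - S ∘L F‖ = ‖S ∘L (T - F)‖ := by rw [comp_sub]
    _ ≤ ‖S‖ * ‖T - F‖ := opNorm_comp_le _ _
    _ ≤ (‖S‖ + 1) * ‖T - F‖ := by gcongr; linarith
    _ < (‖S‖ + 1) * (ε / (‖S‖ + 1)) := by gcongr
    _ = ε := by field_simp

theorem IsApproximable.comp_right {T : Y →L[ℝ] Z} (hT : T.IsApproximable) (S : X →L[ℝ] Y) :
    (T ∘L S).IsApproximable := by
  intro ε hε
  obtain ⟨F, hF, h1⟩ := hT (ε / (‖S‖ + 1)) (by positivity)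
  refine ⟨F ∘L S, hF.comp_right S.toLinearMap, ?_⟩
  calc ‖T ∘L S - F ∘L S‖ = ‖(T - F) ∘L S‖ := by rw [sub_comp]
    _ ≤ ‖T - F‖ * ‖S‖ := opNorm_comp_le _ _
    _ ≤ ‖T - F‖ * (‖S‖ + 1) := by gcongr; linarith
    _ < (ε / (‖S‖ + 1)) * (‖S‖ + 1) := by gcongr
    _ = ε := by field_simp

theorem IsApproximable.neg {T : X →L[ℝ] Y} (hT : T.IsApproximable) : (-T).IsApproximable := by
  have := hT.comp_left (-ContinuousLinearMap.id ℝ Y)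
  convert this using 1
  ext; simp

theorem IsApproximable.sub {T S : X →L[ℝ] Y} (hT : T.IsApproximable) (hS : S.IsApproximable) :
    (T - S).IsApproximable := by
  rw [sub_eq_add_neg]; exact hT.add hS.neg

theorem IsApproximable.sum {ι : Type*} (s : Finset ι) {T : ι → X →L[ℝ] Y}
    (h : ∀ i ∈ s, (T i).IsApproximable) : (∑ i ∈ s, T i).IsApproximable :=
  Finset.sum_induction _ _ (fun _ _ h1 h2 => h1.add h2) .zero h

theorem IsApproximable.prod {T : X →L[ℝ] Y} {S : X →L[ℝ] Z} (hT : T.IsApproximable)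
    (hS : S.IsApproximable) : (T.prod S).IsApproximable := by
  have := (hT.comp_left (inl ℝ Y Z)).add (hS.comp_left (inr ℝ Y Z))
  convert this using 1
  ext <;> simp

/-- A compact operator into a Hilbert space is approximable. -/
theorem IsApproximable.of_isCompactOperator {H : Type*} [NormedAddCommGroup H]
    [InnerProductSpace ℝ H] {T : X →L[ℝ] H} (hT : IsCompactOperator T) :
    T.IsApproximable := by
  intro ε hε
  have hc : IsCompact (closure (T '' Metric.closedBall 0 1)) :=
    hT.isCompact_closure_image_closedBall 1
  obtain ⟨t, ht1, ht2⟩ := Metric.totallyBounded_iff.1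
    (hc.totallyBounded.subset subset_closure) (ε / 3) (by positivity)
  -- Project orthogonally to the span of a finite ε/3-net of the image of the unit ball. The
  -- projection fixes the net point near `T x` and has norm at most one, so the error is at most
  -- 2ε/3.
  set V : Submodule ℝ H := Submodule.span ℝ t with hV
  have : FiniteDimensional ℝ V := FiniteDimensional.span_of_finite ℝ ht1
  refine ⟨V.starProjection ∘L T, ?_, ?_⟩
  · refine LinearMap.HasFiniteRange.comp_right ?_ _
    rw [LinearMap.HasFiniteRange]
    have hr : V.starProjection.range = V := V.range_starProjection
    rw [hr]
    exact Submodule.fg_iff_finiteDimensional V |>.2 this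
  · refine lt_of_le_of_lt (opNorm_le_of_unit_norm (C := 2 * (ε / 3)) (by positivity) ?_)
      (by linarith)
    intro x hx
    have hx' : T x ∈ ⋃ y ∈ t, Metric.ball y (ε / 3) :=
      ht2 ⟨x, by simp [hx], rfl⟩
    simp only [mem_iUnion, Metric.mem_ball, dist_eq_norm, exists_prop] at hx'
    obtain ⟨y, hy, hxy⟩ := hx'
    have hy' : V.starProjection y = y :=
      Submodule.starProjection_eq_self_iff.2 (Submodule.subset_span hy)
    have e : (T - V.starProjection ∘L T) x = (T x - y) - V.starProjection (T x - y) := by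
      simp [map_sub, hy']
    rw [e]
    have h1 : ‖V.starProjection (T x - y)‖ ≤ ‖T x - y‖ := V.norm_starProjection_apply_le _
    calc _ ≤ ‖T x - y‖ + ‖V.starProjection (T x - y)‖ := norm_sub_le _ _
      _ ≤ 2 * (ε / 3) := by linarith

end ContinuousLinearMap

open ContinuousLinearMap
open scoped LinearMap.FiniteRangeSetoid

theorem ContinuousLinearMap.IsFredholm.finiteDimensional_coker {T : X →L[ℝ] Y}
    (hT : T.IsFredholm) : FiniteDimensional ℝ (Y ⧸ T.toLinearMap.range) :=
  hT.finite_coker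

theorem fredholmIndex_eq_algIndex (T : X →L[ℝ] Y) :
    fredholmIndex T = T.toLinearMap.algIndex := rfl

/-- The sum of the identity, a small operator and an approximable operator is Fredholm of
index zero. -/
theorem isFredholm_id_add_small_add [CompleteSpace Y] {s K : Y →L[ℝ] Y} (hs : ‖s‖ < 1)
    (hK : K.IsApproximable) :
    (ContinuousLinearMap.id ℝ Y + s + K).IsFredholm ∧
      fredholmIndex (ContinuousLinearMap.id ℝ Y + s + K) = 0 := by
  obtain ⟨F, hF, h1⟩ := hK (1 - ‖s‖) (by linarith)
  -- After splitting off a finite rank part `F` of `K`, the rest 1 + s + (K − F) = 1 − t is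
  -- invertible by the Neumann series; call it J. What remains is J + F = J(1 + J⁻¹F).
  set t : Y →L[ℝ] Y := -(s + (K - F)) with ht
  have ht1 : ‖t‖ < 1 := by
    rw [ht, norm_neg]
    exact (norm_add_le _ _).trans_lt (by linarith)
  set J : Y ≃L[ℝ] Y := ContinuousLinearEquiv.ofUnit (Units.oneSub t ht1) with hJ
  have hJx : ∀ x, J x = x - t x := fun x => rfl
  have e : ContinuousLinearMap.id ℝ Y + s + K = J.toContinuousLinearMap + F := by
    ext x
    simp [hJx, ht]
    abel
  rw [e]
  constructor
  · refine ContinuousLinearMap.IsFredholm.of_isQuasiInverse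
      (v := J.symm.toContinuousLinearMap) ⟨?_, ?_⟩
    · have h2 : (J.symm.toLinearEquiv.toLinearMap ∘ₗ F.toLinearMap).HasFiniteRange :=
        hF.comp_left _
      refine LinearMap.FiniteRangeSetoid.equiv_iff_hasFiniteRange.2 ?_
      have h3 : J.symm.toLinearEquiv.toLinearMap ∘ₗ (J.toContinuousLinearMap + F).toLinearMap -
          LinearMap.id = J.symm.toLinearEquiv.toLinearMap ∘ₗ F.toLinearMap := by
        ext x; simp
      rw [← h3] at h2
      exact h2
    · have h2 : (F.toLinearMap ∘ₗ J.symm.toLinearEquiv.toLinearMap).HasFiniteRange :=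
        hF.comp_right _
      refine LinearMap.FiniteRangeSetoid.equiv_iff_hasFiniteRange.2 ?_
      have h3 : (J.toContinuousLinearMap + F).toLinearMap ∘ₗ J.symm.toLinearEquiv.toLinearMap -
          LinearMap.id = F.toLinearMap ∘ₗ J.symm.toLinearEquiv.toLinearMap := by
        ext x; simp
      rw [← h3] at h2
      exact h2
  · have h2 : (J.symm.toLinearEquiv.toLinearMap ∘ₗ F.toLinearMap).HasFiniteRange :=
      hF.comp_left _
    have : FiniteDimensional ℝ (J.symm.toLinearEquiv.toLinearMap ∘ₗ F.toLinearMap).range :=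
      Submodule.fg_iff_finiteDimensional _ |>.1 h2
    rw [← LinearMap.algIndex_id_add (J.symm.toLinearEquiv.toLinearMap ∘ₗ F.toLinearMap),
      fredholmIndex_eq_algIndex]
    symm
    refine LinearMap.algIndex_of_equiv _ _ (LinearEquiv.refl ℝ Y) J.toLinearEquiv fun x => ?_
    simp

/-- Modulo finite rank, R u is a right inverse and v R a left inverse of `T`. As in any monoid the
two then coincide, so R u is a two-sided quasi-inverse. -/
theorem isFredholm_of_isFredholm_comp [CompleteSpace X] [CompleteSpace Y] {T : X →L[ℝ] Y}
    {R : Y →L[ℝ] X} (h1 : (T ∘L R).IsFredholm) (h2 : (R ∘L T).IsFredholm) : T.IsFredholm := by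
  obtain ⟨u, hu⟩ := h1.exists_isQuasiInverse
  obtain ⟨v, hv⟩ := h2.exists_isQuasiInverse
  refine ContinuousLinearMap.IsFredholm.of_isQuasiInverse (v := R ∘L u) ⟨?_, ?_⟩
  · have a1 : T.toLinearMap ∘ₗ (R ∘L u).toLinearMap ≈ .id := hu.2
    have a2 : (v ∘L R).toLinearMap ∘ₗ T.toLinearMap ≈ .id := hv.1
    change (R ∘L u).toLinearMap ∘ₗ T.toLinearMap ≈ .id
    calc (R ∘L u).toLinearMap ∘ₗ T.toLinearMap
        = .id ∘ₗ (R ∘L u).toLinearMap ∘ₗ T.toLinearMap := rfl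
      _ ≈ ((v ∘L R).toLinearMap ∘ₗ T.toLinearMap) ∘ₗ (R ∘L u).toLinearMap ∘ₗ T.toLinearMap := by
          grw [a2]
      _ = (v ∘L R).toLinearMap ∘ₗ (T.toLinearMap ∘ₗ (R ∘L u).toLinearMap) ∘ₗ T.toLinearMap := rfl
      _ ≈ (v ∘L R).toLinearMap ∘ₗ .id ∘ₗ T.toLinearMap := by grw [a1]
      _ ≈ .id := a2
  · exact hu.2

/-- An operator with a two-sided inverse up to small and approximable operators is Fredholm. -/
theorem isFredholm_of_parametrix [CompleteSpace X] [CompleteSpace Y] {T : X →L[ℝ] Y}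
    {R : Y →L[ℝ] X} {s K : Y →L[ℝ] Y} {s' K' : X →L[ℝ] X} (hs : ‖s‖ < 1) (hs' : ‖s'‖ < 1)
    (hK : K.IsApproximable) (hK' : K'.IsApproximable)
    (h : T ∘L R = ContinuousLinearMap.id ℝ Y + s + K)
    (h' : R ∘L T = ContinuousLinearMap.id ℝ X + s' + K') :
    T.IsFredholm ∧ R.IsFredholm ∧ fredholmIndex T + fredholmIndex R = 0 := by
  obtain ⟨f1, i1⟩ := isFredholm_id_add_small_add hs hK
  obtain ⟨f2, i2⟩ := isFredholm_id_add_small_add hs' hK'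
  rw [← h] at f1 i1
  rw [← h'] at f2 i2
  have fT := isFredholm_of_isFredholm_comp f1 f2
  have fR := isFredholm_of_isFredholm_comp f2 f1
  refine ⟨fT, fR, ?_⟩
  rw [← i1]
  simp only [fredholmIndex_eq_algIndex]
  have := fT.finite_ker
  have := fR.finiteDimensional_coker
  have : FiniteDimensional ℝ (T.toLinearMap ∘ₗ R.toLinearMap).ker := f1.finite_ker
  have : FiniteDimensional ℝ (Y ⧸ (T.toLinearMap ∘ₗ R.toLinearMap).range) :=
    f1.finiteDimensional_coker
  exact (LinearMap.algIndex_comp T.toLinearMap R.toLinearMap).symm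

/-- This is the form in which Fredholm operators enter all later parametrix constructions: finite
rank errors are only remembered as approximable, so that they can be added to errors of compact
type. -/
theorem ContinuousLinearMap.IsFredholm.exists_approximable_inverse {T : X →L[ℝ] Y}
    (hT : T.IsFredholm) : ∃ (R : Y →L[ℝ] X) (K : Y →L[ℝ] Y) (K' : X →L[ℝ] X),
      K.IsApproximable ∧ K'.IsApproximable ∧ T ∘L R = ContinuousLinearMap.id ℝ Y + K ∧
      R ∘L T = ContinuousLinearMap.id ℝ X + K' := by
  obtain ⟨R, h1, h2⟩ := hT.exists_isQuasiInverse
  refine ⟨R, T ∘L R - ContinuousLinearMap.id ℝ Y, R ∘L T - ContinuousLinearMap.id ℝ X,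
    .of_hasFiniteRange ?_, .of_hasFiniteRange ?_, by simp, by simp⟩
  · exact LinearMap.FiniteRangeSetoid.equiv_iff_hasFiniteRange.1 h2
  · exact LinearMap.FiniteRangeSetoid.equiv_iff_hasFiniteRange.1 h1

/-- The index is invariant under small and approximable perturbations. -/
theorem fredholmIndex_add_small_add [CompleteSpace X] [CompleteSpace Y] {T : X →L[ℝ] Y}
    {R : Y →L[ℝ] X} {K₀ : Y →L[ℝ] Y} {K₀' : X →L[ℝ] X} (hK₀ : K₀.IsApproximable)
    (hK₀' : K₀'.IsApproximable) (h : T ∘L R = ContinuousLinearMap.id ℝ Y + K₀)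
    (h' : R ∘L T = ContinuousLinearMap.id ℝ X + K₀') {s K : X →L[ℝ] Y} (hs : ‖s‖ * ‖R‖ < 1)
    (hK : K.IsApproximable) :
    (T + s + K).IsFredholm ∧ fredholmIndex (T + s + K) = fredholmIndex T := by
  -- The same `R` is a parametrix of `T` and of the perturbed operator, so both indices are equal to
  -- −ind R, and no homotopy argument is needed.
  have h1 := isFredholm_of_parametrix (T := T) (R := R) (s := 0) (s' := 0) (by simp) (by simp)
    hK₀ hK₀' (by rw [h]; simp) (by rw [h']; simp)
  have h2 := isFredholm_of_parametrix (T := T + s + K) (R := R) (s := s ∘L R) (s' := R ∘L s)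
    ((opNorm_comp_le _ _).trans_lt hs)
    ((opNorm_comp_le _ _).trans_lt (by rwa [mul_comm])) (hK₀.add (hK.comp_right R))
    (hK₀'.add (hK.comp_left R)) (by rw [add_comp, add_comp, h]; abel)
    (by rw [comp_add, comp_add, h']; abel)
  exact ⟨h2.1, by linarith [h1.2.2, h2.2.2]⟩

end Approximable

/-! ### Calculus of weak derivatives. -/

section WeakDerivative

variable {E : Type*} [NormedAddCommGroup E] [InnerProductSpace ℝ E] [CompleteSpace E]

theorem integral_deriv_test {a b : ℝ} (hab : a < b) {φ : ℝ → ℝ} (h1 : ContDiff ℝ ∞ φ)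
    (h3 : tsupport φ ⊆ Ioo a b) : ∫ s in Icc a b, deriv φ s = 0 := by
  have hφ : ∀ t, t ∉ Ioo a b → φ t = 0 := fun t ht => by
    by_contra h
    exact ht (h3 (subset_tsupport _ h))
  rw [integral_Icc_eq_integral_Ioc, ← intervalIntegral.integral_of_le hab.le,
    intervalIntegral.integral_deriv_eq_sub
      (fun x _ => (h1.differentiable (by simp)).differentiableAt)
      ((h1.continuous_deriv (by simp)).intervalIntegrable _ _), hφ a (by simp), hφ b (by simp)]
  simp

namespace HilbertPair

theorem IsWeakDeriv.of_primitive {a b : ℝ} (hab : a < b) {u v : ℝ → E} {c : E}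
    (hv : IntegrableOn v (Icc a b))
    (h : ∀ᵐ s ∂volume.restrict (Icc a b), u s = c + ∫ r in a..s, v r) :
    IsWeakDeriv a b u v := by
  intro φ h1 h2 h3
  have hφ' : Continuous (deriv φ) := h1.continuous_deriv (by simp)
  have hprim : ContinuousOn (fun s => ∫ r in a..s, v r) (Icc a b) := by
    have := intervalIntegral.continuousOn_primitive_interval (a := a) (b := b) (f := v)
      (by simpa [uIcc_of_le hab.le] using hv)
    simpa [uIcc_of_le hab.le] using this
  rw [← integral_test_primitive hab hv h1 h2 h3]
  have e : ∫ s in Icc a b, deriv φ s • u s =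
      ∫ s in Icc a b, (deriv φ s • c + deriv φ s • ∫ r in a..s, v r) := by
    refine integral_congr_ae ?_
    filter_upwards [h] with s hs
    rw [hs, smul_add]
  rw [e, integral_add, integral_smul_const, integral_deriv_test hab h1 h3]
  · simp
  · exact integrable_smul_of_test hφ' h2.deriv (integrableOn_const (by simp))
  · exact integrable_smul_of_test hφ' h2.deriv (hprim.integrableOn_compact isCompact_Icc)

theorem IsWeakDeriv.congr_ae {a b : ℝ} {u v u' v' : ℝ → E} (h : IsWeakDeriv a b u v)
    (hu : u' =ᵐ[volume.restrict (Icc a b)] u) (hv : v' =ᵐ[volume.restrict (Icc a b)] v) :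
    IsWeakDeriv a b u' v' := by
  intro φ h1 h2 h3
  have e1 : ∫ s in Icc a b, deriv φ s • u' s = ∫ s in Icc a b, deriv φ s • u s :=
    integral_congr_ae (by filter_upwards [hu] with s hs; rw [hs])
  have e2 : ∫ s in Icc a b, φ s • v' s = ∫ s in Icc a b, φ s • v s :=
    integral_congr_ae (by filter_upwards [hv] with s hs; rw [hs])
  rw [e1, e2, h φ h1 h2 h3]

/-- The product φχ is again a test function. Testing the given identity with it and using the
Leibniz rule for (φχ)' moves the term φχ'u to the other side. -/
theorem IsWeakDeriv.smul {a b : ℝ} {u v : ℝ → E} (h : IsWeakDeriv a b u v)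
    (hu : IntegrableOn u (Icc a b)) (hv : IntegrableOn v (Icc a b)) {χ : ℝ → ℝ}
    (hχ : ContDiff ℝ ∞ χ) :
    IsWeakDeriv a b (fun s => χ s • u s) (fun s => χ s • v s + deriv χ s • u s) := by
  intro φ h1 h2 h3
  have hχ' : Continuous (deriv χ) := hχ.continuous_deriv (by simp)
  have hφ' : Continuous (deriv φ) := h1.continuous_deriv (by simp)
  have hts : tsupport (fun s => φ s * χ s) ⊆ tsupport φ :=
    closure_mono (Function.support_mul_subset_left _ _)
  have key := h (fun s => φ s * χ s) (h1.mul hχ) (h2.mul_right) (hts.trans h3)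
  have hd : ∀ s, deriv (fun s => φ s * χ s) s = deriv φ s * χ s + φ s * deriv χ s := fun s =>
    deriv_fun_mul (h1.differentiable (by simp)).differentiableAt
      (hχ.differentiable (by simp)).differentiableAt
  simp only [hd] at key
  have i1 : IntegrableOn (fun s => (deriv φ s * χ s) • u s) (Icc a b) :=
    integrable_smul_of_test (hφ'.mul hχ.continuous) h2.deriv.mul_right hu
  have i2 : IntegrableOn (fun s => (φ s * deriv χ s) • u s) (Icc a b) :=
    integrable_smul_of_test (h1.continuous.mul hχ') h2.mul_right hu
  have i3 : IntegrableOn (fun s => (φ s * χ s) • v s) (Icc a b) :=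
    integrable_smul_of_test (h1.continuous.mul hχ.continuous) h2.mul_right hv
  have e1 : ∫ s in Icc a b, (deriv φ s * χ s + φ s * deriv χ s) • u s =
      (∫ s in Icc a b, (deriv φ s * χ s) • u s) + ∫ s in Icc a b, (φ s * deriv χ s) • u s := by
    rw [← integral_add i1 i2]
    simp only [add_smul]
  have e2 : ∫ s in Icc a b, φ s • (χ s • v s + deriv χ s • u s) =
      (∫ s in Icc a b, (φ s * χ s) • v s) + ∫ s in Icc a b, (φ s * deriv χ s) • u s := by
    rw [← integral_add i3 i2]
    simp only [smul_add, smul_smul]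
  simp only [smul_smul]
  rw [e2, neg_add, ← key, e1]
  abel

theorem IsWeakDeriv.clm_apply {F : Type*} [NormedAddCommGroup F] [InnerProductSpace ℝ F]
    [CompleteSpace F] {a b : ℝ} {u v : ℝ → E} (h : IsWeakDeriv a b u v)
    (hu : IntegrableOn u (Icc a b)) (hv : IntegrableOn v (Icc a b)) (S : E →L[ℝ] F) :
    IsWeakDeriv a b (fun s => S (u s)) (fun s => S (v s)) := by
  intro φ h1 h2 h3
  have hφ' : Continuous (deriv φ) := h1.continuous_deriv (by simp)
  have := congrArg S (h φ h1 h2 h3)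
  rw [map_neg, ← S.integral_comp_comm (integrable_smul_of_test hφ' h2.deriv hu),
    ← S.integral_comp_comm (integrable_smul_of_test h1.continuous h2 hv)] at this
  simpa only [map_smul] using this

/-- Cauchy-Schwarz on a finite measure space. -/
theorem sq_integral_norm_le {F : Type*} [NormedAddCommGroup F] {μ : Measure ℝ}
    [IsFiniteMeasure μ] {v : ℝ → F} (hv : Integrable v μ) (hv2 : Integrable (fun s => ‖v s‖ ^ 2) μ) :
    (∫ s, ‖v s‖ ∂μ) ^ 2 ≤ μ.real univ * ∫ s, ‖v s‖ ^ 2 ∂μ := by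
  set m := ∫ s, ‖v s‖ ∂μ with hm
  set δ := μ.real univ with hδ
  have hδ0 : 0 ≤ δ := measureReal_nonneg
  -- This is the variance of ‖v‖ multiplied through by the total mass δ, so that the expansion makes
  -- sense for δ = 0 as well.
  have h0 : 0 ≤ ∫ r, (δ * ‖v r‖ - m) ^ 2 ∂μ := integral_nonneg fun _ => sq_nonneg _
  have h1 : ∫ r, (δ * ‖v r‖ - m) ^ 2 ∂μ =
      δ ^ 2 * (∫ r, ‖v r‖ ^ 2 ∂μ) - 2 * δ * m * m + δ * m ^ 2 := by
    have e : (fun r => (δ * ‖v r‖ - m) ^ 2) =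
        fun r => (δ ^ 2 * ‖v r‖ ^ 2 - 2 * δ * m * ‖v r‖) + m ^ 2 := by
      ext r; ring
    have i1 : Integrable (fun r => 2 * δ * m * ‖v r‖) μ := hv.norm.const_mul _
    have i2 : Integrable (fun r => δ ^ 2 * ‖v r‖ ^ 2) μ := hv2.const_mul _
    rw [e, integral_add (by exact i2.sub i1) (integrable_const _), integral_sub i2 i1, integral_const_mul,
      integral_const_mul, integral_const, smul_eq_mul]
  rcases hδ0.eq_or_lt with h | h
  · have : μ = 0 := by
      rw [← Measure.measure_univ_eq_zero]
      exact (measureReal_eq_zero_iff).1 h.symm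
    have hm0 : m = 0 := by rw [hm, this]; simp
    rw [hm0, ← h]; simp
  · rw [h1] at h0
    have h2 : 0 ≤ δ * (δ * (∫ r, ‖v r‖ ^ 2 ∂μ) - m ^ 2) := by nlinarith
    have := nonneg_of_mul_nonneg_right h2 h
    linarith

end HilbertPair

end WeakDerivative

/-! ### Operators between spaces of paths. -/

namespace HilbertPair

section PathOperators

variable {H₀ H₁ : Type*} [NormedAddCommGroup H₀] [InnerProductSpace ℝ H₀] [CompleteSpace H₀]
  [NormedAddCommGroup H₁] [InnerProductSpace ℝ H₁] [CompleteSpace H₁] (P : HilbertPair H₀ H₁)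
  {a b : ℝ}

section L2

variable {H H' : Type*} [NormedAddCommGroup H] [InnerProductSpace ℝ H] [CompleteSpace H]
  [NormedAddCommGroup H'] [InnerProductSpace ℝ H'] [CompleteSpace H']

theorem ae_mem_Icc (a b : ℝ) : ∀ᵐ s ∂(volume : Measure ℝ).restrict (Icc a b), s ∈ Icc a b :=
  ae_restrict_mem measurableSet_Icc

theorem norm_mulOp_le (hab : a < b) (A : C(Icc a b, H →L[ℝ] H')) : ‖mulOp hab A‖ ≤ ‖A‖ := by
  unfold mulOp
  exact LinearMap.mkContinuous_norm_le _ (norm_nonneg A) _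

theorem mulOp_ae_eq' (hab : a < b) (A : C(Icc a b, H →L[ℝ] H')) (f : PathL2 a b H) :
    ∀ᵐ s ∂volume.restrict (Icc a b), ∀ hs : s ∈ Icc a b, mulOp hab A f s = A ⟨s, hs⟩ (f s) := by
  filter_upwards [mulOp_ae_eq hab A f] with s hs h
  rw [hs, IccExtend_of_mem hab.le A h]

theorem mulOp_eq_iff (hab : a < b) (A : C(Icc a b, H →L[ℝ] H')) (f : PathL2 a b H)
    (g : PathL2 a b H') : mulOp hab A f = g ↔
      ∀ᵐ s ∂volume.restrict (Icc a b), ∀ hs : s ∈ Icc a b, A ⟨s, hs⟩ (f s) = g s := by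
  constructor
  · rintro rfl
    filter_upwards [mulOp_ae_eq' hab A f] with s hs h
    rw [hs h]
  · intro h
    refine Lp.ext ?_
    filter_upwards [mulOp_ae_eq' hab A f, h, ae_mem_Icc a b] with s h1 h2 h3
    rw [h1 h3, h2 h3]

theorem mulOp_sub (hab : a < b) (A B : C(Icc a b, H →L[ℝ] H')) :
    mulOp hab (A - B) = mulOp hab A - mulOp hab B := by
  ext1 f
  rw [mulOp_eq_iff]
  filter_upwards [Lp.coeFn_sub (mulOp hab A f) (mulOp hab B f), mulOp_ae_eq' hab A f,
    mulOp_ae_eq' hab B f] with s h1 h2 h3 hs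
  change _ = (mulOp hab A f - mulOp hab B f : PathL2 a b H') s
  rw [h1, Pi.sub_apply, h2 hs, h3 hs]
  rfl

/-- Pointwise application of a fixed operator. -/
noncomputable def constOp (hab : a < b) (S : H →L[ℝ] H') : PathL2 a b H →L[ℝ] PathL2 a b H' :=
  mulOp hab (ContinuousMap.const _ S)

theorem constOp_ae_eq (hab : a < b) (S : H →L[ℝ] H') (f : PathL2 a b H) :
    ∀ᵐ s ∂volume.restrict (Icc a b), constOp hab S f s = S (f s) := by
  filter_upwards [mulOp_ae_eq' hab (ContinuousMap.const _ S) f, ae_mem_Icc a b] with s h1 h2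
  exact h1 h2

theorem norm_constOp_le (hab : a < b) (S : H →L[ℝ] H') : ‖constOp hab S‖ ≤ ‖S‖ := by
  refine (norm_mulOp_le hab _).trans ?_
  rw [ContinuousMap.norm_le _ (norm_nonneg _)]
  intro s; rfl

/-- Multiplication with a continuous function. -/
noncomputable def scal (H : Type*) [NormedAddCommGroup H] [InnerProductSpace ℝ H]
    [CompleteSpace H] (hab : a < b) (χ : C(ℝ, ℝ)) :
    PathL2 a b H →L[ℝ] PathL2 a b H :=
  mulOp hab ⟨fun s => χ s • ContinuousLinearMap.id ℝ H, by fun_prop⟩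

theorem scal_ae_eq (hab : a < b) (χ : C(ℝ, ℝ)) (f : PathL2 a b H) :
    ∀ᵐ s ∂volume.restrict (Icc a b), scal H hab χ f s = χ s • f s := by
  filter_upwards [mulOp_ae_eq' hab ⟨fun s : Icc a b => χ s • ContinuousLinearMap.id ℝ H,
    by fun_prop⟩ f, ae_mem_Icc a b] with s h1 h2
  exact h1 h2

theorem norm_scal_le (hab : a < b) (χ : C(ℝ, ℝ)) {C : ℝ} (hC : 0 ≤ C)
    (h : ∀ s ∈ Icc a b, |χ s| ≤ C) : ‖scal H hab χ‖ ≤ C := by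
  refine (norm_mulOp_le hab _).trans ?_
  rw [ContinuousMap.norm_le _ hC]
  intro s
  refine ContinuousLinearMap.opNorm_le_bound _ hC fun x => ?_
  simp only [ContinuousMap.coe_mk, smul_apply, ContinuousLinearMap.id_apply,
    norm_smul, Real.norm_eq_abs]
  exact mul_le_mul_of_nonneg_right (h s s.2) (norm_nonneg _)

theorem scal_eq_iff (hab : a < b) (χ : C(ℝ, ℝ)) (f g : PathL2 a b H) : scal H hab χ f = g ↔
      ∀ᵐ s ∂volume.restrict (Icc a b), s ∈ Icc a b → χ s • f s = g s :=
  mulOp_eq_iff hab _ f g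

theorem mulOp_scal (hab : a < b) (A : C(Icc a b, H →L[ℝ] H')) (χ : C(ℝ, ℝ)) (f : PathL2 a b H) :
    mulOp hab A (scal H hab χ f) = scal H' hab χ (mulOp hab A f) := by
  rw [mulOp_eq_iff]
  filter_upwards [scal_ae_eq hab χ f, scal_ae_eq hab χ (mulOp hab A f), mulOp_ae_eq' hab A f]
    with s h1 h2 h3 hs
  rw [h1, h2, h3 hs, map_smul]

theorem scal_mulOp_congr (hab : a < b) (A B : C(Icc a b, H →L[ℝ] H')) (χ : C(ℝ, ℝ))
    (h : ∀ s (hs : s ∈ Icc a b), χ s ≠ 0 → A ⟨s, hs⟩ = B ⟨s, hs⟩) (f : PathL2 a b H) :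
    scal H' hab χ (mulOp hab A f) = scal H' hab χ (mulOp hab B f) := by
  rw [scal_eq_iff]
  filter_upwards [scal_ae_eq hab χ (mulOp hab B f), mulOp_ae_eq' hab A f,
    mulOp_ae_eq' hab B f] with s h1 h2 h3 hs
  rw [h1, h2 hs, h3 hs]
  by_cases h0 : χ s = 0
  · simp [h0]
  · rw [h s hs h0]

theorem integral_sq_le_mul_norm_sq {J : Set ℝ} (hJs : J ⊆ Icc a b)
    (f : PathL2 a b H) : (∫ s in J, ‖f s‖) ^ 2 ≤
      (volume : Measure ℝ).real J * ∫ s in Icc a b, ‖f s‖ ^ 2 := by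
  have hJf : volume J ≠ ⊤ := ((measure_mono hJs).trans_lt (by simp)).ne
  have : Fact (volume J < ⊤) := ⟨hJf.lt_top⟩
  have h1 := (integrableOn_pathL2 f).mono_set hJs
  have h2 := (integrableOn_norm_sq_pathL2 f).mono_set hJs
  refine (sq_integral_norm_le h1 h2).trans ?_
  have h3 : ((volume : Measure ℝ).restrict J).real univ = (volume : Measure ℝ).real J := by
    simp [measureReal_def]
  rw [h3]
  refine mul_le_mul_of_nonneg_left ?_ measureReal_nonneg
  exact setIntegral_mono_set (integrableOn_norm_sq_pathL2 f)
    (Filter.Eventually.of_forall fun _ => by positivity) (LE.le.eventuallyLE hJs)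

/-- The integral over a measurable subset of `[a, b]` as a bounded operator. -/
noncomputable def integralOp (H : Type*) [NormedAddCommGroup H] [InnerProductSpace ℝ H]
    [CompleteSpace H] {J : Set ℝ} (hJs : J ⊆ Icc a b) :
    PathL2 a b H →L[ℝ] H :=
  LinearMap.mkContinuous
    { toFun := fun f => ∫ s in J, f s
      map_add' := fun f g => by
        rw [← integral_add ((integrableOn_pathL2 f).mono_set hJs)
          ((integrableOn_pathL2 g).mono_set hJs)]
        refine integral_congr_ae ?_
        exact ae_restrict_of_ae_restrict_of_subset hJs (Lp.coeFn_add f g)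
      map_smul' := fun c f => by
        rw [RingHom.id_apply, ← integral_smul]
        refine integral_congr_ae ?_
        exact ae_restrict_of_ae_restrict_of_subset hJs (Lp.coeFn_smul c f) }
    (√((volume : Measure ℝ).real J)) fun f => by
      refine (norm_integral_le_integral_norm _).trans ?_
      refine le_of_sq_le_sq ?_ (by positivity)
      rw [mul_pow, Real.sq_sqrt measureReal_nonneg, norm_sq_pathL2]
      exact integral_sq_le_mul_norm_sq hJs f

theorem integralOp_apply {J : Set ℝ} (hJs : J ⊆ Icc a b)
    (f : PathL2 a b H) : integralOp H hJs f = ∫ s in J, f s := rfl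

end L2

/-- The inclusion `P₁([a, b]) → L²([a, b], H₀)`. -/
noncomputable def pathIncl (hab : a < b) : P.pathSpace a b →L[ℝ] PathL2 a b H₀ :=
  constOp hab P.incl ∘L P.path a b

theorem pathIncl_ae_eq (hab : a < b) (x : P.pathSpace a b) :
    ∀ᵐ s ∂volume.restrict (Icc a b), P.pathIncl hab x s = P.incl (P.path a b x s) :=
  constOp_ae_eq hab P.incl _

theorem pathIncl_ae_eq_rep (hab : a < b) (x : P.pathSpace a b) :
    ∀ᵐ s ∂volume.restrict (Icc a b), P.pathIncl hab x s = P.rep hab x s := by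
  filter_upwards [P.pathIncl_ae_eq hab x, P.rep_ae_eq hab x] with s h1 h2
  rw [h1, h2]

/-- For each test function both sides of the defining identity are bounded linear expressions in the
pair, so each cuts out a closed set. The resulting completeness of P₁ is needed for the Neumann
series and the open mapping theorem. -/
theorem isClosed_pathSpace (hab : a < b) :
    IsClosed (P.pathSpace a b : Set (WithLp 2 (PathL2 a b H₁ × PathL2 a b H₀))) := by
  have : (P.pathSpace a b : Set (WithLp 2 (PathL2 a b H₁ × PathL2 a b H₀))) =
      ⋂ (φ : ℝ → ℝ) (_ : ContDiff ℝ ∞ φ) (_ : HasCompactSupport φ) (_ : tsupport φ ⊆ Ioo a b),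
        {x | ∫ s in Icc a b, deriv φ s • P.incl (x.fst s) = -∫ s in Icc a b, φ s • x.snd s} := by
    ext x
    simp only [mem_iInter]
    rfl
  rw [this]
  refine isClosed_iInter fun φ => isClosed_iInter fun h1 => isClosed_iInter fun h2 =>
    isClosed_iInter fun h3 => ?_
  have hφ' : Continuous (deriv φ) := h1.continuous_deriv (by simp)
  have e1 : ∀ f : PathL2 a b H₁, ∫ s in Icc a b, deriv φ s • P.incl (f s) =
      integralOp H₀ (J := Icc a b) subset_rfl
        (scal H₀ hab ⟨deriv φ, hφ'⟩ (constOp hab P.incl f)) := by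
    intro f
    rw [integralOp_apply]
    refine integral_congr_ae ?_
    filter_upwards [scal_ae_eq hab ⟨deriv φ, hφ'⟩ (constOp hab P.incl f),
      constOp_ae_eq hab P.incl f] with s h1 h2
    rw [h1, h2]; rfl
  have e2 : ∀ f : PathL2 a b H₀, ∫ s in Icc a b, φ s • f s =
      integralOp H₀ (J := Icc a b) subset_rfl (scal H₀ hab ⟨φ, h1.continuous⟩ f) := by
    intro f
    rw [integralOp_apply]
    refine integral_congr_ae ?_
    filter_upwards [scal_ae_eq hab ⟨φ, h1.continuous⟩ f] with s h1
    rw [h1]; rfl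
  simp only [e1, e2]
  refine isClosed_eq ?_ ?_
  · exact ((integralOp H₀ (J := Icc a b) subset_rfl).continuous.comp
      ((scal H₀ hab ⟨deriv φ, hφ'⟩).continuous.comp ((constOp hab P.incl).continuous.comp
        (WithLp.fstL 2 ℝ (PathL2 a b H₁) (PathL2 a b H₀)).continuous)))
  · exact ((integralOp H₀ (J := Icc a b) subset_rfl).continuous.comp
      ((scal H₀ hab ⟨φ, h1.continuous⟩).continuous.comp
        (WithLp.sndL 2 ℝ (PathL2 a b H₁) (PathL2 a b H₀)).continuous)).neg

theorem completeSpace_pathSpace (hab : a < b) : CompleteSpace (P.pathSpace a b) :=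
  (P.isClosed_pathSpace hab).completeSpace_coe

theorem pathSpace_ext {x y : P.pathSpace a b} (h1 : P.path a b x = P.path a b y)
    (h2 : P.pathDeriv a b x = P.pathDeriv a b y) : x = y :=
  Subtype.ext ((WithLp.equiv 2 _).injective (Prod.ext h1 h2))

/-- Construction of bounded operators into `P₁([a, b])`. -/
noncomputable def toPathSpace {X : Type*} [NormedAddCommGroup X] [NormedSpace ℝ X]
    (f : X →L[ℝ] PathL2 a b H₁) (v : X →L[ℝ] PathL2 a b H₀)
    (h : ∀ x, IsWeakDeriv a b (fun s => P.incl (f x s)) (v x)) : X →L[ℝ] P.pathSpace a b :=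
  ((WithLp.prodContinuousLinearEquiv 2 ℝ (PathL2 a b H₁) (PathL2 a b H₀)).symm.toContinuousLinearMap
    ∘L (f.prod v)).codRestrict (P.pathSpace a b) h

section toPathSpace

variable {X : Type*} [NormedAddCommGroup X] [NormedSpace ℝ X]
    (f : X →L[ℝ] PathL2 a b H₁) (v : X →L[ℝ] PathL2 a b H₀)
    (h : ∀ x, IsWeakDeriv a b (fun s => P.incl (f x s)) (v x))

theorem path_toPathSpace (x : X) : P.path a b (P.toPathSpace f v h x) = f x := rfl

end toPathSpace

/-- Continuous functions that agree almost everywhere on an interval agree. All point values below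
are computed in this way from almost everywhere formulas. -/
theorem rep_eq_of_ae (hab : a < b) (x : P.pathSpace a b) {g : ℝ → H₀} (hg : ContinuousOn g (Icc a b))
    (h : ∀ᵐ s ∂volume.restrict (Icc a b), P.incl (P.path a b x s) = g s) {t : ℝ}
    (ht : t ∈ Icc a b) : P.rep hab x t = g t := by
  refine eqOn_of_ae_eq hab (P.continuousOn_rep hab x) hg ?_ ht
  filter_upwards [P.rep_ae_eq hab x, h] with s h1 h2
  rw [← h1, h2]

/-- Multiplication with a smooth function on `P₁([a, b])`. -/
noncomputable def smulPath (hab : a < b) (χ : ℝ → ℝ) (hχ : ContDiff ℝ ∞ χ) :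
    P.pathSpace a b →L[ℝ] P.pathSpace a b :=
  P.toPathSpace (scal H₁ hab ⟨χ, hχ.continuous⟩ ∘L P.path a b)
    (scal H₀ hab ⟨χ, hχ.continuous⟩ ∘L P.pathDeriv a b +
      scal H₀ hab ⟨deriv χ, hχ.continuous_deriv (by simp)⟩ ∘L P.pathIncl hab) fun x => by
    refine IsWeakDeriv.congr_ae (IsWeakDeriv.smul x.2
      (P.incl.integrable_comp (integrableOn_pathL2 _)) (integrableOn_pathL2 _) hχ) ?_ ?_
    · filter_upwards [scal_ae_eq hab ⟨χ, hχ.continuous⟩ (P.path a b x)] with s hs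
      simp only [ContinuousLinearMap.comp_apply, hs, map_smul]
      rfl
    · filter_upwards [scal_ae_eq hab ⟨χ, hχ.continuous⟩ (P.pathDeriv a b x),
        scal_ae_eq hab ⟨deriv χ, hχ.continuous_deriv (by simp)⟩ (P.pathIncl hab x),
        Lp.coeFn_add (scal H₀ hab ⟨χ, hχ.continuous⟩ (P.pathDeriv a b x))
          (scal H₀ hab ⟨deriv χ, hχ.continuous_deriv (by simp)⟩ (P.pathIncl hab x)),
        P.pathIncl_ae_eq hab x] with s h1 h2 h3 h4
      simp only [add_apply, ContinuousLinearMap.comp_apply, h3, Pi.add_apply,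
        h1, h2, h4]
      rfl

theorem path_smulPath (hab : a < b) {χ : ℝ → ℝ} (hχ : ContDiff ℝ ∞ χ) (x : P.pathSpace a b) :
    P.path a b (P.smulPath hab χ hχ x) = scal H₁ hab ⟨χ, hχ.continuous⟩ (P.path a b x) := rfl

theorem pathDeriv_smulPath (hab : a < b) {χ : ℝ → ℝ} (hχ : ContDiff ℝ ∞ χ)
    (x : P.pathSpace a b) : P.pathDeriv a b (P.smulPath hab χ hχ x) =
      scal H₀ hab ⟨χ, hχ.continuous⟩ (P.pathDeriv a b x) +
        scal H₀ hab ⟨deriv χ, hχ.continuous_deriv (by simp)⟩ (P.pathIncl hab x) := rfl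

theorem rep_smulPath (hab : a < b) {χ : ℝ → ℝ} (hχ : ContDiff ℝ ∞ χ) (x : P.pathSpace a b)
    {t : ℝ} (ht : t ∈ Icc a b) :
    P.rep hab (P.smulPath hab χ hχ x) t = χ t • P.rep hab x t := by
  refine P.rep_eq_of_ae hab _ (g := fun t => χ t • P.rep hab x t)
    (hχ.continuous.continuousOn.smul (P.continuousOn_rep hab x)) ?_ ht
  filter_upwards [scal_ae_eq hab ⟨χ, hχ.continuous⟩ (P.path a b x), P.rep_ae_eq hab x]
    with s h1 h2
  rw [path_smulPath, h1, map_smul, h2]; rfl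

theorem eval_smulPath (hab : a < b) {χ : ℝ → ℝ} (hχ : ContDiff ℝ ∞ χ) (x : P.pathSpace a b)
    (t : Icc a b) : P.eval hab t (P.smulPath hab χ hχ x) = χ t • P.eval hab t x :=
  Subtype.ext (P.rep_smulPath hab hχ x t.2)

/-- The multiplication by `A` commutes with scalar functions, so the commutator of ∂ₛ + A and χ is
the multiplication by χ'. It factors over the inclusion of P₁ into L²([a,b], H₀) and is therefore
approximable; all cutting and pasting rests on this. -/
theorem opD_smulPath (hab : a < b) (A : C(Icc a b, H₁ →L[ℝ] H₀)) {χ : ℝ → ℝ}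
    (hχ : ContDiff ℝ ∞ χ) (x : P.pathSpace a b) : P.opD hab A (P.smulPath hab χ hχ x) =
      scal H₀ hab ⟨χ, hχ.continuous⟩ (P.opD hab A x) +
        scal H₀ hab ⟨deriv χ, hχ.continuous_deriv (by simp)⟩ (P.pathIncl hab x) := by
  change P.pathDeriv a b _ + mulOp hab A (P.path a b _) =
    scal H₀ hab _ (P.pathDeriv a b x + mulOp hab A (P.path a b x)) + _
  rw [pathDeriv_smulPath, path_smulPath, mulOp_scal, map_add]
  abel

/-- The action on `P₁([a, b])` of a pair of operators of `H₀` and `H₁` which commutes with the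
inclusion. -/
noncomputable def mapPath (hab : a < b) (S₀ : H₀ →L[ℝ] H₀) (S₁ : H₁ →L[ℝ] H₁)
    (hS : ∀ x, P.incl (S₁ x) = S₀ (P.incl x)) : P.pathSpace a b →L[ℝ] P.pathSpace a b :=
  P.toPathSpace (constOp hab S₁ ∘L P.path a b) (constOp hab S₀ ∘L P.pathDeriv a b) fun x => by
    refine IsWeakDeriv.congr_ae (IsWeakDeriv.clm_apply x.2
      (P.incl.integrable_comp (integrableOn_pathL2 _)) (integrableOn_pathL2 _) S₀) ?_ ?_
    · filter_upwards [constOp_ae_eq hab S₁ (P.path a b x)] with s hs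
      simp only [ContinuousLinearMap.comp_apply, hs, hS]
      rfl
    · filter_upwards [constOp_ae_eq hab S₀ (P.pathDeriv a b x)] with s hs
      simp only [ContinuousLinearMap.comp_apply, hs]
      rfl

theorem rep_mapPath (hab : a < b) {S₀ : H₀ →L[ℝ] H₀} {S₁ : H₁ →L[ℝ] H₁}
    (hS : ∀ x, P.incl (S₁ x) = S₀ (P.incl x)) (x : P.pathSpace a b) {t : ℝ} (ht : t ∈ Icc a b) :
    P.rep hab (P.mapPath hab S₀ S₁ hS x) t = S₀ (P.rep hab x t) := by
  refine P.rep_eq_of_ae hab _ (g := fun t => S₀ (P.rep hab x t))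
    (S₀.continuous.comp_continuousOn (P.continuousOn_rep hab x)) ?_ ht
  filter_upwards [constOp_ae_eq hab S₁ (P.path a b x), P.rep_ae_eq hab x] with s h1 h2
  rw [mapPath, path_toPathSpace, ContinuousLinearMap.comp_apply, h1, hS, h2]

/-- The constant paths. -/
noncomputable def constPath (hab : a < b) : H₁ →L[ℝ] P.pathSpace a b :=
  P.toPathSpace (Lp.constL 2 ((volume : Measure ℝ).restrict (Icc a b)) ℝ) 0 fun x => by
    refine IsWeakDeriv.congr_ae (u := fun _ => P.incl x) (v := fun _ => 0)
      (IsWeakDeriv.of_primitive hab (c := P.incl x) (integrableOn_const (by simp))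
        (Filter.Eventually.of_forall fun s => by simp)) ?_ (Lp.coeFn_zero _ _ _)
    filter_upwards [Lp.coeFn_const (p := 2) (μ := (volume : Measure ℝ).restrict (Icc a b)) x]
      with s hs
    exact congrArg P.incl hs

theorem path_constPath_ae_eq (hab : a < b) (x : H₁) :
    ∀ᵐ s ∂volume.restrict (Icc a b), P.path a b (P.constPath hab x) s = x :=
  Lp.coeFn_const (p := 2) (μ := (volume : Measure ℝ).restrict (Icc a b)) x

theorem pathDeriv_constPath (hab : a < b) (x : H₁) :
    P.pathDeriv a b (P.constPath hab x) = 0 := rfl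

theorem rep_constPath (hab : a < b) (x : H₁) {t : ℝ} (ht : t ∈ Icc a b) :
    P.rep hab (P.constPath hab x) t = P.incl x := by
  refine P.rep_eq_of_ae hab _ (g := fun _ => P.incl x) continuousOn_const ?_ ht
  filter_upwards [P.path_constPath_ae_eq hab x] with s hs
  rw [hs]

theorem rep_eq_rep_add (hab : a < b) (x : P.pathSpace a b) {s t : ℝ} (hs : s ∈ Icc a b)
    (ht : t ∈ Icc a b) :
    P.rep hab x t = P.rep hab x s + ∫ r in s..t, P.pathDeriv a b x r := by
  have hvint : ∀ s ∈ Icc a b, IntervalIntegrable (P.pathDeriv a b x) volume a s := fun s hs =>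
    (intervalIntegrable_iff_integrableOn_Icc_of_le hs.1).2
      ((integrableOn_pathL2 _).mono_set (Icc_subset_Icc_right hs.2))
  simp only [rep]
  rw [add_assoc, intervalIntegral.integral_add_adjacent_intervals (hvint s hs)
    ((hvint s hs).symm.trans (hvint t ht))]

theorem integral_norm_sq_rep (hab : a < b) (x : P.pathSpace a b) :
    ∫ s in Icc a b, ‖P.rep hab x s‖ ^ 2 = ‖P.pathIncl hab x‖ ^ 2 := by
  rw [norm_sq_pathL2]
  refine integral_congr_ae ?_
  filter_upwards [P.pathIncl_ae_eq_rep hab x] with s hs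
  rw [hs]

/-- The evaluation at `t` as a bounded operator with values in `H₀`. -/
noncomputable def evalZero (hab : a < b) (t : Icc a b) : P.pathSpace a b →L[ℝ] H₀ :=
  LinearMap.mkContinuous
    { toFun := fun x => P.rep hab x t
      map_add' := fun x y => P.rep_add hab x y t.2
      map_smul' := fun c x => P.rep_smul hab c x t.2 }
    (√((2 * ‖P.pathIncl hab‖ ^ 2 + 2 * (b - a) ^ 2) / (b - a))) fun x => by
      have hba : 0 < b - a := by linarith
      refine le_of_sq_le_sq ?_ (by positivity)
      rw [mul_pow, Real.sq_sqrt (by positivity), div_mul_eq_mul_div, le_div_iff₀ hba, mul_comm]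
      refine (trace_estimate t.2 hba le_rfl (P.continuousOn_rep hab x)
        (integrableOn_pathL2 (P.pathDeriv a b x)) (integrableOn_norm_sq_pathL2 _)
        fun s hs => P.rep_eq_rep_add hab x hs t.2).trans ?_
      rw [integral_norm_sq_rep, ← norm_sq_pathL2]
      have h1 : ‖P.pathIncl hab x‖ ^ 2 ≤ ‖P.pathIncl hab‖ ^ 2 * ‖x‖ ^ 2 := by
        rw [← mul_pow]
        exact pow_le_pow_left₀ (norm_nonneg _) (ContinuousLinearMap.le_opNorm _ _) 2
      have h2 : ‖P.pathDeriv a b x‖ ^ 2 ≤ ‖x‖ ^ 2 := by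
        rw [P.norm_sq_pathSpace]; nlinarith [sq_nonneg ‖P.path a b x‖]
      have h3 := mul_le_mul_of_nonneg_left h2 (show 0 ≤ 2 * (b - a) ^ 2 by positivity)
      nlinarith

theorem evalZero_apply (hab : a < b) (t : Icc a b) (x : P.pathSpace a b) :
    P.evalZero hab t x = P.rep hab x t := rfl

end PathOperators

end HilbertPair

/-! ### Products of scalar functions and vectors, and compactness of the inclusion of P₁. -/

namespace HilbertPair

section Tensor

variable {H H' : Type*} [NormedAddCommGroup H] [InnerProductSpace ℝ H] [CompleteSpace H]
  [NormedAddCommGroup H'] [InnerProductSpace ℝ H'] [CompleteSpace H'] {a b : ℝ}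

/-- The operator `w ↦ g • w` for a scalar function `g ∈ L²([a, b])`. -/
noncomputable def tensor (H : Type*) [NormedAddCommGroup H] [InnerProductSpace ℝ H]
    [CompleteSpace H] (hab : a < b) (g : PathL2 a b ℝ) : H →L[ℝ] PathL2 a b H :=
  LinearMap.mkContinuous
    { toFun := fun w => constOp hab (ContinuousLinearMap.toSpanSingleton ℝ w) g
      map_add' := fun w w' => by
        refine Lp.ext ?_
        filter_upwards [constOp_ae_eq hab (ContinuousLinearMap.toSpanSingleton ℝ (w + w')) g,
          constOp_ae_eq hab (ContinuousLinearMap.toSpanSingleton ℝ w) g,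
          constOp_ae_eq hab (ContinuousLinearMap.toSpanSingleton ℝ w') g,
          Lp.coeFn_add (constOp hab (ContinuousLinearMap.toSpanSingleton ℝ w) g)
            (constOp hab (ContinuousLinearMap.toSpanSingleton ℝ w') g)] with s h1 h2 h3 h4
        rw [h1, h4, Pi.add_apply, h2, h3]
        simp
      map_smul' := fun c w => by
        refine Lp.ext ?_
        filter_upwards [constOp_ae_eq hab (ContinuousLinearMap.toSpanSingleton ℝ (c • w)) g,
          constOp_ae_eq hab (ContinuousLinearMap.toSpanSingleton ℝ w) g,
          Lp.coeFn_smul c (constOp hab (ContinuousLinearMap.toSpanSingleton ℝ w) g)]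
          with s h1 h2 h3
        rw [RingHom.id_apply, h1, h3, Pi.smul_apply, h2]
        simp [smul_comm c] } ‖g‖ fun w => by
    refine (ContinuousLinearMap.le_opNorm
      (constOp hab (ContinuousLinearMap.toSpanSingleton ℝ w)) g).trans ?_
    rw [mul_comm]
    refine mul_le_mul_of_nonneg_left ((norm_constOp_le hab _).trans ?_) (norm_nonneg _)
    exact (ContinuousLinearMap.norm_toSpanSingleton w).le

theorem tensor_ae_eq (hab : a < b) (g : PathL2 a b ℝ) (w : H) :
    ∀ᵐ s ∂volume.restrict (Icc a b), tensor H hab g w s = g s • w :=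
  constOp_ae_eq hab _ g

theorem constOp_tensor (hab : a < b) (S : H →L[ℝ] H') (g : PathL2 a b ℝ) (w : H) :
    constOp hab S (tensor H hab g w) = tensor H' hab g (S w) := by
  refine Lp.ext ?_
  filter_upwards [constOp_ae_eq hab S (tensor H hab g w), tensor_ae_eq hab g w,
    tensor_ae_eq hab g (S w)] with s h1 h2 h3
  rw [h1, h2, h3, map_smul]

/-- A closed subspace of `L²([a, b], H)` which contains all products `g • w` of a continuous scalar
function `g` and a vector `w` is everything. -/
theorem eq_top_of_forall_continuous_smul (hab : a < b) {C : Submodule ℝ (PathL2 a b H)}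
    (hC : IsClosed (C : Set (PathL2 a b H)))
    (h : ∀ (g : ℝ → ℝ) (w : H) (η : PathL2 a b H), Continuous g →
      (∀ᵐ s ∂volume.restrict (Icc a b), η s = g s • w) → η ∈ C) : C = ⊤ := by
  have h1 : ∀ (g : PathL2 a b ℝ) (w : H), tensor H hab g w ∈ C := by
    intro g w
    have hcl : IsClosed {g : PathL2 a b ℝ | tensor H hab g w ∈ C} :=
      hC.preimage (constOp hab (ContinuousLinearMap.toSpanSingleton ℝ w)).continuous
    -- Bounded continuous scalar functions are dense in L², and g ↦ g • w is continuous for fixed w.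
    -- So the hypothesis extends to all square integrable g, in particular to indicator functions.
    refine (BoundedContinuousFunction.toLp_denseRange (E := ℝ) (p := 2)
      ((volume : Measure ℝ).restrict (Icc a b)) ℝ (by simp)).induction_on g hcl fun k => ?_
    refine h k w _ k.continuous ?_
    filter_upwards [tensor_ae_eq hab (BoundedContinuousFunction.toLp 2
      ((volume : Measure ℝ).restrict (Icc a b)) ℝ k) w,
      BoundedContinuousFunction.coeFn_toLp (p := 2) (𝕜 := ℝ)
        ((volume : Measure ℝ).restrict (Icc a b)) k] with s h1 h2
    rw [h1, h2]
  rw [eq_top_iff]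
  rintro η -
  refine Lp.induction (p := 2) (by simp) (fun η => η ∈ C) ?_ ?_ hC η
  · intro c s hs hμ
    have := h1 (indicatorConstLp 2 hs hμ.ne (1 : ℝ)) c
    convert this using 1
    refine Lp.ext ?_
    filter_upwards [tensor_ae_eq hab (indicatorConstLp 2 hs hμ.ne (1 : ℝ)) c,
      indicatorConstLp_coeFn (p := 2) (hs := hs) (hμs := hμ.ne) (c := (1 : ℝ)),
      indicatorConstLp_coeFn (p := 2) (hs := hs) (hμs := hμ.ne) (c := c)] with r h2 h3 h4
    rw [h2, h3, Lp.simpleFunc.coe_indicatorConst, h4]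
    by_cases hr : r ∈ s <;> simp [hr]
  · intro f g hf hg _ h2 h3
    exact C.add_mem h2 h3

/-- Strong convergence of bounded operators on `H` gives strong convergence on `L²([a, b], H)`. -/
theorem tendsto_constOp (hab : a < b) {ι : Type*} {l : Filter ι} {S : ι → H →L[ℝ] H} {M : ℝ}
    (hM : ∀ i, ‖S i‖ ≤ M) (hS : ∀ w, Filter.Tendsto (fun i => S i w) l (nhds w))
    (η : PathL2 a b H) : Filter.Tendsto (fun i => constOp hab (S i) η) l (nhds η) := by
  -- The uniform norm bound makes the set of all η for which the convergence holds closed, and for a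
  -- product g • w the convergence is that of `S i w`. So this set is everything.
  let C : Submodule ℝ (PathL2 a b H) :=
    { carrier := {η | Filter.Tendsto (fun i => constOp hab (S i) η) l (nhds η)}
      zero_mem' := by
        simpa only [mem_ofPred_eq, map_zero] using tendsto_const_nhds
      add_mem' := fun {x y} hx hy => by
        have := Filter.Tendsto.add hx hy
        simpa only [mem_ofPred_eq, map_add] using this
      smul_mem' := fun c x hx => by
        have := Filter.Tendsto.const_smul hx c
        simpa only [mem_ofPred_eq, map_smul] using this }
  have hC : IsClosed (C : Set (PathL2 a b H)) := by
    rw [← isSeqClosed_iff_isClosed]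
    intro u x hu hux
    change Filter.Tendsto (fun i => constOp hab (S i) x) l (nhds x)
    rw [Metric.tendsto_nhds]
    intro ε hε
    have hM' : 0 ≤ |M| + 2 := by positivity
    -- In the three term estimate the first error is multiplied by at most |M| and the other two by
    -- 1, whence the denominator |M| + 2. The absolute value is used because the index type may be
    -- empty and M negative.
    obtain ⟨n, hn⟩ := ((Metric.tendsto_nhds.1 hux) (ε / (|M| + 2)) (by positivity)).exists
    have hun : Filter.Tendsto (fun i => constOp hab (S i) (u n)) l (nhds (u n)) := hu n
    filter_upwards [(Metric.tendsto_nhds.1 hun) (ε / (|M| + 2)) (by positivity)] with i hi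
    rw [dist_eq_norm] at hi hn ⊢
    have e : constOp hab (S i) x - x = constOp hab (S i) (x - u n) +
        (constOp hab (S i) (u n) - u n) + (u n - x) := by rw [map_sub]; abel
    have h1 : ‖constOp hab (S i) (x - u n)‖ ≤ |M| * (ε / (|M| + 2)) := by
      refine (ContinuousLinearMap.le_opNorm _ _).trans ?_
      rw [norm_sub_rev]
      exact mul_le_mul ((norm_constOp_le hab _).trans ((hM i).trans (le_abs_self M))) hn.le
        (norm_nonneg _) (abs_nonneg M)
    rw [e]
    calc _ ≤ ‖constOp hab (S i) (x - u n)‖ + ‖constOp hab (S i) (u n) - u n‖ + ‖u n - x‖ :=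
          norm_add₃_le
      _ < |M| * (ε / (|M| + 2)) + ε / (|M| + 2) + ε / (|M| + 2) := by linarith
      _ = ε := by field_simp; ring
  have htop : C = ⊤ := by
    refine eq_top_of_forall_continuous_smul hab hC fun g w η hg hη => ?_
    have hgL : MemLp g 2 ((volume : Measure ℝ).restrict (Icc a b)) := by
      obtain ⟨B, hB⟩ := isCompact_Icc.exists_bound_of_continuousOn
        (s := Icc a b) hg.continuousOn
      exact MemLp.of_bound hg.aestronglyMeasurable B
        (by filter_upwards [ae_mem_Icc a b] with s hs using hB s hs)
    have e : η = tensor H hab hgL.toLp w := by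
      refine Lp.ext ?_
      filter_upwards [hη, tensor_ae_eq hab hgL.toLp w, hgL.coeFn_toLp] with s h1 h2 h3
      rw [h1, h2, h3]
    change Filter.Tendsto (fun i => constOp hab (S i) η) l (nhds η)
    rw [e]
    simp only [constOp_tensor]
    exact ((tensor H hab hgL.toLp).continuous.tendsto w).comp (hS w)
  have : η ∈ C := htop ▸ Submodule.mem_top
  exact this

end Tensor

section Compactness

variable {H₀ H₁ : Type*} [NormedAddCommGroup H₀] [InnerProductSpace ℝ H₀] [CompleteSpace H₀]
  [NormedAddCommGroup H₁] [InnerProductSpace ℝ H₁] [CompleteSpace H₁] (P : HilbertPair H₀ H₁)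
  {a b : ℝ}

/-- A path differs little from its mean over a short interval. -/
theorem norm_rep_sub_mean_le (hab : a < b) (x : P.pathSpace a b) {J : Set ℝ} {h : ℝ} (hh : 0 < h) (hJc : J.OrdConnected)
    (hJs : J ⊆ Icc a b) (hJv : (volume : Measure ℝ).real J = h) {s : ℝ} (hs : s ∈ J) :
    ‖P.rep hab x s - P.incl (h⁻¹ • ∫ r in J, P.path a b x r)‖ ^ 2 ≤ h * ‖x‖ ^ 2 := by
  set v := P.pathDeriv a b x with hv
  set m := ∫ r in J, ‖v r‖ with hm
  have hvJ : IntegrableOn v J := (integrableOn_pathL2 v).mono_set hJs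
  have hrJ : IntegrableOn (P.rep hab x) J :=
    ((P.continuousOn_rep hab x).integrableOn_compact isCompact_Icc).mono_set hJs
  have hJf : volume J ≠ ⊤ := ((measure_mono hJs).trans_lt (by simp)).ne
  have hpt : ∀ r ∈ J, ‖P.rep hab x s - P.rep hab x r‖ ≤ m := by
    intro r hr
    rw [P.rep_eq_rep_add hab x (hJs hr) (hJs hs), add_sub_cancel_left]
    refine (intervalIntegral.norm_integral_le_integral_norm_uIoc).trans ?_
    refine setIntegral_mono_set hvJ.norm (Filter.Eventually.of_forall fun _ => norm_nonneg _) ?_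
    exact LE.le.eventuallyLE (uIoc_subset_uIcc.trans (hJc.uIcc_subset hr hs))
  have e1 : P.incl (h⁻¹ • ∫ r in J, P.path a b x r) = h⁻¹ • ∫ r in J, P.rep hab x r := by
    rw [map_smul, ← P.incl.integral_comp_comm ((integrableOn_pathL2 _).mono_set hJs)]
    congr 1
    refine integral_congr_ae ?_
    exact ae_restrict_of_ae_restrict_of_subset hJs (P.rep_ae_eq hab x)
  have e2 : P.rep hab x s - h⁻¹ • ∫ r in J, P.rep hab x r =
      h⁻¹ • ∫ r in J, (P.rep hab x s - P.rep hab x r) := by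
    rw [integral_sub (integrableOn_const (C := P.rep hab x s) hJf (by simp)) hrJ, setIntegral_const, hJv, smul_sub, smul_smul,
      inv_mul_cancel₀ hh.ne', one_smul]
  have h3 : ‖∫ r in J, (P.rep hab x s - P.rep hab x r)‖ ≤ m * h := by
    have := norm_setIntegral_le_of_norm_le_const hJf.lt_top hpt
    rwa [hJv] at this
  have h4 : ‖P.rep hab x s - P.incl (h⁻¹ • ∫ r in J, P.path a b x r)‖ ≤ m := by
    rw [e1, e2, norm_smul, Real.norm_of_nonneg (inv_nonneg.2 hh.le)]
    calc h⁻¹ * ‖∫ r in J, (P.rep hab x s - P.rep hab x r)‖ ≤ h⁻¹ * (m * h) := by gcongr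
      _ = m := by field_simp
  have h5 : m ^ 2 ≤ h * ‖x‖ ^ 2 := by
    have := integral_sq_le_mul_norm_sq hJs v
    rw [hJv, ← norm_sq_pathL2] at this
    refine this.trans (mul_le_mul_of_nonneg_left ?_ hh.le)
    rw [P.norm_sq_pathSpace]
    nlinarith [sq_nonneg ‖P.path a b x‖]
  exact (pow_le_pow_left₀ (norm_nonneg _) h4 2).trans h5

/-- The compactness of the inclusion `P₁([a, b]) → L²([a, b], H₀)`. -/
theorem isApproximable_pathIncl (hab : a < b) : (P.pathIncl hab).IsApproximable := by
  refine .of_forall_exists fun ε hε => ?_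
  have hba : 0 < b - a := by linarith
  -- A path is replaced by its means over n intervals of length h = (b − a)/n. The squared pointwise
  -- error is at most h‖x‖², so the squared L² error is at most ((b − a)²/n)‖x‖².
  obtain ⟨n, hn⟩ := exists_nat_gt ((b - a) ^ 2 / (ε / 2) ^ 2)
  have hn0 : 0 < (n : ℝ) := lt_of_le_of_lt (by positivity) hn
  set h : ℝ := (b - a) / n with hh
  have hh0 : 0 < h := div_pos hba hn0
  have hnh : n * h = b - a := by rw [hh]; field_simp
  -- Half-open intervals, so that every point of [a, b) lies in exactly one of them; the point b is
  -- a null set.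
  let J : ℕ → Set ℝ := fun k => Ico (a + k * h) (a + k * h + h)
  have hJm : ∀ k, MeasurableSet (J k) := fun k => measurableSet_Ico
  have hJs : ∀ k < n, J k ⊆ Icc a b := by
    intro k hk s hs
    have h1 : a + k * h ≤ s := hs.1
    have h2 : s < a + k * h + h := hs.2
    have h3 : ((k : ℝ) + 1) * h ≤ n * h := by gcongr; exact_mod_cast hk
    have h4 : 0 ≤ k * h := by positivity
    constructor <;> linarith
  have hJf : ∀ k, ((volume : Measure ℝ).restrict (Icc a b)) (J k) ≠ ⊤ := fun k =>
    (measure_lt_top _ _).ne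
  let e : ℕ → PathL2 a b ℝ := fun k => indicatorConstLp 2 (hJm k) (hJf k) (1 : ℝ)
  -- The mean is formed in H₁ and only then included in H₀: the compactness of the inclusion makes
  -- each summand approximable. The value 0 for k ≥ n does not enter the sum.
  let I : ℕ → PathL2 a b H₁ →L[ℝ] H₁ := fun k =>
    if hk : k < n then integralOp H₁ (hJs k hk) else 0
  let S : ℕ → P.pathSpace a b →L[ℝ] PathL2 a b H₀ := fun k =>
    tensor H₀ hab (e k) ∘L P.incl ∘L (h⁻¹ • I k) ∘L P.path a b
  refine ⟨∑ k ∈ Finset.range n, S k, .sum _ fun k _ => ?_, ?_⟩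
  · exact ((ContinuousLinearMap.IsApproximable.of_isCompactOperator P.compact_incl).comp_right
      _).comp_left _
  · refine lt_of_le_of_lt (ContinuousLinearMap.opNorm_le_bound _ (by positivity : 0 ≤ ε / 2)
      fun x => ?_) (by linarith)
    refine le_of_sq_le_sq ?_ (by positivity)
    have hae : ∀ᵐ s ∂volume.restrict (Icc a b),
        ‖(P.pathIncl hab - ∑ k ∈ Finset.range n, S k) x s‖ ^ 2 ≤ h * ‖x‖ ^ 2 := by
      have hIco : ∀ᵐ s ∂volume.restrict (Icc a b), s ∈ Ico a b := by
        rw [← Measure.restrict_congr_set (Ico_ae_eq_Icc (a := a) (b := b) (μ := volume))]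
        exact ae_restrict_mem measurableSet_Ico
      have hSk : ∀ᵐ s ∂volume.restrict (Icc a b), ∀ k, S k x s =
          (J k).indicator (fun _ => (1 : ℝ)) s • P.incl ((h⁻¹ • I k) (P.path a b x)) := by
        rw [ae_all_iff]
        intro k
        filter_upwards [tensor_ae_eq hab (e k) (P.incl ((h⁻¹ • I k) (P.path a b x))),
          indicatorConstLp_coeFn (p := 2) (hs := hJm k) (hμs := hJf k) (c := (1 : ℝ))]
          with s h1 h2
        rw [← h2]
        exact h1
      filter_upwards [hIco, hSk, P.pathIncl_ae_eq_rep hab x,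
        Lp.coeFn_sub (P.pathIncl hab x) ((∑ k ∈ Finset.range n, S k) x),
        Lp.coeFn_fun_finsetSum (Finset.range n) fun k => S k x] with s h1 h2 h3 h4 h5
      rw [sub_apply, h4, Pi.sub_apply, sum_apply, h5, h3]
      simp only [h2]
      set k := ⌊(s - a) / h⌋₊ with hk
      have hs0 : 0 ≤ (s - a) / h := div_nonneg (by linarith [h1.1]) hh0.le
      have hk1 : k * h ≤ s - a := by
        rw [← le_div_iff₀ hh0]; exact Nat.floor_le hs0
      have hk2 : s - a < (k + 1) * h := by
        rw [← div_lt_iff₀ hh0]; exact Nat.lt_floor_add_one _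
      have hkn : k < n := by
        rw [hk, Nat.floor_lt hs0, div_lt_iff₀ hh0, hnh]
        linarith [h1.2]
      have hsk : s ∈ J k := ⟨by linarith, by linarith⟩
      have huniq : ∀ i ∈ Finset.range n, i ≠ k →
          (J i).indicator (fun _ => (1 : ℝ)) s • P.incl ((h⁻¹ • I i) (P.path a b x)) = 0 := by
        intro i _ hik
        have : s ∉ J i := by
          rintro ⟨h6, h7⟩
          rcases lt_or_gt_of_ne hik with h8 | h8
          · have : ((i : ℝ) + 1) * h ≤ k * h := by gcongr; exact_mod_cast h8
            linarith
          · have : ((k : ℝ) + 1) * h ≤ i * h := by gcongr; exact_mod_cast h8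
            linarith
        simp [this]
      rw [Finset.sum_eq_single k huniq (fun hc => absurd (Finset.mem_range.2 hkn) hc),
        indicator_of_mem hsk, one_smul]
      have hI : (h⁻¹ • I k) (P.path a b x) = h⁻¹ • ∫ r in J k, P.path a b x r := by
        simp [I, hkn, integralOp_apply]
      rw [hI]
      exact P.norm_rep_sub_mean_le hab x hh0 ordConnected_Ico (hJs k hkn)
        (by simp [measureReal_def, hh0.le]) hsk
    rw [norm_sq_pathL2]
    calc _ ≤ ∫ s in Icc a b, h * ‖x‖ ^ 2 :=
          integral_mono_ae (integrableOn_norm_sq_pathL2 _) (integrableOn_const (by simp)) hae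
      _ = (b - a) * (h * ‖x‖ ^ 2) := by
          rw [setIntegral_const, smul_eq_mul]; simp [measureReal_def, hab.le]
      _ = ((b - a) ^ 2 / n) * ‖x‖ ^ 2 := by rw [hh]; field_simp
      _ ≤ (ε / 2) ^ 2 * ‖x‖ ^ 2 := by
          gcongr
          rw [div_lt_iff₀ (by positivity)] at hn
          rw [div_le_iff₀ hn0]
          linarith
      _ = (ε / 2 * ‖x‖) ^ 2 := by ring

end Compactness

end HilbertPair

/-! ### Sums of orthogonal vectors. -/

section Orthogonal

variable {ι E : Type*} [NormedAddCommGroup E] [InnerProductSpace ℝ E] {q : ι → E}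

/-- Passing to the lines spanned by the vectors gives access to the theory of orthogonal families
while some vectors are allowed to vanish. -/
theorem orthogonalFamily_span_singleton (hq : ∀ i j, i ≠ j → ⟪q i, q j⟫_ℝ = 0) :
    OrthogonalFamily ℝ (fun i => Submodule.span ℝ {q i})
      fun i => (Submodule.span ℝ {q i}).subtypeₗᵢ :=
  .of_pairwise fun i j h => Submodule.isOrtho_span.2 <| by
    rintro _ rfl _ rfl
    exact hq i j h

theorem norm_sum_sq_of_inner_eq_zero (hq : ∀ i j, i ≠ j → ⟪q i, q j⟫_ℝ = 0) (F : Finset ι) :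
    ‖∑ i ∈ F, q i‖ ^ 2 = ∑ i ∈ F, ‖q i‖ ^ 2 :=
  (orthogonalFamily_span_singleton hq).norm_sum
    (fun i => ⟨q i, Submodule.mem_span_singleton_self _⟩) F

theorem summable_of_inner_eq_zero [CompleteSpace E] (hq : ∀ i j, i ≠ j → ⟪q i, q j⟫_ℝ = 0)
    (h : Summable fun i => ‖q i‖ ^ 2) : Summable q :=
  ((orthogonalFamily_span_singleton hq).summable_iff_norm_sq_summable
    (fun i => ⟨q i, Submodule.mem_span_singleton_self _⟩)).2 h

end Orthogonal

/-! ### H_{1/2} as the trace space of P₁. -/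

namespace HilbertPair

section Extension

variable {H₀ H₁ : Type*} [NormedAddCommGroup H₀] [InnerProductSpace ℝ H₀] [CompleteSpace H₀]
  [NormedAddCommGroup H₁] [InnerProductSpace ℝ H₁] [CompleteSpace H₁] (P : HilbertPair H₀ H₁)
  {a b : ℝ}

/-- The projection to the eigenspace `V κ`, as an operator with values in `H₁`. -/
noncomputable def eigenLift (κ : ℝ) : H₀ →L[ℝ] H₁ :=
  κ⁻¹ • (P.incl.adjoint ∘L (P.eigen κ).starProjection)

/-- The adjoint of the inclusion, composed with the inclusion, is the growth operator, which is κ on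
its eigenspace. So κ⁻¹ times the adjoint inverts the inclusion there. For κ ≤ 0, in particular for
the junk value of κ⁻¹ at 0, the eigenspace is trivial. -/
theorem growth_eigenLift_and_incl (κ : ℝ) (x : H₀) :
    P.growth (P.eigenLift κ x) = κ • P.eigenLift κ x ∧
      P.incl (P.eigenLift κ x) = (P.eigen κ).starProjection x := by
  obtain ⟨v, hv, hv2⟩ := P.mem_eigen.1 ((P.eigen κ).starProjection_apply_mem x)
  have e : P.eigenLift κ x = κ⁻¹ • P.growth v := by
    simp [eigenLift, ← hv2, growth]
  rcases le_or_gt κ 0 with h | h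
  · have hv0 : v = 0 := P.eq_zero_of_growth h hv
    rw [e, ← hv2, hv0]; simp
  · have e' : P.eigenLift κ x = v := by rw [e, hv, inv_smul_smul₀ h.ne']
    rw [e']; exact ⟨hv, hv2⟩

theorem incl_eigenLift (κ : ℝ) (x : H₀) :
    P.incl (P.eigenLift κ x) = (P.eigen κ).starProjection x :=
  (P.growth_eigenLift_and_incl κ x).2

theorem growth_eigenLift (κ : ℝ) (x : H₀) :
    P.growth (P.eigenLift κ x) = κ • P.eigenLift κ x :=
  (P.growth_eigenLift_and_incl κ x).1

/-- The decaying exponential function with rate `κ ^ (-1/2)` which is `1` at `a`. -/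
noncomputable def decay (a κ : ℝ) : ℝ → ℝ := fun s => Real.exp (-(√κ)⁻¹ * (s - a))

theorem contDiff_decay (a κ : ℝ) : ContDiff ℝ ∞ (decay a κ) := by
  unfold decay; fun_prop

theorem deriv_decay (a κ s : ℝ) : deriv (decay a κ) s = -(√κ)⁻¹ * decay a κ s := by
  have : HasDerivAt (decay a κ) (Real.exp (-(√κ)⁻¹ * (s - a)) * (-(√κ)⁻¹ * 1)) s :=
    (((hasDerivAt_id s).sub_const a).const_mul _).exp
  rw [this.deriv, decay]; ring

/-- A primitive of the integrand is −(√κ/2) times itself. The end a contributes √κ/2, and the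
contribution of b has the favourable sign. -/
theorem integral_decay_sq_le (hab : a < b) {κ : ℝ} (hκ : 0 < κ) :
    ∫ s in Icc a b, decay a κ s ^ 2 ≤ √κ / 2 := by
  have hs : 0 < √κ := Real.sqrt_pos.2 hκ
  have hd : ∀ s ∈ uIcc a b, HasDerivAt (fun s => -(√κ / 2) * decay a κ s ^ 2)
      (decay a κ s ^ 2) s := by
    intro s _
    have h1 : HasDerivAt (decay a κ) (-(√κ)⁻¹ * decay a κ s) s := by
      rw [← deriv_decay]
      exact ((contDiff_decay a κ).differentiable (by simp)).differentiableAt.hasDerivAt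
    refine ((h1.pow 2).const_mul (-(√κ / 2))).congr_deriv ?_
    have e : √κ * (√κ)⁻¹ = 1 := mul_inv_cancel₀ hs.ne'
    push_cast
    linear_combination decay a κ s ^ 2 * e
  rw [integral_Icc_eq_integral_Ioc, ← intervalIntegral.integral_of_le hab.le,
    intervalIntegral.integral_eq_sub_of_hasDerivAt hd
      (((contDiff_decay a κ).continuous.pow 2).intervalIntegrable _ _)]
  have : decay a κ a = 1 := by simp [decay]
  rw [this]
  nlinarith [sq_nonneg (decay a κ b)]

/-- The extension of the `κ`-component of a vector to a path. -/
noncomputable def eigenPath (hab : a < b) (κ : ℝ) : H₀ →L[ℝ] P.pathSpace a b :=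
  P.smulPath hab (decay a κ) (contDiff_decay a κ) ∘L P.constPath hab ∘L P.eigenLift κ

theorem path_eigenPath_ae_eq (hab : a < b) (κ : ℝ) (x : H₀) :
    ∀ᵐ s ∂volume.restrict (Icc a b),
      P.path a b (P.eigenPath hab κ x) s = decay a κ s • P.eigenLift κ x := by
  filter_upwards [scal_ae_eq hab ⟨decay a κ, (contDiff_decay a κ).continuous⟩
    (P.path a b (P.constPath hab (P.eigenLift κ x))),
    P.path_constPath_ae_eq hab (P.eigenLift κ x)] with s h1 h2
  rw [h2] at h1
  exact h1

theorem pathDeriv_eigenPath_ae_eq (hab : a < b) (κ : ℝ) (x : H₀) :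
    ∀ᵐ s ∂volume.restrict (Icc a b), P.pathDeriv a b (P.eigenPath hab κ x) s =
      (-(√κ)⁻¹ * decay a κ s) • (P.eigen κ).starProjection x := by
  have hc := (contDiff_decay a κ).continuous_deriv (by simp)
  have e : P.pathDeriv a b (P.eigenPath hab κ x) = scal H₀ hab ⟨deriv (decay a κ), hc⟩
      (P.pathIncl hab (P.constPath hab (P.eigenLift κ x))) := by
    change P.pathDeriv a b (P.smulPath hab (decay a κ) (contDiff_decay a κ)
      (P.constPath hab (P.eigenLift κ x))) = _
    rw [pathDeriv_smulPath, pathDeriv_constPath, map_zero, zero_add]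
  rw [e]
  filter_upwards [scal_ae_eq hab ⟨deriv (decay a κ), hc⟩
    (P.pathIncl hab (P.constPath hab (P.eigenLift κ x))),
    P.path_constPath_ae_eq hab (P.eigenLift κ x),
    P.pathIncl_ae_eq hab (P.constPath hab (P.eigenLift κ x))] with s h1 h2 h3
  rw [h1, h3, h2, incl_eigenLift, ← deriv_decay]
  rfl

theorem inner_pathSpace (x y : P.pathSpace a b) : ⟪x, y⟫_ℝ =
    ⟪P.path a b x, P.path a b y⟫_ℝ + ⟪P.pathDeriv a b x, P.pathDeriv a b y⟫_ℝ :=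
  WithLp.prod_inner_apply x.1 y.1

/-- Different eigenspaces are orthogonal in H₁ and in H₀, hence for both terms of the inner product
of P₁. -/
theorem inner_eigenPath (hab : a < b) {κ κ' : ℝ} (h : κ ≠ κ') (x y : H₀) :
    ⟪P.eigenPath hab κ x, P.eigenPath hab κ' y⟫_ℝ = 0 := by
  have h0 := P.inner_eigen_eq_zero h (P.growth_eigenLift κ x) (P.growth_eigenLift κ' y)
  rw [inner_pathSpace, L2.inner_def, L2.inner_def]
  have e1 : ∫ s in Icc a b, ⟪P.path a b (P.eigenPath hab κ x) s,
      P.path a b (P.eigenPath hab κ' y) s⟫_ℝ = 0 := by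
    refine integral_eq_zero_of_ae ?_
    filter_upwards [P.path_eigenPath_ae_eq hab κ x, P.path_eigenPath_ae_eq hab κ' y] with s h1 h2
    rw [h1, h2, inner_smul_left, inner_smul_right, h0.1]; simp
  have e2 : ∫ s in Icc a b, ⟪P.pathDeriv a b (P.eigenPath hab κ x) s,
      P.pathDeriv a b (P.eigenPath hab κ' y) s⟫_ℝ = 0 := by
    refine integral_eq_zero_of_ae ?_
    filter_upwards [P.pathDeriv_eigenPath_ae_eq hab κ x, P.pathDeriv_eigenPath_ae_eq hab κ' y]
      with s h1 h2
    rw [h1, h2, inner_smul_left, inner_smul_right, ← incl_eigenLift, ← incl_eigenLift, h0.2]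
    simp
  rw [e1, e2, add_zero]

/-- The decay rate κ^(-1/2) balances the two parts of the norm of P₁: both are κ⁻¹‖x_κ‖₀² times the
integral of the squared exponential, which is at most √κ/2. Their sum is bounded by κ^(-1/2)‖x_κ‖₀²,
precisely the weight in the norm of H_{1/2}. -/
theorem norm_eigenPath_sq_le (hab : a < b) (κ : ℝ) (x : H₀) :
    ‖P.eigenPath hab κ x‖ ^ 2 ≤ ‖P.halfCoeff x κ‖ ^ 2 := by
  rcases le_or_gt κ 0 with h | hκ
  · have : P.eigenLift κ x = 0 := P.eq_zero_of_growth h (P.growth_eigenLift κ x)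
    simp only [eigenPath, ContinuousLinearMap.comp_apply, this, map_zero, norm_zero]
    simp
  have hs : 0 < √κ := Real.sqrt_pos.2 hκ
  have hκs : κ = √κ * √κ := (Real.mul_self_sqrt hκ.le).symm
  have hint : IntegrableOn (fun s => decay a κ s ^ 2) (Icc a b) :=
    ((contDiff_decay a κ).continuous.pow 2).continuousOn.integrableOn_compact isCompact_Icc
  set N := ‖(P.eigen κ).starProjection x‖ ^ 2 with hN
  have e2 : ‖P.halfCoeff x κ‖ ^ 2 = (√κ)⁻¹ * N := by
    rw [halfCoeff, norm_smul, mul_pow, Real.norm_of_nonneg (Real.rpow_nonneg hκ.le _),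
      ← Real.rpow_natCast, ← Real.rpow_mul hκ.le, Real.sqrt_eq_rpow, ← Real.rpow_neg hκ.le]
    norm_num
    exact Or.inl rfl
  have hq : ‖P.eigenLift κ x‖ ^ 2 = κ⁻¹ * N := by
    have := P.norm_incl_sq_of_growth (P.growth_eigenLift κ x)
    rw [incl_eigenLift] at this
    rw [hN, this, inv_mul_cancel_left₀ hκ.ne']
  have n1 : ‖P.path a b (P.eigenPath hab κ x)‖ ^ 2 =
      (∫ s in Icc a b, decay a κ s ^ 2) * (κ⁻¹ * N) := by
    rw [norm_sq_pathL2, ← integral_mul_const]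
    refine integral_congr_ae ?_
    filter_upwards [P.path_eigenPath_ae_eq hab κ x] with s h1
    rw [h1, norm_smul, mul_pow, hq, Real.norm_eq_abs, sq_abs]
  have n2 : ‖P.pathDeriv a b (P.eigenPath hab κ x)‖ ^ 2 =
      (∫ s in Icc a b, decay a κ s ^ 2) * (κ⁻¹ * N) := by
    rw [norm_sq_pathL2, ← integral_mul_const]
    refine integral_congr_ae ?_
    filter_upwards [P.pathDeriv_eigenPath_ae_eq hab κ x] with s h1
    rw [h1, norm_smul, mul_pow, Real.norm_eq_abs, sq_abs, mul_pow, neg_sq, inv_pow,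
      Real.sq_sqrt hκ.le]
    ring
  rw [P.norm_sq_pathSpace, n1, n2, e2]
  have hN0 : 0 ≤ N := by positivity
  calc _ = 2 * (∫ s in Icc a b, decay a κ s ^ 2) * (κ⁻¹ * N) := by ring
    _ ≤ 2 * (√κ / 2) * (κ⁻¹ * N) := by
        gcongr
        exact integral_decay_sq_le hab hκ
    _ = (√κ)⁻¹ * N := by
        nth_rewrite 2 [hκs]
        field_simp

theorem sum_halfCoeff_le (x : P.Half) (F : Finset ℝ) :
    ∑ κ ∈ F, ‖P.halfCoeff (Half.val P x) κ‖ ^ 2 ≤ ‖x‖ ^ 2 := by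
  have := lp.sum_rpow_le_norm_rpow (p := 2) (by norm_num) (Half.coeff P x) F
  simp only [ENNReal.toReal_ofNat, Real.rpow_ofNat] at this
  exact this

theorem norm_sum_eigenPath_sq_le (hab : a < b) (x : P.Half) (F : Finset ℝ) :
    ‖∑ κ ∈ F, P.eigenPath hab κ (Half.val P x)‖ ^ 2 ≤ ‖x‖ ^ 2 := by
  rw [norm_sum_sq_of_inner_eq_zero (fun κ κ' h => P.inner_eigenPath hab h _ _)]
  refine (Finset.sum_le_sum fun κ _ => ?_).trans (P.sum_halfCoeff_le x F)
  exact P.norm_eigenPath_sq_le hab κ _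

theorem summable_eigenPath (hab : a < b) (x : P.Half) :
    Summable fun κ => P.eigenPath hab κ (Half.val P x) := by
  have := P.completeSpace_pathSpace hab
  refine summable_of_inner_eq_zero (fun κ κ' h => P.inner_eigenPath hab h _ _) ?_
  refine summable_of_sum_le (c := ‖x‖ ^ 2) (fun _ => by positivity) fun F => ?_
  exact (Finset.sum_le_sum fun κ _ => P.norm_eigenPath_sq_le hab κ _).trans
    (P.sum_halfCoeff_le x F)

/-- A bounded right inverse of the evaluation at `a`. -/
noncomputable def halfExt (hab : a < b) : P.Half →L[ℝ] P.pathSpace a b :=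
  LinearMap.mkContinuous
    { toFun := fun x => ∑' κ, P.eigenPath hab κ (Half.val P x)
      map_add' := fun x y => by
        rw [← (P.summable_eigenPath hab x).tsum_add (P.summable_eigenPath hab y)]
        simp only [map_add]
      map_smul' := fun c x => by
        simp only [map_smul, RingHom.id_apply]
        exact (P.summable_eigenPath hab x).tsum_const_smul c } 1 fun x => by
      rw [one_mul]
      refine le_of_tendsto (P.summable_eigenPath hab x).hasSum.norm
        (Filter.Eventually.of_forall fun F => ?_)
      exact le_of_sq_le_sq (P.norm_sum_eigenPath_sq_le hab x F) (norm_nonneg _)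

theorem hasSum_halfExt (hab : a < b) (x : P.Half) :
    HasSum (fun κ => P.eigenPath hab κ (Half.val P x)) (P.halfExt hab x) :=
  (P.summable_eigenPath hab x).hasSum

/-- The series converges in P₁, so it may be evaluated termwise in H₀. The κ-th term has the value
x_κ at a, and the eigenspace projections, which are mutually orthogonal, separate the points of H₀.
-/
theorem eval_halfExt (hab : a < b) (x : P.Half) :
    P.eval hab ⟨a, left_mem_Icc.2 hab.le⟩ (P.halfExt hab x) = x := by
  set t : Icc a b := ⟨a, left_mem_Icc.2 hab.le⟩ with ht
  refine Subtype.ext ?_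
  change P.evalZero hab t (P.halfExt hab x) = Half.val P x
  have h1 := (P.hasSum_halfExt hab x).mapL (P.evalZero hab t)
  have h2 : ∀ κ, P.evalZero hab t (P.eigenPath hab κ (Half.val P x)) =
      (P.eigen κ).starProjection (Half.val P x) := by
    intro κ
    rw [evalZero_apply]
    change P.rep hab (P.smulPath hab (decay a κ) (contDiff_decay a κ)
      (P.constPath hab (P.eigenLift κ (Half.val P x)))) t = _
    rw [P.rep_smulPath hab _ _ t.2, P.rep_constPath hab _ t.2,
      incl_eigenLift]
    simp [decay, ht]
  simp only [h2] at h1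
  rw [← sub_eq_zero]
  refine P.eq_zero_of_starProjection_eigen fun κ => ?_
  have h3 := h1.mapL (P.eigen κ).starProjection
  have h4 := hasSum_single (f := fun κ' => (P.eigen κ).starProjection
    ((P.eigen κ').starProjection (Half.val P x))) κ fun κ' hκ => by
      rw [Submodule.starProjection_apply_eq_zero_iff, Submodule.mem_orthogonal]
      intro u hu
      obtain ⟨v, hv, rfl⟩ := P.mem_eigen.1 hu
      rw [← incl_eigenLift]
      exact (P.inner_eigen_eq_zero hκ.symm hv (P.growth_eigenLift _ _)).2
  have h5 : (P.eigen κ).starProjection ((P.eigen κ).starProjection (Half.val P x)) =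
      (P.eigen κ).starProjection (Half.val P x) :=
    Submodule.starProjection_eq_self_iff.2 (Submodule.starProjection_apply_mem _ _)
  rw [h5] at h4
  rw [map_sub, h3.unique h4, sub_self]

/-- The maps `halfExt` and `eval` exhibit H_{1/2} as a retract of the complete space P₁([0, 1]):
extend a Cauchy sequence, take the limit there, and evaluate it. -/
theorem completeSpace_half : CompleteSpace P.Half := by
  have hab : (0 : ℝ) < 1 := one_pos
  have := P.completeSpace_pathSpace hab
  refine Metric.complete_of_cauchySeq_tendsto fun u hu => ?_
  have h1 : CauchySeq fun n => P.halfExt hab (u n) :=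
    hu.map (P.halfExt hab).uniformContinuous
  obtain ⟨y, hy⟩ := cauchySeq_tendsto_of_complete h1
  refine ⟨P.eval hab ⟨0, left_mem_Icc.2 hab.le⟩ y, ?_⟩
  have h2 := ((P.eval hab ⟨0, left_mem_Icc.2 hab.le⟩).continuous.tendsto y).comp hy
  refine h2.congr fun n => ?_
  exact P.eval_halfExt hab (u n)

instance : CompleteSpace P.Half := P.completeSpace_half

/-- The inclusion `H_{1/2} → H₀` as a bounded operator. -/
noncomputable def halfVal : P.Half →L[ℝ] H₀ :=
  P.evalZero one_pos ⟨0, left_mem_Icc.2 zero_le_one⟩ ∘L P.halfExt one_pos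

theorem halfVal_apply (x : P.Half) : P.halfVal x = Half.val P x :=
  congrArg (Half.val P) (P.eval_halfExt one_pos x)

theorem halfVal_injective : Function.Injective P.halfVal := fun x y h => by
  rw [halfVal_apply, halfVal_apply] at h
  exact Subtype.ext h

theorem halfVal_eval (hab : a < b) (t : Icc a b) (x : P.pathSpace a b) :
    P.halfVal (P.eval hab t x) = P.rep hab x t := by
  rw [halfVal_apply]; rfl

/-- The inclusion `H₁ → H_{1/2}`. -/
noncomputable def halfIncl : H₁ →L[ℝ] P.Half :=
  P.eval one_pos ⟨0, left_mem_Icc.2 zero_le_one⟩ ∘L P.constPath one_pos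

theorem halfVal_halfIncl (v : H₁) : P.halfVal (P.halfIncl v) = P.incl v := by
  rw [halfIncl, ContinuousLinearMap.comp_apply, halfVal_eval]
  exact P.rep_constPath one_pos v (left_mem_Icc.2 zero_le_one)

theorem eval_constPath (hab : a < b) (t : Icc a b) (v : H₁) :
    P.eval hab t (P.constPath hab v) = P.halfIncl v :=
  P.halfVal_injective (by rw [halfVal_eval, halfVal_halfIncl, P.rep_constPath hab v t.2])

/-- This is the series of `halfExt` evaluated at the initial point, where all exponentials are 1. It
gives the density of H₁ in H_{1/2}. -/
theorem hasSum_halfIncl_eigenLift (x : P.Half) :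
    HasSum (fun κ => P.halfIncl (P.eigenLift κ (P.halfVal x))) x := by
  have h := (P.hasSum_halfExt one_pos x).mapL (P.eval one_pos ⟨0, left_mem_Icc.2 zero_le_one⟩)
  rw [P.eval_halfExt one_pos] at h
  convert h using 2 with κ
  change _ = P.eval one_pos _ (P.smulPath one_pos (decay 0 κ) (contDiff_decay 0 κ)
    (P.constPath one_pos _))
  rw [eval_smulPath, eval_constPath, halfVal_apply]
  simp [decay]

/-- A closed subspace of `H_{1/2}` which contains `H₁` is everything. -/
theorem half_eq_top_of_halfIncl_mem {C : Submodule ℝ P.Half} (hC : IsClosed (C : Set P.Half))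
    (h : ∀ v, P.halfIncl v ∈ C) : C = ⊤ := by
  rw [eq_top_iff]
  rintro x -
  exact hC.mem_of_tendsto (P.hasSum_halfIncl_eigenLift x)
    (Filter.Eventually.of_forall fun F => C.sum_mem fun κ _ => h _)

end Extension

end HilbertPair

-- Diagonalization of invertible symmetrizable operators.

universe u

/-- A copy of a vector space, to carry another norm. -/
def Renormed (H : Type*) : Type _ := H

instance {H : Type*} [h : AddCommGroup H] : AddCommGroup (Renormed H) := h
instance {H : Type*} [AddCommGroup H] [h : Module ℝ H] : Module ℝ (Renormed H) := h

/-- An inner product which is equivalent to the given one is the pull back of the inner product of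
some Hilbert space under a linear homeomorphism. -/
theorem exists_equiv_of_equivalent_form {H : Type u} [NormedAddCommGroup H] [InnerProductSpace ℝ H]
    [CompleteSpace H] (b : H →ₗ[ℝ] H →ₗ[ℝ] ℝ) (hb : ∀ x y, b x y = b y x) {c : ℝ} (hc : 0 < c)
    (h : ∀ x, c⁻¹ * ‖x‖ ≤ √(b x x) ∧ √(b x x) ≤ c * ‖x‖) :
    ∃ (H' : Type u) (_ : NormedAddCommGroup H') (_ : InnerProductSpace ℝ H') (_ : CompleteSpace H')
      (U : H ≃L[ℝ] H'), ∀ x y, ⟪U x, U y⟫_ℝ = b x y := by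
  have hpos : ∀ x, x ≠ 0 → 0 < b x x := fun x hx => by
    have h1 : 0 < √(b x x) := lt_of_lt_of_le (by positivity) (h x).1
    exact Real.sqrt_pos.1 h1
  let b' : Renormed H →ₗ[ℝ] Renormed H →ₗ[ℝ] ℝ := b
  let core : InnerProductSpace.Core ℝ (Renormed H) :=
    { inner := fun x y => b' x y
      conj_inner_symm := fun x y => hb y x
      re_inner_nonneg := fun x => by
        change 0 ≤ b x x
        by_cases hx : x = 0
        · rw [show b x x = 0 by rw [hx]; exact (b _).map_zero]
        · exact (hpos x hx).le
      add_left := fun x y z => by simp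
      smul_left := fun x y r => by simp
      definite := fun x hx => by
        by_contra h0
        exact (hpos x h0).ne' hx }
  let i1 : NormedAddCommGroup (Renormed H) := core.toNormedAddCommGroup
  let i2 : InnerProductSpace ℝ (Renormed H) := InnerProductSpace.ofCore core.toCore
  let e : H ≃ₗ[ℝ] Renormed H := LinearEquiv.refl ℝ H
  have hn : ∀ x, ‖e x‖ = √(b x x) := fun x => rfl
  let U : H ≃L[ℝ] Renormed H := e.toContinuousLinearEquivOfBounds c c
    (fun x => (h x).2) fun y => by
      have h1 := (h (e.symm y)).1
      rw [inv_mul_le_iff₀ hc, ← hn, e.apply_symm_apply] at h1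
      exact h1
  have hC : CompleteSpace (Renormed H) :=
    (completeSpace_congr (e := U.toEquiv) U.isUniformEmbedding).1 inferInstance
  exact ⟨Renormed H, i1, i2, hC, U, fun x y => rfl⟩

/-- The spectral theorem for injective compact symmetric operators. -/
theorem exists_hilbertBasis_eigenvectors {H : Type*} [NormedAddCommGroup H] [InnerProductSpace ℝ H]
    [CompleteSpace H] {K : H →L[ℝ] H} (hK : IsCompactOperator K)
    (hs : (K : H →ₗ[ℝ] H).IsSymmetric) (hi : Function.Injective K) :
    ∃ (ι : Type) (k : ι → ℝ) (B : HilbertBasis ι ℝ H), ∀ i, K (B i) = k i • B i := by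
  -- Compactness settles μ ≠ 0 and injectivity settles μ = 0, so each eigenspace has a finite
  -- orthonormal basis. Their union is total because the eigenspaces are.
  have hfin : ∀ μ : ℝ, FiniteDimensional ℝ (Module.End.eigenspace (K : Module.End ℝ H) μ) := by
    intro μ
    rcases eq_or_ne μ 0 with rfl | h
    · have : Module.End.eigenspace (K : Module.End ℝ H) 0 = ⊥ := by
        rw [Module.End.eigenspace_zero]
        exact LinearMap.ker_eq_bot.2 hi
      rw [this]
      infer_instance
    · exact ContinuousLinearMap.finite_dimensional_eigenspace hK μ h
  let B := fun μ : ℝ => stdOrthonormalBasis ℝ (Module.End.eigenspace (K : Module.End ℝ H) μ)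
  let v : (Σ μ : ℝ, Fin (Module.finrank ℝ (Module.End.eigenspace (K : Module.End ℝ H) μ))) → H :=
    fun i => B i.1 i.2
  have hv : Orthonormal ℝ v := hs.orthogonalFamily_eigenspaces.orthonormal_sigma_orthonormal
    fun μ => (B μ).orthonormal
  have hbot : (Submodule.span ℝ (Set.range v))ᗮ = ⊥ := by
    rw [eq_bot_iff, ← ContinuousLinearMap.orthogonalComplement_iSup_eigenspaces_eq_bot hK hs,
      ← Submodule.iInf_orthogonal]
    intro x hx
    rw [Submodule.mem_iInf]
    intro μ w hw
    have h1 := (B μ).sum_repr ⟨w, hw⟩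
    have h2 : w = ∑ j, (B μ).repr ⟨w, hw⟩ j • v ⟨μ, j⟩ := by
      conv_lhs => rw [← Subtype.coe_mk w hw, ← h1]
      simp [v]
    rw [h2, sum_inner]
    refine Finset.sum_eq_zero fun j _ => ?_
    rw [inner_smul_left, hx _ (Submodule.subset_span ⟨_, rfl⟩), mul_zero]
  refine ⟨_, fun i => i.1, HilbertBasis.mkOfOrthogonalEqBot hv hbot, fun i => ?_⟩
  rw [HilbertBasis.coe_mkOfOrthogonalEqBot]
  exact Module.End.mem_eigenspace_iff.1 (B i.1 i.2).2

namespace HilbertPair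

section Frame

variable {H₀ H₁ : Type*} [NormedAddCommGroup H₀] [InnerProductSpace ℝ H₀] [CompleteSpace H₀]
  [NormedAddCommGroup H₁] [InnerProductSpace ℝ H₁] [CompleteSpace H₁] (P : HilbertPair H₀ H₁)

/-- A diagonalization of an invertible operator `𝔸 : H₁ → H₀`. -/
structure SpectralFrame (𝔸 : H₁ →L[ℝ] H₀) where
  /-- The index set of the eigenbasis. -/
  ι : Type
  /-- The eigenvalues. -/
  rate : ι → ℝ
  rate_ne_zero : ∀ i, rate i ≠ 0
  /-- The operator, as an isomorphism. -/
  equiv : H₁ ≃L[ℝ] H₀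
  coe_equiv : equiv.toContinuousLinearMap = 𝔸
  /-- The coordinates. -/
  coord : H₀ ≃L[ℝ] lp (fun _ : ι => ℝ) 2
  coord_equiv : ∀ x i, coord (equiv x) i = rate i * coord (P.incl x) i

/-- Carry H₀ over to the Hilbert space H whose inner product is the symmetrizing form. There the
inverse of 𝔸 followed by the inclusion becomes an operator K that is compact, symmetric and
injective. Its eigenbasis gives the coordinates, and the reciprocals of its eigenvalues are the
eigenvalues of 𝔸. -/
theorem IsSymmetrizable.nonempty_spectralFrame {𝔸 : H₁ →L[ℝ] H₀} (h : P.IsSymmetrizable 𝔸)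
    (hi : 𝔸.IsInvertible) : Nonempty (P.SpectralFrame 𝔸) := by
  obtain ⟨b, hb, ⟨c, hc, hbc⟩, hs⟩ := h
  obtain ⟨J, rfl⟩ := hi
  obtain ⟨H, _, _, _, U, hU⟩ := exists_equiv_of_equivalent_form b hb hc hbc
  let K : H →L[ℝ] H := U.toContinuousLinearMap ∘L P.incl ∘L J.symm.toContinuousLinearMap ∘L
    U.symm.toContinuousLinearMap
  have hK : IsCompactOperator K :=
    (P.compact_incl.comp_clm (J.symm.toContinuousLinearMap ∘L
      U.symm.toContinuousLinearMap)).clm_comp U.toContinuousLinearMap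
  have hKs : (K : H →ₗ[ℝ] H).IsSymmetric := by
    intro x y
    change ⟪U (P.incl (J.symm (U.symm x))), y⟫_ℝ = ⟪x, U (P.incl (J.symm (U.symm y)))⟫_ℝ
    conv_lhs => rw [← U.apply_symm_apply y]
    conv_rhs => rw [← U.apply_symm_apply x]
    rw [hU, hU]
    have := hs (J.symm (U.symm x)) (J.symm (U.symm y))
    simp only [ContinuousLinearEquiv.coe_coe, ContinuousLinearEquiv.apply_symm_apply] at this
    exact this.symm
  have hKi : Function.Injective K :=
    U.injective.comp (P.injective_incl.comp (J.symm.injective.comp U.symm.injective))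
  obtain ⟨ι, k, B, hB⟩ := exists_hilbertBasis_eigenvectors hK hKs hKi
  have hk : ∀ i, k i ≠ 0 := by
    intro i h0
    have h1 := hB i
    rw [h0, zero_smul] at h1
    have h2 : B i = 0 := hKi (by rw [h1, map_zero])
    simpa [h2] using B.orthonormal.1 i
  refine ⟨⟨ι, fun i => (k i)⁻¹, fun i => inv_ne_zero (hk i), J, rfl,
    U.trans B.repr.toContinuousLinearEquiv, fun x i => ?_⟩⟩
  change B.repr (U (J x)) i = (k i)⁻¹ * B.repr (U (P.incl x)) i
  have h1 : U (P.incl x) = K (U (J x)) := by simp [K]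
  have h2 : ⟪B i, K (U (J x))⟫_ℝ = k i * ⟪B i, U (J x)⟫_ℝ := by
    rw [show ⟪B i, K (U (J x))⟫_ℝ = ⟪K (B i), U (J x)⟫_ℝ from (hKs _ _).symm, hB, inner_smul_left]
    rfl
  rw [h1, B.repr_apply_apply, B.repr_apply_apply, h2, inv_mul_cancel_left₀ (hk i)]

end Frame

end HilbertPair

/-! ### Spectral projections on H₀, H₁ and H_{1/2}. -/

section Multiplier

variable {ι : Type*}

/-- The orthogonal projection of `ℓ²` which restricts sequences to a subset of the index set. -/
noncomputable def lpRestrict (S : Set ι) :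
    lp (fun _ : ι => ℝ) 2 →L[ℝ] lp (fun _ : ι => ℝ) 2 :=
  LinearMap.mkContinuous
    { toFun := fun f => ⟨S.indicator f, (lp.memℓp f).mono' fun i => norm_indicator_le_norm_self _ i⟩
      map_add' := fun f g => lp.ext <| by
        funext i
        exact congrFun (Set.indicator_add S f g) i
      map_smul' := fun c f => lp.ext <| by
        funext i
        exact congrFun (Set.indicator_const_smul S c f) i } 1 fun f => by
      rw [one_mul]
      exact lp.norm_mono two_ne_zero fun i => norm_indicator_le_norm_self _ i

theorem lpRestrict_apply (S : Set ι) (f : lp (fun _ : ι => ℝ) 2) (i : ι) :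
    lpRestrict S f i = S.indicator f i := rfl

theorem norm_lpRestrict_le (S : Set ι) : ‖lpRestrict S‖ ≤ 1 :=
  LinearMap.mkContinuous_norm_le _ zero_le_one _

end Multiplier

namespace HilbertPair

namespace SpectralFrame

variable {H₀ H₁ : Type*} [NormedAddCommGroup H₀] [InnerProductSpace ℝ H₀] [CompleteSpace H₀]
  [NormedAddCommGroup H₁] [InnerProductSpace ℝ H₁] [CompleteSpace H₁] {P : HilbertPair H₀ H₁}
  {𝔸 : H₁ →L[ℝ] H₀} (Φ : P.SpectralFrame 𝔸) {a b : ℝ}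

theorem equiv_apply (v : H₁) : Φ.equiv v = 𝔸 v := by
  conv_rhs => rw [← Φ.coe_equiv]
  rfl

/-- A coordinate functional. -/
noncomputable def comp (i : Φ.ι) : H₀ →L[ℝ] ℝ :=
  lp.evalCLM ℝ (fun _ : Φ.ι => ℝ) 2 i ∘L Φ.coord.toContinuousLinearMap

theorem comp_apply (i : Φ.ι) (x : H₀) : Φ.comp i x = Φ.coord x i := rfl

theorem comp_op (i : Φ.ι) (v : H₁) : Φ.comp i (𝔸 v) = Φ.rate i * Φ.comp i (P.incl v) := by
  rw [← Φ.equiv_apply]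
  exact Φ.coord_equiv v i

theorem ext_comp {x y : H₀} (h : ∀ i, Φ.comp i x = Φ.comp i y) : x = y :=
  Φ.coord.injective (lp.ext (funext h))

open Classical in
/-- The eigenvectors. -/
noncomputable def vec (i : Φ.ι) : H₁ :=
  Φ.rate i • Φ.equiv.symm (Φ.coord.symm (lp.single 2 i 1))

open Classical in
theorem op_vec_eq (i : Φ.ι) : 𝔸 (Φ.vec i) = Φ.rate i • Φ.coord.symm (lp.single 2 i 1) := by
  rw [vec, map_smul, ← Φ.equiv_apply, Φ.equiv.apply_symm_apply]

open Classical in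
theorem incl_vec_eq (i : Φ.ι) : P.incl (Φ.vec i) = Φ.coord.symm (lp.single 2 i 1) := by
  refine Φ.ext_comp fun j => mul_left_cancel₀ (Φ.rate_ne_zero j) ?_
  rw [← comp_op, op_vec_eq, map_smul, comp_apply, Φ.coord.apply_symm_apply, lp.single_apply]
  rcases eq_or_ne j i with rfl | h
  · rfl
  · simp [h]

theorem op_vec (i : Φ.ι) : 𝔸 (Φ.vec i) = Φ.rate i • P.incl (Φ.vec i) := by
  rw [op_vec_eq, incl_vec_eq]

theorem comp_incl_vec_self (i : Φ.ι) : Φ.comp i (P.incl (Φ.vec i)) = 1 := by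
  classical
  rw [incl_vec_eq, comp_apply, Φ.coord.apply_symm_apply, lp.single_apply_self]

theorem comp_incl_vec_ne {i j : Φ.ι} (h : j ≠ i) : Φ.comp j (P.incl (Φ.vec i)) = 0 := by
  classical
  rw [incl_vec_eq, comp_apply, Φ.coord.apply_symm_apply, lp.single_apply_ne _ _ _ h]

theorem hasSum_comp_smul (x : H₀) : HasSum (fun i => Φ.comp i x • P.incl (Φ.vec i)) x := by
  classical
  have h := (lp.hasSum_single (by norm_num) (Φ.coord x)).mapL Φ.coord.symm.toContinuousLinearMap
  rw [ContinuousLinearEquiv.coe_coe, Φ.coord.symm_apply_apply] at h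
  convert h using 2 with i
  rw [incl_vec_eq, ← map_smul, ← lp.single_smul, smul_eq_mul, mul_one]
  rfl

theorem top_of_incl_vec_mem {C : Submodule ℝ H₀} (hC : IsClosed (C : Set H₀))
    (h : ∀ i, P.incl (Φ.vec i) ∈ C) : C = ⊤ := by
  rw [eq_top_iff]
  rintro x -
  exact hC.mem_of_tendsto (Φ.hasSum_comp_smul x)
    (Filter.Eventually.of_forall fun F => C.sum_mem fun i _ => C.smul_mem _ (h i))

/-- The isomorphism 𝔸 multiplies eigenvectors by nonzero scalars, so totality of the eigenvectors
carries over from H₀ to H₁. -/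
theorem top_of_vec_mem {C : Submodule ℝ H₁} (hC : IsClosed (C : Set H₁))
    (h : ∀ i, Φ.vec i ∈ C) : C = ⊤ := by
  have h1 : C.comap (Φ.equiv.symm.toContinuousLinearMap : H₀ →ₗ[ℝ] H₁) = ⊤ := by
    refine Φ.top_of_incl_vec_mem (hC.preimage Φ.equiv.symm.continuous) fun i => ?_
    change Φ.equiv.symm (P.incl (Φ.vec i)) ∈ C
    have : P.incl (Φ.vec i) = Φ.equiv ((Φ.rate i)⁻¹ • Φ.vec i) := by
      rw [map_smul, equiv_apply, op_vec, inv_smul_smul₀ (Φ.rate_ne_zero i)]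
    rw [this, Φ.equiv.symm_apply_apply]
    exact C.smul_mem _ (h i)
  rw [eq_top_iff]
  rintro v -
  have : Φ.equiv v ∈ C.comap (Φ.equiv.symm.toContinuousLinearMap : H₀ →ₗ[ℝ] H₁) := by
    rw [h1]; trivial
  simpa using this

theorem top_of_halfIncl_vec_mem {C : Submodule ℝ P.Half} (hC : IsClosed (C : Set P.Half))
    (h : ∀ i, P.halfIncl (Φ.vec i) ∈ C) : C = ⊤ := by
  have h1 : C.comap (P.halfIncl : H₁ →ₗ[ℝ] P.Half) = ⊤ :=
    Φ.top_of_vec_mem (hC.preimage P.halfIncl.continuous) h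
  refine P.half_eq_top_of_halfIncl_mem hC fun v => ?_
  have : v ∈ C.comap (P.halfIncl : H₁ →ₗ[ℝ] P.Half) := by rw [h1]; trivial
  exact this

/-- The spectral projection of `H₀` to a set of eigenvectors. -/
noncomputable def diag (S : Set Φ.ι) : H₀ →L[ℝ] H₀ :=
  Φ.coord.symm.toContinuousLinearMap ∘L lpRestrict S ∘L Φ.coord.toContinuousLinearMap

theorem comp_diag (S : Set Φ.ι) (i : Φ.ι) (x : H₀) :
    Φ.comp i (Φ.diag S x) = S.indicator (fun i => Φ.comp i x) i := by
  change Φ.coord (Φ.coord.symm _) i = _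
  rw [Φ.coord.apply_symm_apply]
  rfl

theorem comp_diag_of_mem {S : Set Φ.ι} {i : Φ.ι} (h : i ∈ S) (x : H₀) :
    Φ.comp i (Φ.diag S x) = Φ.comp i x := by
  rw [comp_diag, indicator_of_mem h]

theorem comp_diag_of_notMem {S : Set Φ.ι} {i : Φ.ι} (h : i ∉ S) (x : H₀) :
    Φ.comp i (Φ.diag S x) = 0 := by
  rw [comp_diag, indicator_of_notMem h]

theorem norm_diag_le (S : Set Φ.ι) : ‖Φ.diag S‖ ≤
    ‖Φ.coord.symm.toContinuousLinearMap‖ * ‖Φ.coord.toContinuousLinearMap‖ := by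
  refine (ContinuousLinearMap.opNorm_comp_le _ _).trans (mul_le_mul_of_nonneg_left ?_ (norm_nonneg _))
  refine (ContinuousLinearMap.opNorm_comp_le _ _).trans ?_
  exact mul_le_of_le_one_left (norm_nonneg _) (norm_lpRestrict_le S)

/-- The spectral projection of `H₁` to a set of eigenvectors. -/
noncomputable def diagOne (S : Set Φ.ι) : H₁ →L[ℝ] H₁ :=
  Φ.equiv.symm.toContinuousLinearMap ∘L Φ.diag S ∘L Φ.equiv.toContinuousLinearMap

theorem op_diagOne (S : Set Φ.ι) (v : H₁) : 𝔸 (Φ.diagOne S v) = Φ.diag S (𝔸 v) := by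
  rw [← Φ.equiv_apply, ← Φ.equiv_apply]
  exact Φ.equiv.apply_symm_apply _

/-- The projection on H₁ is the conjugate by 𝔸 of the one on H₀, which makes it bounded. It is also
the restriction of the latter, because 𝔸 is diagonal with nonzero eigenvalues. -/
theorem incl_diagOne (S : Set Φ.ι) (v : H₁) :
    P.incl (Φ.diagOne S v) = Φ.diag S (P.incl v) := by
  refine Φ.ext_comp fun i => mul_left_cancel₀ (Φ.rate_ne_zero i) ?_
  rw [← comp_op, op_diagOne]
  by_cases h : i ∈ S
  · rw [comp_diag_of_mem _ h, comp_diag_of_mem _ h, comp_op]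
  · rw [comp_diag_of_notMem _ h, comp_diag_of_notMem _ h, mul_zero]

theorem diag_tendsto (x : H₀) :
    Filter.Tendsto (fun F : Finset Φ.ι => Φ.diag F x) Filter.atTop (nhds x) := by
  classical
  have h := Φ.hasSum_comp_smul x
  refine h.congr fun F => ?_
  refine Φ.ext_comp fun i => ?_
  rw [map_sum]
  simp only [map_smul, smul_eq_mul]
  by_cases hi : i ∈ F
  · rw [comp_diag_of_mem _ (by exact hi), Finset.sum_eq_single i
      (fun j _ hj => by rw [comp_incl_vec_ne _ hj.symm, mul_zero]) (fun h => absurd hi h),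
      comp_incl_vec_self, mul_one]
  · rw [comp_diag_of_notMem _ (by exact hi)]
    exact Finset.sum_eq_zero fun j hj => by
      rw [comp_incl_vec_ne _ (by rintro rfl; exact hi hj), mul_zero]

/-- The spectral projection of `H_{1/2}` to a set of eigenvectors. -/
noncomputable def diagHalf (S : Set Φ.ι) : P.Half →L[ℝ] P.Half :=
  P.eval one_pos ⟨0, left_mem_Icc.2 zero_le_one⟩ ∘L
    P.mapPath one_pos (Φ.diag S) (Φ.diagOne S) (Φ.incl_diagOne S) ∘L P.halfExt one_pos

/-- `diagHalf` extends a vector to a path, applies the projections of H₀ and H₁ pointwise, and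
evaluates again; boundedness on H_{1/2} is thus inherited from both spaces. Evaluation commutes with
pointwise application, so the result restricts `diag`. -/
theorem halfVal_diagHalf (S : Set Φ.ι) (x : P.Half) :
    P.halfVal (Φ.diagHalf S x) = Φ.diag S (P.halfVal x) := by
  rw [diagHalf, ContinuousLinearMap.comp_apply, halfVal_eval, ContinuousLinearMap.comp_apply,
    P.rep_mapPath one_pos _ _ (left_mem_Icc.2 zero_le_one), ← P.halfVal_eval one_pos ⟨0, left_mem_Icc.2 zero_le_one⟩,
    P.eval_halfExt one_pos]

theorem half_ext_comp {x y : P.Half}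
    (h : ∀ i, Φ.comp i (P.halfVal x) = Φ.comp i (P.halfVal y)) : x = y :=
  P.halfVal_injective (Φ.ext_comp h)

theorem diagHalf_halfIncl_vec_of_mem {S : Set Φ.ι} {i : Φ.ι} (h : i ∈ S) :
    Φ.diagHalf S (P.halfIncl (Φ.vec i)) = P.halfIncl (Φ.vec i) := by
  refine Φ.half_ext_comp fun j => ?_
  rw [halfVal_diagHalf, halfVal_halfIncl]
  by_cases hj : j ∈ S
  · rw [comp_diag_of_mem _ hj]
  · rw [comp_diag_of_notMem _ hj, comp_incl_vec_ne]
    rintro rfl; exact hj h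

theorem diagHalf_halfIncl_vec_of_notMem {S : Set Φ.ι} {i : Φ.ι} (h : i ∉ S) :
    Φ.diagHalf S (P.halfIncl (Φ.vec i)) = 0 := by
  refine Φ.half_ext_comp fun j => ?_
  rw [halfVal_diagHalf, halfVal_halfIncl, map_zero, map_zero]
  by_cases hj : j ∈ S
  · rw [comp_diag_of_mem _ hj, comp_incl_vec_ne]
    rintro rfl; exact h hj
  · rw [comp_diag_of_notMem _ hj]

/-- The closed span of a set of eigenvectors, cut out by the vanishing of the other coordinates. -/
theorem mem_closure_span_iff (S : Set ℝ) (x : P.Half) :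
    x ∈ (Submodule.span ℝ {x : P.Half | ∃ α, α ∈ S ∧ ∃ v : H₁, 𝔸 v = α • P.incl v ∧
      Half.val P x = P.incl v}).topologicalClosure ↔ Φ.diagHalf {i | Φ.rate i ∈ S} x = x := by
  set D := Φ.diagHalf {i | Φ.rate i ∈ S} with hD
  constructor
  · intro hx
    -- The fixed space of the projection is closed. It contains each generator, since an eigenvector
    -- for α has vanishing coordinates at all indices whose rate is not α.
    let C : Submodule ℝ P.Half := (D - ContinuousLinearMap.id ℝ P.Half).ker
    have hC : IsClosed (C : Set P.Half) := (D - ContinuousLinearMap.id ℝ P.Half).isClosed_ker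
    have : x ∈ C := by
      refine Submodule.topologicalClosure_minimal _ (Submodule.span_le.2 ?_) hC hx
      rintro y ⟨α, hα, v, hv, hy⟩
      rw [SetLike.mem_coe, LinearMap.mem_ker, ContinuousLinearMap.coe_coe,
        sub_apply, ContinuousLinearMap.id_apply, sub_eq_zero]
      refine Φ.half_ext_comp fun i => ?_
      rw [hD, halfVal_diagHalf, halfVal_apply, hy]
      by_cases hi : i ∈ {i | Φ.rate i ∈ S}
      · rw [comp_diag_of_mem _ hi]
      · rw [comp_diag_of_notMem _ hi]
        have h1 := Φ.comp_op i v
        rw [hv, map_smul, smul_eq_mul] at h1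
        have h2 : α ≠ Φ.rate i := by rintro rfl; exact hi hα
        have h3 : (α - Φ.rate i) * Φ.comp i (P.incl v) = 0 := by linarith
        exact ((mul_eq_zero.1 h3).resolve_left (sub_ne_zero.2 h2)).symm
    rwa [LinearMap.mem_ker, ContinuousLinearMap.coe_coe,
      sub_apply, ContinuousLinearMap.id_apply, sub_eq_zero] at this
  · intro hx
    set V := (Submodule.span ℝ {x : P.Half | ∃ α, α ∈ S ∧ ∃ v : H₁, 𝔸 v = α • P.incl v ∧
      Half.val P x = P.incl v}).topologicalClosure with hV
    -- The preimage is closed and contains every basis eigenvector: those with eigenvalue in `S` are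
    -- fixed by the projection and the others are annihilated.
    have h1 : V.comap (D : P.Half →ₗ[ℝ] P.Half) = ⊤ := by
      refine Φ.top_of_halfIncl_vec_mem
        ((Submodule.isClosed_topologicalClosure _).preimage D.continuous) fun i => ?_
      rw [Submodule.mem_comap, ContinuousLinearMap.coe_coe]
      by_cases hi : i ∈ {i | Φ.rate i ∈ S}
      · rw [hD, Φ.diagHalf_halfIncl_vec_of_mem hi]
        refine Submodule.le_topologicalClosure _ (Submodule.subset_span ?_)
        refine ⟨Φ.rate i, hi, Φ.vec i, Φ.op_vec i, ?_⟩
        rw [← halfVal_apply, halfVal_halfIncl]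
      · rw [hD, Φ.diagHalf_halfIncl_vec_of_notMem hi]
        exact V.zero_mem
    have : x ∈ V.comap (D : P.Half →ₗ[ℝ] P.Half) := by rw [h1]; trivial
    rw [Submodule.mem_comap, ContinuousLinearMap.coe_coe, hx] at this
    exact this

theorem mem_halfPos_iff (x : P.Half) :
    x ∈ P.halfPos 𝔸 ↔ Φ.diagHalf {i | 0 < Φ.rate i} x = x :=
  Φ.mem_closure_span_iff (Ioi 0) x

theorem mem_halfNeg_iff (x : P.Half) :
    x ∈ P.halfNeg 𝔸 ↔ Φ.diagHalf {i | Φ.rate i < 0} x = x :=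
  Φ.mem_closure_span_iff (Iio 0) x

theorem diagHalf_idem (S : Set Φ.ι) (x : P.Half) :
    Φ.diagHalf S (Φ.diagHalf S x) = Φ.diagHalf S x := by
  refine Φ.half_ext_comp fun i => ?_
  rw [halfVal_diagHalf, halfVal_diagHalf]
  by_cases h : i ∈ S
  · rw [comp_diag_of_mem _ h]
  · rw [comp_diag_of_notMem _ h, comp_diag_of_notMem _ h]

theorem diagHalf_add_diagHalf (x : P.Half) :
    Φ.diagHalf {i | 0 < Φ.rate i} x + Φ.diagHalf {i | Φ.rate i < 0} x = x := by
  refine Φ.half_ext_comp fun i => ?_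
  rw [map_add, map_add, halfVal_diagHalf, halfVal_diagHalf]
  rcases lt_or_gt_of_ne (Φ.rate_ne_zero i) with h | h
  · rw [comp_diag_of_notMem _ (show i ∉ {i | 0 < Φ.rate i} from h.le.not_gt),
      comp_diag_of_mem _ (show i ∈ {i | Φ.rate i < 0} from h), zero_add]
  · rw [comp_diag_of_notMem _ (show i ∉ {i | Φ.rate i < 0} from h.le.not_gt),
      comp_diag_of_mem _ (show i ∈ {i | 0 < Φ.rate i} from h), add_zero]

theorem range_diagHalf_pos :
    (Φ.diagHalf {i | 0 < Φ.rate i}).range = P.halfPos 𝔸 := by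
  ext x
  rw [Φ.mem_halfPos_iff, LinearMap.mem_range]
  simp only [ContinuousLinearMap.coe_coe]
  constructor
  · rintro ⟨y, hy⟩
    rw [← hy, Φ.diagHalf_idem]
  · exact fun h => ⟨x, h⟩

theorem diagHalf_pos_eq_zero_iff (x : P.Half) :
    Φ.diagHalf {i | 0 < Φ.rate i} x = 0 ↔ Φ.diagHalf {i | Φ.rate i < 0} x = x := by
  have := Φ.diagHalf_add_diagHalf x
  constructor
  · intro h
    rwa [h, zero_add] at this
  · intro h
    rw [h] at this
    exact left_eq_add.1 (by rw [add_comm]; exact this.symm)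

theorem ker_diagHalf_pos :
    (Φ.diagHalf {i | 0 < Φ.rate i}).ker = P.halfNeg 𝔸 := by
  ext x
  rw [Φ.mem_halfNeg_iff, ← Φ.diagHalf_pos_eq_zero_iff, LinearMap.mem_ker]
  rfl

/-- The two subspaces are the range and the kernel of a bounded idempotent. Consequently `projPos`
and `projNeg` are the true projections and not their default values. -/
theorem isTopCompl (Φ : P.SpectralFrame 𝔸) : (P.halfPos 𝔸).IsTopCompl (P.halfNeg 𝔸) := by
  have h : IsIdempotentElem (Φ.diagHalf {i | 0 < Φ.rate i}) := by
    rw [IsIdempotentElem, ContinuousLinearMap.mul_def]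
    ext1 x
    rw [ContinuousLinearMap.comp_apply, Φ.diagHalf_idem]
  have := ContinuousLinearMap.IsIdempotentElem.isTopCompl h
  rwa [Φ.range_diagHalf_pos, Φ.ker_diagHalf_pos] at this

theorem coe_projPos (x : P.Half) :
    (P.projPos 𝔸 x : P.Half) = Φ.diagHalf {i | 0 < Φ.rate i} x := by
  have hx := Φ.diagHalf_add_diagHalf x
  have h1 : Φ.diagHalf {i | 0 < Φ.rate i} x ∈ P.halfPos 𝔸 :=
    (Φ.mem_halfPos_iff _).2 (Φ.diagHalf_idem _ _)
  have h2 : Φ.diagHalf {i | Φ.rate i < 0} x ∈ P.halfNeg 𝔸 :=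
    (Φ.mem_halfNeg_iff _).2 (Φ.diagHalf_idem _ _)
  rw [projPos, dif_pos Φ.isTopCompl]
  conv_lhs => rw [← hx]
  rw [map_add, Submodule.projectionOntoL_apply_left Φ.isTopCompl ⟨_, h1⟩,
    Submodule.projectionOntoL_apply_right Φ.isTopCompl ⟨_, h2⟩, add_zero]

theorem coe_projNeg (x : P.Half) :
    (P.projNeg 𝔸 x : P.Half) = Φ.diagHalf {i | Φ.rate i < 0} x := by
  have hx := Φ.diagHalf_add_diagHalf x
  have h1 : Φ.diagHalf {i | 0 < Φ.rate i} x ∈ P.halfPos 𝔸 :=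
    (Φ.mem_halfPos_iff _).2 (Φ.diagHalf_idem _ _)
  have h2 : Φ.diagHalf {i | Φ.rate i < 0} x ∈ P.halfNeg 𝔸 :=
    (Φ.mem_halfNeg_iff _).2 (Φ.diagHalf_idem _ _)
  rw [projNeg, dif_pos Φ.isTopCompl.symm]
  conv_lhs => rw [← hx]
  rw [map_add, Submodule.projectionOntoL_apply_right Φ.isTopCompl.symm ⟨_, h1⟩,
    Submodule.projectionOntoL_apply_left Φ.isTopCompl.symm ⟨_, h2⟩, zero_add]

theorem projPos_add_projNeg (Φ : P.SpectralFrame 𝔸) (x : P.Half) :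
    (P.projPos 𝔸 x : P.Half) + (P.projNeg 𝔸 x : P.Half) = x := by
  rw [Φ.coe_projPos, Φ.coe_projNeg, Φ.diagHalf_add_diagHalf]

theorem projPos_coe (Φ : P.SpectralFrame 𝔸) (x : P.halfPos 𝔸) : P.projPos 𝔸 (x : P.Half) = x :=
  Subtype.ext (by rw [Φ.coe_projPos]; exact (Φ.mem_halfPos_iff _).1 x.2)

theorem projNeg_coe (Φ : P.SpectralFrame 𝔸) (x : P.halfNeg 𝔸) : P.projNeg 𝔸 (x : P.Half) = x :=
  Subtype.ext (by rw [Φ.coe_projNeg]; exact (Φ.mem_halfNeg_iff _).1 x.2)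

theorem projNeg_coe_halfPos (Φ : P.SpectralFrame 𝔸) (x : P.halfPos 𝔸) : P.projNeg 𝔸 (x : P.Half) = 0 := by
  have := Φ.projPos_add_projNeg (x : P.Half)
  rw [Φ.projPos_coe] at this
  exact Subtype.ext (add_eq_left.1 this)

theorem projPos_coe_halfNeg (Φ : P.SpectralFrame 𝔸) (x : P.halfNeg 𝔸) : P.projPos 𝔸 (x : P.Half) = 0 := by
  have := Φ.projPos_add_projNeg (x : P.Half)
  rw [Φ.projNeg_coe] at this
  exact Subtype.ext (add_eq_right.1 this)

theorem projPos_eq_zero_iff (x : P.Half) :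
    P.projPos 𝔸 x = 0 ↔ ∀ i, 0 < Φ.rate i → Φ.comp i (P.halfVal x) = 0 := by
  rw [← Submodule.coe_eq_zero, coe_projPos]
  constructor
  · intro h i hi
    rw [← Φ.comp_diag_of_mem (S := {i | 0 < Φ.rate i}) hi, ← halfVal_diagHalf, h, map_zero, map_zero]
  · intro h
    refine Φ.half_ext_comp fun i => ?_
    rw [halfVal_diagHalf, map_zero, map_zero]
    by_cases hi : i ∈ {i | 0 < Φ.rate i}
    · rw [comp_diag_of_mem _ hi, h i hi]
    · rw [comp_diag_of_notMem _ hi]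

theorem projNeg_eq_zero_iff (x : P.Half) :
    P.projNeg 𝔸 x = 0 ↔ ∀ i, Φ.rate i < 0 → Φ.comp i (P.halfVal x) = 0 := by
  rw [← Submodule.coe_eq_zero, coe_projNeg]
  constructor
  · intro h i hi
    rw [← Φ.comp_diag_of_mem (S := {i | Φ.rate i < 0}) hi, ← halfVal_diagHalf, h, map_zero, map_zero]
  · intro h
    refine Φ.half_ext_comp fun i => ?_
    rw [halfVal_diagHalf, map_zero, map_zero]
    by_cases hi : i ∈ {i | Φ.rate i < 0}
    · rw [comp_diag_of_mem _ hi, h i hi]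
    · rw [comp_diag_of_notMem _ hi]

theorem comp_projPos {i : Φ.ι} (hi : 0 < Φ.rate i) (x : P.Half) :
    Φ.comp i (P.halfVal (P.projPos 𝔸 x)) = Φ.comp i (P.halfVal x) := by
  rw [coe_projPos, halfVal_diagHalf, comp_diag_of_mem _ (show i ∈ {i | 0 < Φ.rate i} from hi)]

theorem comp_projNeg {i : Φ.ι} (hi : Φ.rate i < 0) (x : P.Half) :
    Φ.comp i (P.halfVal (P.projNeg 𝔸 x)) = Φ.comp i (P.halfVal x) := by
  rw [coe_projNeg, halfVal_diagHalf, comp_diag_of_mem _ (show i ∈ {i | Φ.rate i < 0} from hi)]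

end SpectralFrame

end HilbertPair

/-! ### The constant path: an isomorphism for its own spectral boundary conditions. -/

namespace HilbertPair

section Pair

variable {H₀ H₁ : Type*} [NormedAddCommGroup H₀] [InnerProductSpace ℝ H₀] [CompleteSpace H₀]
  [NormedAddCommGroup H₁] [InnerProductSpace ℝ H₁] [CompleteSpace H₁] (P : HilbertPair H₀ H₁)
  {a b : ℝ}

instance (𝔸 : H₁ →L[ℝ] H₀) : CompleteSpace (P.halfPos 𝔸) :=
  (Submodule.isClosed_topologicalClosure _).completeSpace_coe

instance (𝔸 : H₁ →L[ℝ] H₀) : CompleteSpace (P.halfNeg 𝔸) :=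
  (Submodule.isClosed_topologicalClosure _).completeSpace_coe

/-- The left end point of an interval. -/
def leftEnd (hab : a < b) : Icc a b := ⟨a, left_mem_Icc.2 hab.le⟩

/-- The right end point of an interval. -/
def rightEnd (hab : a < b) : Icc a b := ⟨b, right_mem_Icc.2 hab.le⟩

/-- The operator `∂ₛ + A` with the spectral boundary conditions of two operators `𝔸` and `𝔹`. -/
noncomputable def bdryOp (hab : a < b) (A : C(Icc a b, H₁ →L[ℝ] H₀)) (𝔸 𝔹 : H₁ →L[ℝ] H₀) :
    P.pathSpace a b →L[ℝ] PathL2 a b H₀ × P.halfPos 𝔸 × P.halfNeg 𝔹 :=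
  (P.opD hab A).prod ((P.projPos 𝔸 ∘L P.eval hab (leftEnd hab)).prod
    (P.projNeg 𝔹 ∘L P.eval hab (rightEnd hab)))

theorem bdryOp_apply (hab : a < b) (A : C(Icc a b, H₁ →L[ℝ] H₀)) (𝔸 𝔹 : H₁ →L[ℝ] H₀)
    (x : P.pathSpace a b) : P.bdryOp hab A 𝔸 𝔹 x = (P.opD hab A x,
      P.projPos 𝔸 (P.eval hab (leftEnd hab) x), P.projNeg 𝔹 (P.eval hab (rightEnd hab) x)) := rfl

theorem opD_const_apply (hab : a < b) (𝔸 : H₁ →L[ℝ] H₀) (x : P.pathSpace a b) :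
    P.opD hab (.const _ 𝔸) x = P.pathDeriv a b x + constOp hab 𝔸 (P.path a b x) := rfl

/-- The scalar function l(x(s)) is absolutely continuous, and the left hand side is the integral of
the derivative of its square. This is the source of the boundary terms in the energy identity. -/
theorem two_mul_inner_constOp (hab : a < b) (l : H₀ →L[ℝ] ℝ) (x : P.pathSpace a b) :
    2 * ⟪constOp hab l (P.pathDeriv a b x), constOp hab l (P.pathIncl hab x)⟫_ℝ =
      l (P.rep hab x b) ^ 2 - l (P.rep hab x a) ^ 2 := by
  set v := P.pathDeriv a b x with hv
  have hvI : IntegrableOn v (Icc a b) := integrableOn_pathL2 v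
  have hvi : IntervalIntegrable v volume a b :=
    (intervalIntegrable_iff_integrableOn_Icc_of_le hab.le).2 hvI
  have hg : IntervalIntegrable (fun r => l (v r)) volume a b :=
    (intervalIntegrable_iff_integrableOn_Icc_of_le hab.le).2 (l.integrable_comp hvI)
  set G : ℝ → ℝ := fun s => ∫ r in a..s, l (v r) with hG
  have hGac : AbsolutelyContinuousOnInterval G a b :=
    hg.absolutelyContinuousOnInterval_intervalIntegral (c := a) (by simp)
  have hrep : ∀ s ∈ Icc a b, l (P.rep hab x s) = l (P.rep hab x a) + G s := by
    intro s hs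
    rw [P.rep_eq_rep_add hab x (left_mem_Icc.2 hab.le) hs, map_add, ← l.intervalIntegral_comp_comm]
    exact hvi.mono_set (by rw [uIcc_of_le hab.le, uIcc_of_le hs.1]; exact Icc_subset_Icc_right hs.2)
  have key := hGac.integral_deriv_mul_eq_sub hGac
  have e1 : ∫ s in a..b, deriv G s * G s + G s * deriv G s = ∫ s in a..b, 2 * (l (v s) * G s) := by
    apply intervalIntegral.integral_congr_ae
    filter_upwards [hg.ae_hasDerivAt_integral] with s hs hs2
    rw [hG, (hs (uIoc_subset_uIcc hs2) a (by simp)).deriv]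
    ring
  have hGa : G a = 0 := by simp [hG]
  rw [e1, intervalIntegral.integral_const_mul, hGa] at key
  have e2 : ⟪constOp hab l v, constOp hab l (P.pathIncl hab x)⟫_ℝ =
      ∫ s in a..b, (l (P.rep hab x a) * l (v s) + l (v s) * G s) := by
    rw [L2.inner_def, intervalIntegral.integral_of_le hab.le, ← integral_Icc_eq_integral_Ioc]
    refine integral_congr_ae ?_
    filter_upwards [constOp_ae_eq hab l v, constOp_ae_eq hab l (P.pathIncl hab x),
      P.pathIncl_ae_eq_rep hab x, ae_mem_Icc a b] with s h1 h2 h3 h4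
    rw [h1, h2, h3, hrep s h4]
    simp only [RCLike.inner_apply, conj_trivial]
    ring
  have hGc : IntervalIntegrable (fun s => l (v s) * G s) volume a b :=
    hg.mul_continuousOn hGac.continuousOn
  rw [e2, intervalIntegral.integral_add (hg.const_mul _) hGc, intervalIntegral.integral_const_mul,
    hrep b (right_mem_Icc.2 hab.le)]
  have e3 : ∫ s in a..b, l (v s) = G b := rfl
  rw [e3]
  linear_combination key

theorem memLp_of_continuous {E : Type*} [NormedAddCommGroup E] {f : ℝ → E} (hf : Continuous f) :
    MemLp f 2 (volume.restrict (Icc a b)) := by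
  obtain ⟨C, hC⟩ := isCompact_Icc.exists_bound_of_continuousOn (s := Icc a b) hf.continuousOn
  refine MemLp.of_bound hf.aestronglyMeasurable C ?_
  filter_upwards [ae_mem_Icc a b] with s hs
  exact hC s hs

/-- A path in `P₁([a, b])` with values in the span of a single vector. -/
theorem exists_pathSpace_primitive (hab : a < b) {g : ℝ → ℝ} (hg : Continuous g) (w : H₁) :
    ∃ x : P.pathSpace a b,
      (∀ᵐ s ∂volume.restrict (Icc a b), P.path a b x s = (∫ r in a..s, g r) • w) ∧
      ∀ᵐ s ∂volume.restrict (Icc a b), P.pathDeriv a b x s = g s • P.incl w := by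
  have hG : Continuous fun s => ∫ r in a..s, g r :=
    intervalIntegral.continuous_primitive (fun _ _ => hg.intervalIntegrable _ _) a
  have h1 : MemLp (fun s => (∫ r in a..s, g r) • w) 2 (volume.restrict (Icc a b)) :=
    memLp_of_continuous (hG.smul continuous_const)
  have h2 : MemLp (fun s => g s • P.incl w) 2 (volume.restrict (Icc a b)) :=
    memLp_of_continuous (hg.smul continuous_const)
  have hw : IsWeakDeriv a b (fun s => P.incl ((h1.toLp : PathL2 a b H₁) s))
      (h2.toLp : PathL2 a b H₀) := by
    refine (IsWeakDeriv.of_primitive hab (u := fun s => (∫ r in a..s, g r) • P.incl w)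
      (v := fun s => g s • P.incl w) (c := 0) ?_ ?_).congr_ae ?_ h2.coeFn_toLp
    · exact (hg.smul continuous_const).continuousOn.integrableOn_compact isCompact_Icc
    · refine Filter.Eventually.of_forall fun s => ?_
      rw [zero_add, intervalIntegral.integral_smul_const]
    · filter_upwards [h1.coeFn_toLp] with s hs
      rw [hs, map_smul]
  exact ⟨⟨(WithLp.equiv 2 _).symm (h1.toLp, h2.toLp), hw⟩, h1.coeFn_toLp, h2.coeFn_toLp⟩

end Pair

namespace SpectralFrame

variable {H₀ H₁ : Type*} [NormedAddCommGroup H₀] [InnerProductSpace ℝ H₀] [CompleteSpace H₀]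
  [NormedAddCommGroup H₁] [InnerProductSpace ℝ H₁] [CompleteSpace H₁] {P : HilbertPair H₀ H₁}
  {𝔸 : H₁ →L[ℝ] H₀} (Φ : P.SpectralFrame 𝔸) {a b : ℝ}

theorem sum_comp_sq_le (F : Finset Φ.ι) (x : H₀) :
    ∑ i ∈ F, Φ.comp i x ^ 2 ≤ ‖Φ.coord.toContinuousLinearMap‖ ^ 2 * ‖x‖ ^ 2 := by
  have h1 := lp.sum_rpow_le_norm_rpow (p := 2) (by norm_num) (Φ.coord x) F
  simp only [ENNReal.toReal_ofNat, Real.rpow_ofNat, Real.norm_eq_abs, sq_abs] at h1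
  refine h1.trans ?_
  rw [← mul_pow]
  exact pow_le_pow_left₀ (norm_nonneg _) (Φ.coord.toContinuousLinearMap.le_opNorm x) 2

theorem norm_diag_sq_le (F : Finset Φ.ι) (x : H₀) : ‖Φ.diag F x‖ ^ 2 ≤
    ‖Φ.coord.symm.toContinuousLinearMap‖ ^ 2 * ∑ i ∈ F, Φ.comp i x ^ 2 := by
  have h1 : ‖lpRestrict (F : Set Φ.ι) (Φ.coord x)‖ ^ 2 ≤ ∑ i ∈ F, Φ.comp i x ^ 2 := by
    have h2 := lp.norm_rpow_eq_tsum (p := 2) (by norm_num) (lpRestrict (F : Set Φ.ι) (Φ.coord x))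
    simp only [ENNReal.toReal_ofNat, Real.rpow_ofNat, Real.norm_eq_abs, sq_abs] at h2
    rw [h2, tsum_eq_sum (s := F)]
    · refine Finset.sum_le_sum fun i hi => ?_
      rw [lpRestrict_apply, indicator_of_mem (by exact hi), comp_apply]
    · intro i hi
      rw [lpRestrict_apply, indicator_of_notMem (by exact hi)]
      simp
  refine le_trans ?_ (mul_le_mul_of_nonneg_left h1 (by positivity))
  rw [← mul_pow]
  exact pow_le_pow_left₀ (norm_nonneg _) (Φ.coord.symm.toContinuousLinearMap.le_opNorm _) 2

theorem integrableOn_comp_sq (hab : a < b) (i : Φ.ι) (η : PathL2 a b H₀) :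
    IntegrableOn (fun s => Φ.comp i (η s) ^ 2) (Icc a b) := by
  refine (integrableOn_norm_sq_pathL2 (constOp hab (Φ.comp i) η)).congr ?_
  filter_upwards [constOp_ae_eq hab (Φ.comp i) η] with s hs
  rw [hs, Real.norm_eq_abs, sq_abs]

theorem norm_constOp_comp_sq (hab : a < b) (i : Φ.ι) (η : PathL2 a b H₀) :
    ‖constOp hab (Φ.comp i) η‖ ^ 2 = ∫ s in Icc a b, Φ.comp i (η s) ^ 2 := by
  rw [norm_sq_pathL2]
  refine integral_congr_ae ?_
  filter_upwards [constOp_ae_eq hab (Φ.comp i) η] with s hs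
  rw [hs, Real.norm_eq_abs, sq_abs]

theorem sum_norm_constOp_comp_sq_le (hab : a < b) (F : Finset Φ.ι) (η : PathL2 a b H₀) :
    ∑ i ∈ F, ‖constOp hab (Φ.comp i) η‖ ^ 2 ≤
      ‖Φ.coord.toContinuousLinearMap‖ ^ 2 * ‖η‖ ^ 2 := by
  simp only [Φ.norm_constOp_comp_sq]
  rw [← integral_finsetSum F fun i _ => Φ.integrableOn_comp_sq hab i η, norm_sq_pathL2,
    ← integral_const_mul]
  exact integral_mono (integrable_finsetSum F fun i _ => Φ.integrableOn_comp_sq hab i η)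
    ((integrableOn_norm_sq_pathL2 η).const_mul _) fun s => Φ.sum_comp_sq_le F (η s)

/-- The projections to finitely many coordinates are uniformly bounded and converge strongly to the
identity, also on L². So a bound for all finite sets of coordinates passes to the limit. -/
theorem norm_sq_le_of_forall_sum_le (hab : a < b) {η : PathL2 a b H₀} {C : ℝ}
    (h : ∀ F : Finset Φ.ι, ∑ i ∈ F, ‖constOp hab (Φ.comp i) η‖ ^ 2 ≤ C) :
    ‖η‖ ^ 2 ≤ ‖Φ.coord.symm.toContinuousLinearMap‖ ^ 2 * C := by
  have h1 := tendsto_constOp hab (l := Filter.atTop) (fun F : Finset Φ.ι => Φ.norm_diag_le F)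
    Φ.diag_tendsto η
  refine le_of_tendsto (h1.norm.pow 2) (Filter.Eventually.of_forall fun F => ?_)
  refine le_trans ?_ (mul_le_mul_of_nonneg_left (h F) (by positivity))
  simp only [Φ.norm_constOp_comp_sq]
  rw [← integral_finsetSum F fun i _ => Φ.integrableOn_comp_sq hab i η, norm_sq_pathL2,
    ← integral_const_mul]
  refine integral_mono_ae (integrableOn_norm_sq_pathL2 _)
    ((integrable_finsetSum F fun i _ => Φ.integrableOn_comp_sq hab i η).const_mul _) ?_
  filter_upwards [constOp_ae_eq hab (Φ.diag F) η] with s hs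
  rw [hs]
  exact Φ.norm_diag_sq_le F (η s)

theorem constOp_comp_op (hab : a < b) (i : Φ.ι) (x : P.pathSpace a b) :
    constOp hab (Φ.comp i) (constOp hab 𝔸 (P.path a b x)) =
      Φ.rate i • constOp hab (Φ.comp i) (P.pathIncl hab x) := by
  refine Lp.ext ?_
  filter_upwards [constOp_ae_eq hab (Φ.comp i) (constOp hab 𝔸 (P.path a b x)),
    constOp_ae_eq hab 𝔸 (P.path a b x), constOp_ae_eq hab (Φ.comp i) (P.pathIncl hab x),
    P.pathIncl_ae_eq hab x, Lp.coeFn_smul (Φ.rate i) (constOp hab (Φ.comp i) (P.pathIncl hab x))]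
    with s h1 h2 h3 h4 h5
  rw [h5, Pi.smul_apply, h1, h2, h3, h4, comp_op, smul_eq_mul]

/-- The energy identity for u' + λu, where u is a coordinate of the path and λ its eigenvalue: the
cross term 2λ⟨u', u⟩ integrates to boundary terms. -/
theorem norm_comp_opD_sq (hab : a < b) (i : Φ.ι) (x : P.pathSpace a b) :
    ‖constOp hab (Φ.comp i) (P.opD hab (.const _ 𝔸) x)‖ ^ 2 =
      ‖constOp hab (Φ.comp i) (P.pathDeriv a b x)‖ ^ 2 +
      ‖constOp hab (Φ.comp i) (constOp hab 𝔸 (P.path a b x))‖ ^ 2 +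
      Φ.rate i * (Φ.comp i (P.rep hab x b) ^ 2 - Φ.comp i (P.rep hab x a) ^ 2) := by
  rw [opD_const_apply, map_add, norm_add_sq_real, ← P.two_mul_inner_constOp hab (Φ.comp i) x,
    Φ.constOp_comp_op, inner_smul_right]
  ring

/-- The eigenvalue weighted square sum of the coordinates is controlled by the norm of
`H_{1/2}`. -/
theorem exists_sum_rate_le : ∃ C : ℝ, 0 ≤ C ∧ ∀ (F : Finset Φ.ι) (x : P.Half),
    ∑ i ∈ F, |Φ.rate i| * Φ.comp i (P.halfVal x) ^ 2 ≤ C * ‖x‖ ^ 2 := by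
  have h01 : (0 : ℝ) < 1 := one_pos
  -- The factor 1 − s makes the extension of x vanish at 1, so that only the boundary term at 0
  -- remains.
  have hχ : ContDiff ℝ ∞ fun s : ℝ => 1 - s := by fun_prop
  set X := P.smulPath h01 _ hχ ∘L P.halfExt h01 with hX
  set B := constOp h01 𝔸 ∘L P.path 0 1 with hB
  refine ⟨‖Φ.coord.toContinuousLinearMap‖ ^ 2 *
    ((‖P.pathDeriv 0 1‖ * ‖X‖) ^ 2 + (‖B‖ * ‖X‖) ^ 2), by positivity, fun F x => ?_⟩
  have hrep0 : P.rep h01 (X x) 0 = P.halfVal x := by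
    rw [hX, ContinuousLinearMap.comp_apply, P.rep_smulPath h01 hχ _ (left_mem_Icc.2 h01.le),
      ← P.halfVal_eval h01 ⟨0, left_mem_Icc.2 h01.le⟩, P.eval_halfExt h01]
    simp
  have hrep1 : P.rep h01 (X x) 1 = 0 := by
    rw [hX, ContinuousLinearMap.comp_apply, P.rep_smulPath h01 hχ _ (right_mem_Icc.2 h01.le)]
    simp
  have key : ∀ i, |Φ.rate i| * Φ.comp i (P.halfVal x) ^ 2 ≤
      ‖constOp h01 (Φ.comp i) (P.pathDeriv 0 1 (X x))‖ ^ 2 +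
      ‖constOp h01 (Φ.comp i) (B (X x))‖ ^ 2 := by
    intro i
    have h1 := Φ.norm_comp_opD_sq h01 i (X x)
    -- The energy identity of ∂ₛ − 𝔸. Nonnegativity of the left side of `h1` bounds the boundary
    -- term for a positive eigenvalue, that of `h2` for a negative one.
    have h2 : ‖constOp h01 (Φ.comp i) (P.pathDeriv 0 1 (X x) - constOp h01 𝔸 (P.path 0 1 (X x)))‖ ^ 2
        = ‖constOp h01 (Φ.comp i) (P.pathDeriv 0 1 (X x))‖ ^ 2 +
      ‖constOp h01 (Φ.comp i) (constOp h01 𝔸 (P.path 0 1 (X x)))‖ ^ 2 -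
      Φ.rate i * (Φ.comp i (P.rep h01 (X x) 1) ^ 2 - Φ.comp i (P.rep h01 (X x) 0) ^ 2) := by
      rw [map_sub, norm_sub_sq_real, ← P.two_mul_inner_constOp h01 (Φ.comp i) (X x),
        Φ.constOp_comp_op, inner_smul_right]
      ring
    rw [hrep0, hrep1, map_zero] at h1 h2
    change _ ≤ _ + ‖constOp h01 (Φ.comp i) (constOp h01 𝔸 (P.path 0 1 (X x)))‖ ^ 2
    rcases abs_cases (Φ.rate i) with ⟨h, _⟩ | ⟨h, _⟩ <;> rw [h]
    · nlinarith [sq_nonneg ‖constOp h01 (Φ.comp i) (P.opD h01 (.const _ 𝔸) (X x))‖]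
    · nlinarith [sq_nonneg ‖constOp h01 (Φ.comp i)
        (P.pathDeriv 0 1 (X x) - constOp h01 𝔸 (P.path 0 1 (X x)))‖]
  refine (Finset.sum_le_sum fun i _ => key i).trans ?_
  rw [Finset.sum_add_distrib]
  refine (add_le_add (Φ.sum_norm_constOp_comp_sq_le h01 F _)
    (Φ.sum_norm_constOp_comp_sq_le h01 F _)).trans ?_
  rw [← mul_add, mul_assoc]
  refine mul_le_mul_of_nonneg_left ?_ (by positivity)
  rw [add_mul, ← mul_pow, ← mul_pow]
  have l1 : ‖P.pathDeriv 0 1 (X x)‖ ≤ ‖P.pathDeriv 0 1‖ * ‖X‖ * ‖x‖ := by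
    rw [mul_assoc]
    exact ((P.pathDeriv 0 1).le_opNorm _).trans
      (mul_le_mul_of_nonneg_left (X.le_opNorm x) (ContinuousLinearMap.opNorm_nonneg _))
  have l2 : ‖B (X x)‖ ≤ ‖B‖ * ‖X‖ * ‖x‖ := by
    rw [mul_assoc]
    exact (B.le_opNorm _).trans (mul_le_mul_of_nonneg_left (X.le_opNorm x) (ContinuousLinearMap.opNorm_nonneg _))
  exact add_le_add (pow_le_pow_left₀ (norm_nonneg _) l1 2) (pow_le_pow_left₀ (norm_nonneg _) l2 2)

theorem comp_rep_left (hab : a < b) {i : Φ.ι} (hi : 0 < Φ.rate i) (x : P.pathSpace a b) :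
    Φ.comp i (P.rep hab x a) =
      Φ.comp i (P.halfVal (P.projPos 𝔸 (P.eval hab (leftEnd hab) x))) := by
  rw [Φ.comp_projPos hi, halfVal_eval]; rfl

theorem comp_rep_right (hab : a < b) {i : Φ.ι} (hi : Φ.rate i < 0) (x : P.pathSpace a b) :
    Φ.comp i (P.rep hab x b) =
      Φ.comp i (P.halfVal (P.projNeg 𝔸 (P.eval hab (rightEnd hab) x))) := by
  rw [Φ.comp_projNeg hi, halfVal_eval]; rfl

/-- For each sign of the eigenvalue one of the two boundary terms of the energy identity has the
good sign and can be dropped. The other one is a prescribed boundary value: at a for positive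
eigenvalues, at b for negative ones. -/
theorem norm_comp_sq_add_le (hab : a < b) (i : Φ.ι) (x : P.pathSpace a b) :
    ‖constOp hab (Φ.comp i) (P.pathDeriv a b x)‖ ^ 2 +
      ‖constOp hab (Φ.comp i) (constOp hab 𝔸 (P.path a b x))‖ ^ 2 ≤
    ‖constOp hab (Φ.comp i) (P.opD hab (.const _ 𝔸) x)‖ ^ 2 +
      (|Φ.rate i| * Φ.comp i (P.halfVal (P.projPos 𝔸 (P.eval hab (leftEnd hab) x))) ^ 2 +
      |Φ.rate i| * Φ.comp i (P.halfVal (P.projNeg 𝔸 (P.eval hab (rightEnd hab) x))) ^ 2) := by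
  have h := Φ.norm_comp_opD_sq hab i x
  rcases lt_or_gt_of_ne (Φ.rate_ne_zero i) with hi | hi
  · rw [← Φ.comp_rep_right hab hi, abs_of_neg hi]
    nlinarith [mul_nonneg (neg_nonneg.2 hi.le) (sq_nonneg (Φ.comp i (P.rep hab x a))),
      mul_nonneg (neg_nonneg.2 hi.le) (sq_nonneg
        (Φ.comp i (P.halfVal (P.projPos 𝔸 (P.eval hab (leftEnd hab) x)))))]
  · rw [← Φ.comp_rep_left hab hi, abs_of_pos hi]
    nlinarith [mul_nonneg hi.le (sq_nonneg (Φ.comp i (P.rep hab x b))),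
      mul_nonneg hi.le (sq_nonneg
        (Φ.comp i (P.halfVal (P.projNeg 𝔸 (P.eval hab (rightEnd hab) x)))))]

/-- Sum the coordinate estimates. `exists_sum_rate_le` controls the weighted boundary values by
their norms in H_{1/2}, and the inverse of 𝔸 recovers the H₁-norm of x from 𝔸x. -/
theorem exists_norm_le_bdryOp (Φ : P.SpectralFrame 𝔸) (hab : a < b) : ∃ C : ℝ, 0 ≤ C ∧ ∀ x : P.pathSpace a b,
    ‖x‖ ≤ C * ‖P.bdryOp hab (.const _ 𝔸) 𝔸 𝔸 x‖ := by
  obtain ⟨C₁, hC₁, h1⟩ := Φ.exists_sum_rate_le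
  set U := ‖Φ.coord.toContinuousLinearMap‖
  set V := ‖Φ.coord.symm.toContinuousLinearMap‖
  set J := ‖Φ.equiv.symm.toContinuousLinearMap‖ with hJ
  refine ⟨√((J ^ 2 + 1) * (V ^ 2 * (U ^ 2 + (C₁ + C₁)))), Real.sqrt_nonneg _, fun x => ?_⟩
  refine le_of_sq_le_sq ?_ (by positivity)
  rw [mul_pow, Real.sq_sqrt (by positivity)]
  set N := ‖P.bdryOp hab (.const _ 𝔸) 𝔸 𝔸 x‖ with hN
  set y := P.projPos 𝔸 (P.eval hab (leftEnd hab) x) with hy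
  set z := P.projNeg 𝔸 (P.eval hab (rightEnd hab) x) with hz
  have n1 : ‖P.opD hab (.const _ 𝔸) x‖ ^ 2 ≤ N ^ 2 :=
    pow_le_pow_left₀ (norm_nonneg _) (norm_fst_le (P.bdryOp hab (.const _ 𝔸) 𝔸 𝔸 x)) 2
  have n2 : ‖(y : P.Half)‖ ^ 2 ≤ N ^ 2 :=
    pow_le_pow_left₀ (norm_nonneg _) ((norm_fst_le (P.bdryOp hab (.const _ 𝔸) 𝔸 𝔸 x).2).trans
      (norm_snd_le (P.bdryOp hab (.const _ 𝔸) 𝔸 𝔸 x))) 2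
  have n3 : ‖(z : P.Half)‖ ^ 2 ≤ N ^ 2 :=
    pow_le_pow_left₀ (norm_nonneg _) ((norm_snd_le (P.bdryOp hab (.const _ 𝔸) 𝔸 𝔸 x).2).trans
      (norm_snd_le (P.bdryOp hab (.const _ 𝔸) 𝔸 𝔸 x))) 2
  have hsum : ∀ F : Finset Φ.ι, (∑ i ∈ F, ‖constOp hab (Φ.comp i) (P.pathDeriv a b x)‖ ^ 2) +
      ∑ i ∈ F, ‖constOp hab (Φ.comp i) (constOp hab 𝔸 (P.path a b x))‖ ^ 2 ≤
      (U ^ 2 + (C₁ + C₁)) * N ^ 2 := by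
    intro F
    rw [← Finset.sum_add_distrib]
    refine (Finset.sum_le_sum fun i _ => Φ.norm_comp_sq_add_le hab i x).trans ?_
    rw [Finset.sum_add_distrib, Finset.sum_add_distrib]
    have l1 := Φ.sum_norm_constOp_comp_sq_le hab F (P.opD hab (.const _ 𝔸) x)
    have l2 := h1 F y
    have l3 := h1 F z
    have l4 := mul_le_mul_of_nonneg_left n1 (sq_nonneg U)
    have l5 := mul_le_mul_of_nonneg_left n2 hC₁
    have l6 := mul_le_mul_of_nonneg_left n3 hC₁
    calc _ ≤ U ^ 2 * N ^ 2 + (C₁ * N ^ 2 + C₁ * N ^ 2) :=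
          add_le_add (l1.trans l4) (add_le_add (l2.trans l5) (l3.trans l6))
      _ = _ := by ring
  have m1 := Φ.norm_sq_le_of_forall_sum_le hab (η := P.pathDeriv a b x) fun F =>
    (le_add_of_nonneg_right (Finset.sum_nonneg fun i _ => by positivity)).trans (hsum F)
  have m2 := Φ.norm_sq_le_of_forall_sum_le hab (η := constOp hab 𝔸 (P.path a b x)) fun F =>
    (le_add_of_nonneg_left (Finset.sum_nonneg fun i _ => by positivity)).trans (hsum F)
  have m3 : ‖P.path a b x‖ ^ 2 ≤ J ^ 2 * ‖constOp hab 𝔸 (P.path a b x)‖ ^ 2 := by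
    rw [← mul_pow]
    refine pow_le_pow_left₀ (norm_nonneg _) ?_ 2
    refine Lp.norm_le_mul_norm_of_ae_le_mul ?_
    filter_upwards [constOp_ae_eq hab 𝔸 (P.path a b x)] with s hs
    rw [hs, ← Φ.equiv_apply]
    calc ‖P.path a b x s‖ = ‖Φ.equiv.symm (Φ.equiv (P.path a b x s))‖ := by
          rw [Φ.equiv.symm_apply_apply]
      _ ≤ _ := Φ.equiv.symm.toContinuousLinearMap.le_opNorm _
  rw [P.norm_sq_pathSpace]
  have m4 := mul_le_mul_of_nonneg_left m2 (sq_nonneg J)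
  calc _ ≤ J ^ 2 * (V ^ 2 * ((U ^ 2 + (C₁ + C₁)) * N ^ 2)) +
        V ^ 2 * ((U ^ 2 + (C₁ + C₁)) * N ^ 2) := add_le_add (m3.trans m4) m1
    _ = _ := by ring

/-- The solution of an inhomogeneous equation with values in an eigenspace. -/
theorem exists_solution (hab : a < b) (i : Φ.ι) {g : ℝ → ℝ} (hg : Continuous g) (t : Icc a b)
    (c : ℝ) : ∃ x : P.pathSpace a b,
      (∀ᵐ s ∂volume.restrict (Icc a b),
        P.opD hab (.const _ 𝔸) x s = g s • P.incl (Φ.vec i)) ∧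
      P.eval hab t x = c • P.halfIncl (Φ.vec i) ∧
      ∀ s, ∃ r : ℝ, P.eval hab s x = r • P.halfIncl (Φ.vec i) := by
  set α := Φ.rate i with hα
  set w := Φ.vec i with hw
  have hχ : ContDiff ℝ ∞ fun s => Real.exp (-α * s) := by fun_prop
  obtain ⟨y, hy1, hy2⟩ := P.exists_pathSpace_primitive hab (g := fun s => Real.exp (α * s) * g s)
    (by fun_prop) w
  have hG : Continuous fun s => ∫ r in a..s, Real.exp (α * r) * g r :=
    intervalIntegral.continuous_primitive
      (fun _ _ => Continuous.intervalIntegrable (by fun_prop) _ _) a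
  have hev : ∀ s : Icc a b, P.eval hab s y =
      (∫ r in a..s, Real.exp (α * r) * g r) • P.halfIncl w := by
    intro s
    refine P.halfVal_injective ?_
    rw [halfVal_eval, map_smul, halfVal_halfIncl]
    refine P.rep_eq_of_ae hab y (g := fun s => (∫ r in a..s, Real.exp (α * r) * g r) • P.incl w)
      (hG.smul continuous_const).continuousOn ?_ s.2
    filter_upwards [hy1] with s hs
    rw [hs, map_smul]
  -- Variation of constants: the coefficient is e^{-αs}(∫ₐˢ e^{αr} g(r) dr + d), and d is fixed by
  -- the requirement that it be c at t.
  set d : ℝ := Real.exp (α * t) * c - ∫ r in a..t, Real.exp (α * r) * g r with hd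
  set z := y + d • P.constPath hab w with hz
  have hez : ∀ s : Icc a b, P.eval hab s (P.smulPath hab _ hχ z) =
      (Real.exp (-α * s) * ((∫ r in a..s, Real.exp (α * r) * g r) + d)) • P.halfIncl w := by
    intro s
    rw [eval_smulPath, hz, map_add, hev, map_smul, P.eval_constPath, ← add_smul, smul_smul]
  refine ⟨P.smulPath hab _ hχ z, ?_, ?_, fun s => ⟨_, hez s⟩⟩
  · rw [opD_smulPath]
    have hχ' : Continuous (deriv fun s => Real.exp (-α * s)) := hχ.continuous_deriv (by simp)
    have hd' : ∀ s, deriv (fun s => Real.exp (-α * s)) s = -α * Real.exp (-α * s) := by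
      intro s
      have : HasDerivAt (fun s => Real.exp (-α * s)) (Real.exp (-α * s) * (-α * 1)) s :=
        ((hasDerivAt_id s).const_mul _).exp
      rw [this.deriv]; ring
    have epath : P.path a b z = P.path a b y + d • P.path a b (P.constPath hab w) := by
      rw [hz, map_add, map_smul]
    have ederiv : P.pathDeriv a b z = P.pathDeriv a b y := by
      rw [hz, map_add, map_smul, pathDeriv_constPath, smul_zero, add_zero]
    have hzp : ∀ᵐ s ∂volume.restrict (Icc a b), P.path a b z s =
        ((∫ r in a..s, Real.exp (α * r) * g r) + d) • w := by
      rw [epath]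
      filter_upwards [Lp.coeFn_add (P.path a b y) (d • P.path a b (P.constPath hab w)),
        Lp.coeFn_smul d (P.path a b (P.constPath hab w)), P.path_constPath_ae_eq hab w, hy1]
        with s h1 h2 h3 h4
      rw [h1, Pi.add_apply, h2, Pi.smul_apply, h3, h4, add_smul]
    filter_upwards [Lp.coeFn_add (scal H₀ hab ⟨fun s => Real.exp (-α * s), hχ.continuous⟩
        (P.opD hab (.const _ 𝔸) z)) (scal H₀ hab ⟨deriv fun s => Real.exp (-α * s), hχ'⟩
        (P.pathIncl hab z)),
      scal_ae_eq hab ⟨fun s => Real.exp (-α * s), hχ.continuous⟩ (P.opD hab (.const _ 𝔸) z),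
      scal_ae_eq hab ⟨deriv fun s => Real.exp (-α * s), hχ'⟩ (P.pathIncl hab z),
      P.pathIncl_ae_eq hab z, hzp, hy2,
      Lp.coeFn_add (P.pathDeriv a b z) (constOp hab 𝔸 (P.path a b z)),
      constOp_ae_eq hab 𝔸 (P.path a b z)] with s h1 h2 h3 h4 h5 h6 h7 h8
    rw [h1, Pi.add_apply, h2, h3, h4, opD_const_apply, h7, Pi.add_apply, h8, h5, ederiv, h6]
    simp only [ContinuousMap.coe_mk, hd', map_smul]
    rw [hw, Φ.op_vec, ← hα]
    simp only [smul_smul, ← add_smul]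
    congr 1
    have he : Real.exp (-α * s) * Real.exp (α * s) = 1 := by
      rw [← Real.exp_add]; simp
    linear_combination g s * he
  · rw [hez, hd]
    congr 1
    have he : Real.exp (-α * t) * Real.exp (α * t) = 1 := by
      rw [← Real.exp_add]; simp
    linear_combination c * he

theorem projPos_halfIncl_vec_of_neg {i : Φ.ι} (hi : Φ.rate i < 0) :
    P.projPos 𝔸 (P.halfIncl (Φ.vec i)) = 0 := by
  rw [Φ.projPos_eq_zero_iff]
  intro j hj
  rw [halfVal_halfIncl, comp_incl_vec_ne]
  rintro rfl; linarith

theorem projNeg_halfIncl_vec_of_pos {i : Φ.ι} (hi : 0 < Φ.rate i) :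
    P.projNeg 𝔸 (P.halfIncl (Φ.vec i)) = 0 := by
  rw [Φ.projNeg_eq_zero_iff]
  intro j hj
  rw [halfVal_halfIncl, comp_incl_vec_ne]
  rintro rfl; linarith

/-- The a priori estimate makes the range closed. It therefore suffices to hit a total set of data,
namely eigenvectors as boundary values and continuous multiples of eigenvectors as right hand sides,
for which the problem is a scalar ODE. -/
theorem range_bdryOp_const (Φ : P.SpectralFrame 𝔸) (hab : a < b) :
    (P.bdryOp hab (.const _ 𝔸) 𝔸 𝔸).range = ⊤ := by
  have := P.completeSpace_pathSpace hab
  set L := P.bdryOp hab (.const _ 𝔸) 𝔸 𝔸 with hL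
  obtain ⟨C, hC0, hC⟩ := Φ.exists_norm_le_bdryOp hab
  have hcl : IsClosed (L.range : Set (PathL2 a b H₀ × P.halfPos 𝔸 × P.halfNeg 𝔸)) :=
    (L.antilipschitz_of_bound (K := ⟨C, hC0⟩) hC).isClosed_range L.uniformContinuous
  have hpos : ∀ x : P.Half, ((0 : PathL2 a b H₀), P.projPos 𝔸 x, (0 : P.halfNeg 𝔸)) ∈ L.range := by
    let T : P.Half →L[ℝ] PathL2 a b H₀ × P.halfPos 𝔸 × P.halfNeg 𝔸 :=
      (0 : P.Half →L[ℝ] PathL2 a b H₀).prod ((P.projPos 𝔸).prod 0)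
    have h1 : L.range.comap (T : P.Half →ₗ[ℝ] _) = ⊤ := by
      refine Φ.top_of_halfIncl_vec_mem (hcl.preimage T.continuous) fun i => ?_
      change ((0 : PathL2 a b H₀), P.projPos 𝔸 (P.halfIncl (Φ.vec i)), (0 : P.halfNeg 𝔸)) ∈ L.range
      rcases lt_or_gt_of_ne (Φ.rate_ne_zero i) with hi | hi
      · rw [Φ.projPos_halfIncl_vec_of_neg hi]
        exact zero_mem _
      · obtain ⟨x, hx1, hx2, hx3⟩ := Φ.exists_solution hab i (continuous_const (y := 0))
          (leftEnd hab) 1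
        obtain ⟨r, hr⟩ := hx3 (rightEnd hab)
        refine ⟨x, ?_⟩
        change L x = _
        rw [hL, bdryOp_apply, hx2, hr, map_smul, map_smul, Φ.projNeg_halfIncl_vec_of_pos hi,
          smul_zero, one_smul]
        congr 1
        refine Lp.ext ?_
        filter_upwards [hx1, Lp.coeFn_zero H₀ 2 (volume.restrict (Icc a b))] with s h1 h2
        rw [h1, h2]; simp
    intro x
    have : x ∈ L.range.comap (T : P.Half →ₗ[ℝ] _) := by rw [h1]; trivial
    exact this
  have hneg : ∀ x : P.Half, ((0 : PathL2 a b H₀), (0 : P.halfPos 𝔸), P.projNeg 𝔸 x) ∈ L.range := by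
    let T : P.Half →L[ℝ] PathL2 a b H₀ × P.halfPos 𝔸 × P.halfNeg 𝔸 :=
      (0 : P.Half →L[ℝ] PathL2 a b H₀).prod ((0 : P.Half →L[ℝ] P.halfPos 𝔸).prod (P.projNeg 𝔸))
    have h1 : L.range.comap (T : P.Half →ₗ[ℝ] _) = ⊤ := by
      refine Φ.top_of_halfIncl_vec_mem (hcl.preimage T.continuous) fun i => ?_
      change ((0 : PathL2 a b H₀), (0 : P.halfPos 𝔸), P.projNeg 𝔸 (P.halfIncl (Φ.vec i))) ∈ L.range
      rcases lt_or_gt_of_ne (Φ.rate_ne_zero i) with hi | hi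
      · obtain ⟨x, hx1, hx2, hx3⟩ := Φ.exists_solution hab i (continuous_const (y := 0))
          (rightEnd hab) 1
        obtain ⟨r, hr⟩ := hx3 (leftEnd hab)
        refine ⟨x, ?_⟩
        change L x = _
        rw [hL, bdryOp_apply, hx2, hr, map_smul, map_smul, Φ.projPos_halfIncl_vec_of_neg hi,
          smul_zero, one_smul]
        congr 1
        refine Lp.ext ?_
        filter_upwards [hx1, Lp.coeFn_zero H₀ 2 (volume.restrict (Icc a b))] with s h1 h2
        rw [h1, h2]; simp
      · rw [Φ.projNeg_halfIncl_vec_of_pos hi]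
        exact zero_mem _
    intro x
    have : x ∈ L.range.comap (T : P.Half →ₗ[ℝ] _) := by rw [h1]; trivial
    exact this
  have hint : ∀ η : PathL2 a b H₀, (η, (0 : P.halfPos 𝔸), (0 : P.halfNeg 𝔸)) ∈ L.range := by
    let T : PathL2 a b H₀ →L[ℝ] PathL2 a b H₀ × P.halfPos 𝔸 × P.halfNeg 𝔸 :=
      ContinuousLinearMap.inl ℝ _ _
    have hTcl : IsClosed (L.range.comap (T : PathL2 a b H₀ →ₗ[ℝ] _) : Set (PathL2 a b H₀)) :=
      hcl.preimage T.continuous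
    have h1 : L.range.comap (T : PathL2 a b H₀ →ₗ[ℝ] _) = ⊤ := by
      refine eq_top_of_forall_continuous_smul hab hTcl fun g w η hg hη => ?_
      have e : η = tensor H₀ hab (memLp_of_continuous hg).toLp w := by
        refine Lp.ext ?_
        filter_upwards [hη, tensor_ae_eq hab (memLp_of_continuous (a := a) (b := b) hg).toLp w,
          (memLp_of_continuous (a := a) (b := b) hg).coeFn_toLp] with s h1 h2 h3
        rw [h1, h2, h3]
      set γ : PathL2 a b ℝ := (memLp_of_continuous hg).toLp with hγ
      have h2 : (L.range.comap (T : PathL2 a b H₀ →ₗ[ℝ] _)).comap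
          (tensor H₀ hab γ : H₀ →ₗ[ℝ] PathL2 a b H₀) = ⊤ := by
        refine Φ.top_of_incl_vec_mem (hTcl.preimage (tensor H₀ hab γ).continuous) fun i => ?_
        obtain ⟨x, hx1, -, -⟩ := Φ.exists_solution hab i hg (leftEnd hab) 0
        have h3 : L x = (tensor H₀ hab γ (P.incl (Φ.vec i)),
            P.projPos 𝔸 (P.eval hab (leftEnd hab) x),
            P.projNeg 𝔸 (P.eval hab (rightEnd hab) x)) := by
          rw [hL, bdryOp_apply]
          congr 1
          refine Lp.ext ?_
          filter_upwards [hx1, tensor_ae_eq hab γ (P.incl (Φ.vec i)),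
            (memLp_of_continuous (a := a) (b := b) hg).coeFn_toLp] with s h1 h2 h3
          rw [h1, h2, h3]
        -- The solution x may have nonzero boundary values, but these already lie in the range as
        -- pure boundary data and can be subtracted.
        have h4 := sub_mem (sub_mem (⟨x, rfl⟩ : L x ∈ L.range)
          (hpos (P.eval hab (leftEnd hab) x))) (hneg (P.eval hab (rightEnd hab) x))
        rw [h3, Prod.mk_sub_mk, Prod.mk_sub_mk, Prod.mk_sub_mk, Prod.mk_sub_mk] at h4
        simp only [sub_zero, sub_self] at h4
        exact h4
      have : w ∈ (L.range.comap (T : PathL2 a b H₀ →ₗ[ℝ] _)).comap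
          (tensor H₀ hab γ : H₀ →ₗ[ℝ] PathL2 a b H₀) := by rw [h2]; trivial
      rw [e]
      exact this
    intro η
    have : η ∈ L.range.comap (T : PathL2 a b H₀ →ₗ[ℝ] _) := by rw [h1]; trivial
    exact this
  rw [eq_top_iff]
  rintro ⟨η, y, z⟩ -
  have h := add_mem (add_mem (hint η) (hpos y)) (hneg z)
  rw [Φ.projPos_coe, Φ.projNeg_coe] at h
  simpa using h

theorem exists_equiv_bdryOp_const (Φ : P.SpectralFrame 𝔸) (hab : a < b) :
    ∃ L : P.pathSpace a b ≃L[ℝ] PathL2 a b H₀ × P.halfPos 𝔸 × P.halfNeg 𝔸,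
      L.toContinuousLinearMap = P.bdryOp hab (.const _ 𝔸) 𝔸 𝔸 := by
  have := P.completeSpace_pathSpace hab
  obtain ⟨C, hC0, hC⟩ := Φ.exists_norm_le_bdryOp hab
  have hker : (P.bdryOp hab (.const _ 𝔸) 𝔸 𝔸).ker = ⊥ := by
    rw [LinearMap.ker_eq_bot']
    intro x hx
    have h1 : P.bdryOp hab (.const _ 𝔸) 𝔸 𝔸 x = 0 := hx
    have h2 := hC x
    rw [h1, norm_zero, mul_zero] at h2
    exact norm_le_zero_iff.1 h2
  exact ⟨ContinuousLinearEquiv.ofBijective _ hker (Φ.range_bdryOp_const hab),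
    ContinuousLinearEquiv.coe_ofBijective _ _ _⟩

/-- A solution which starts in the negative spectral subspace ends there. -/
theorem projPos_eval_right_eq_zero (Φ : P.SpectralFrame 𝔸) (hab : a < b) {x : P.pathSpace a b}
    (h : P.opD hab (.const _ 𝔸) x = 0) (hx : P.projPos 𝔸 (P.eval hab (leftEnd hab) x) = 0) :
    P.projPos 𝔸 (P.eval hab (rightEnd hab) x) = 0 := by
  rw [Φ.projPos_eq_zero_iff] at hx ⊢
  intro i hi
  have h1 := Φ.norm_comp_opD_sq hab i x
  have h2 := hx i hi
  rw [halfVal_eval] at h2 ⊢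
  change Φ.comp i (P.rep hab x a) = 0 at h2
  change Φ.comp i (P.rep hab x b) = 0
  rw [h, h2, map_zero, norm_zero] at h1
  -- For a homogeneous solution whose coordinate vanishes at a, the energy identity says that two
  -- squares plus λu(b)² add up to zero.
  have h3 : Φ.rate i * Φ.comp i (P.rep hab x b) ^ 2 ≤ 0 := by
    nlinarith [sq_nonneg ‖constOp hab (Φ.comp i) (P.pathDeriv a b x)‖,
      sq_nonneg ‖constOp hab (Φ.comp i) (constOp hab 𝔸 (P.path a b x))‖]
  by_contra h4
  have : 0 < Φ.comp i (P.rep hab x b) ^ 2 := by positivity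
  nlinarith [mul_pos hi this]

/-- A solution which ends in the positive spectral subspace starts there. -/
theorem projNeg_eval_left_eq_zero (Φ : P.SpectralFrame 𝔸) (hab : a < b) {x : P.pathSpace a b}
    (h : P.opD hab (.const _ 𝔸) x = 0) (hx : P.projNeg 𝔸 (P.eval hab (rightEnd hab) x) = 0) :
    P.projNeg 𝔸 (P.eval hab (leftEnd hab) x) = 0 := by
  rw [Φ.projNeg_eq_zero_iff] at hx ⊢
  intro i hi
  have h1 := Φ.norm_comp_opD_sq hab i x
  have h2 := hx i hi
  rw [halfVal_eval] at h2 ⊢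
  change Φ.comp i (P.rep hab x b) = 0 at h2
  change Φ.comp i (P.rep hab x a) = 0
  rw [h, h2, map_zero, norm_zero] at h1
  have h3 : -Φ.rate i * Φ.comp i (P.rep hab x a) ^ 2 ≤ 0 := by
    nlinarith [sq_nonneg ‖constOp hab (Φ.comp i) (P.pathDeriv a b x)‖,
      sq_nonneg ‖constOp hab (Φ.comp i) (constOp hab 𝔸 (P.path a b x))‖]
  by_contra h4
  have : 0 < Φ.comp i (P.rep hab x a) ^ 2 := by positivity
  nlinarith [mul_pos (neg_pos.2 hi) this]

end SpectralFrame

end HilbertPair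

/-! ### Making a Hessian invertible. -/

namespace HilbertPair

section Perturbation

variable {H₀ H₁ : Type*} [NormedAddCommGroup H₀] [InnerProductSpace ℝ H₀] [CompleteSpace H₀]
  [NormedAddCommGroup H₁] [InnerProductSpace ℝ H₁] [CompleteSpace H₁] (P : HilbertPair H₀ H₁)

/-- A Hessian becomes invertible, and stays symmetrizable, if one adds a suitable bounded operator
on `H₀` to it. -/
theorem IsHessian.exists_add_isInvertible {A : H₁ →L[ℝ] H₀} (h : P.IsHessian A) :
    ∃ S : H₀ →L[ℝ] H₀, P.IsSymmetrizable (A + S ∘L P.incl) ∧ (A + S ∘L P.incl).IsInvertible := by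
  obtain ⟨⟨b, hb, ⟨c, hc, hbc⟩, hs⟩, hF, hi⟩ := h
  obtain ⟨H, _, _, _, U, hU⟩ := exists_equiv_of_equivalent_form b hb hc hbc
  have hfin : FiniteDimensional ℝ A.ker := hF.finite_ker
  -- The operator S to be added is the projection to the kernel of `A` which is orthogonal for the
  -- symmetrizing form. It is symmetric for this form, so the sum remains symmetrizable.
  let N : Submodule ℝ H := A.ker.map ((U.toContinuousLinearMap ∘L P.incl : H₁ →L[ℝ] H) : H₁ →ₗ[ℝ] H)
  let S : H₀ →L[ℝ] H₀ := U.symm.toContinuousLinearMap ∘L N.starProjection ∘L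
    U.toContinuousLinearMap
  have hUS : ∀ x, U (S x) = N.starProjection (U x) := fun x => U.apply_symm_apply _
  have hsym : ∀ x y, b (S x) y = b x (S y) := by
    intro x y
    rw [← hU, ← hU, hUS, hUS]
    exact Submodule.starProjection_isSymmetric N _ _
  have hbS : ∀ x y : H₁, b ((A + S ∘L P.incl) x) (P.incl y) =
      b (P.incl x) ((A + S ∘L P.incl) y) := by
    intro x y
    simp only [add_apply, ContinuousLinearMap.comp_apply, map_add, LinearMap.add_apply]
    rw [hs, hsym]
  have hinj : ∀ x, (A + S ∘L P.incl) x = 0 → x = 0 := by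
    intro x hx
    have h1 : U (A x) + N.starProjection (U (P.incl x)) = 0 := by
      rw [← hUS, ← map_add]
      exact (congrArg U hx).trans (map_zero U)
    -- By symmetry the range of `A` is orthogonal to its kernel. So `A x` and the projection of x
    -- cancel only if both are zero, which forces x = 0.
    have h2 : U (A x) ∈ Nᗮ := by
      rintro _ ⟨n, hn, rfl⟩
      change ⟪U (P.incl n), U (A x)⟫_ℝ = 0
      have hn0 : A n = 0 := hn
      rw [hU, ← hs, hn0]
      simp
    have h3 : U (A x) ∈ N := by
      rw [eq_neg_of_add_eq_zero_left h1]
      exact N.neg_mem (Submodule.starProjection_apply_mem _ _)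
    have h4 : U (A x) = 0 := by
      have := h2 _ h3
      exact inner_self_eq_zero.1 this
    have h5 : x ∈ A.ker := U.injective (by rw [map_zero]; exact h4)
    have h6 : U (P.incl x) ∈ N := ⟨x, h5, rfl⟩
    rw [h4, zero_add, Submodule.starProjection_eq_self_iff.2 h6] at h1
    exact P.injective_incl (U.injective (by rw [h1, map_zero, map_zero]))
  -- The added term factors over the compact inclusion, so the index remains zero and injectivity
  -- implies surjectivity.
  have hap : (S ∘L P.incl).IsApproximable :=
    (ContinuousLinearMap.IsApproximable.of_isCompactOperator P.compact_incl).comp_left S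
  obtain ⟨R, K, K', hK, hK', e1, e2⟩ := hF.exists_approximable_inverse
  have hind := fredholmIndex_add_small_add hK hK' e1 e2 (s := 0) (by simp) hap
  rw [add_zero, hi] at hind
  refine ⟨S, ⟨b, hb, ⟨c, hc, hbc⟩, hbS⟩, ?_⟩
  have hker : (A + S ∘L P.incl).ker = ⊥ := LinearMap.ker_eq_bot'.2 hinj
  have hran : (A + S ∘L P.incl).range = ⊤ := by
    have h1 := hind.2
    rw [fredholmIndex, hker, finrank_bot] at h1
    have := hind.1.finiteDimensional_coker
    have h2 : Module.finrank ℝ (H₀ ⧸ (A + S ∘L P.incl).range) = 0 := by omega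
    have h3 := Module.finrank_zero_iff.1 h2
    exact Submodule.Quotient.subsingleton_iff.1 h3
  exact ⟨ContinuousLinearEquiv.ofBijective _ hker hran, ContinuousLinearEquiv.coe_ofBijective _ _ _⟩

end Perturbation

end HilbertPair

/-! ### Cutoff functions and gluing of Fredholm operators. -/

/-- A smooth function which vanishes up to `c` and is `1` from `d` on. -/
theorem exists_smooth_step {c d : ℝ} (h : c < d) : ∃ θ : ℝ → ℝ, ContDiff ℝ ∞ θ ∧
    (∀ s ≤ c, θ s = 0) ∧ (∀ s, d ≤ s → θ s = 1) ∧ ∀ s, |θ s| ≤ 1 := by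
  have hdc : 0 < d - c := sub_pos.2 h
  refine ⟨fun s => Real.smoothTransition ((s - c) / (d - c)),
    Real.smoothTransition.contDiff.comp (by fun_prop), fun s hs => ?_, fun s hs => ?_, fun s => ?_⟩
  · exact Real.smoothTransition.zero_of_nonpos
      (div_nonpos_of_nonpos_of_nonneg (by linarith) hdc.le)
  · exact Real.smoothTransition.one_of_one_le ((one_le_div hdc).2 (by linarith))
  · rw [abs_of_nonneg (Real.smoothTransition.nonneg _)]
    exact Real.smoothTransition.le_one _

section AbstractGluing

variable {X X₁ X₂ Y Y₁ Y₂ : Type*} [NormedAddCommGroup X] [NormedSpace ℝ X] [CompleteSpace X]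
  [NormedAddCommGroup X₁] [NormedSpace ℝ X₁] [NormedAddCommGroup X₂] [NormedSpace ℝ X₂]
  [NormedAddCommGroup Y] [NormedSpace ℝ Y] [CompleteSpace Y]
  [NormedAddCommGroup Y₁] [NormedSpace ℝ Y₁] [NormedAddCommGroup Y₂] [NormedSpace ℝ Y₂]

/-- An operator is Fredholm if it is patched together from two Fredholm operators by means of
partitions of unity on the source and on the target. -/
theorem ContinuousLinearMap.IsFredholm.glue {F : X →L[ℝ] Y} {F₁ : X₁ →L[ℝ] Y₁}
    {F₂ : X₂ →L[ℝ] Y₂} (f1 : F₁.IsFredholm) (f2 : F₂.IsFredholm) {M₁ : X₁ →L[ℝ] X}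
    {M₂ : X₂ →L[ℝ] X} {N₁ : X →L[ℝ] X₁} {N₂ : X →L[ℝ] X₂} {o₁ : Y₁ →L[ℝ] Y} {o₂ : Y₂ →L[ℝ] Y}
    {i₁ : Y →L[ℝ] Y₁} {i₂ : Y →L[ℝ] Y₂} {S₁ : X₁ →L[ℝ] Y} {S₂ : X₂ →L[ℝ] Y} {S₁' : X →L[ℝ] Y₁}
    {S₂' : X →L[ℝ] Y₂} (hMN : M₁ ∘L N₁ + M₂ ∘L N₂ = .id ℝ X)
    (hoi : o₁ ∘L i₁ + o₂ ∘L i₂ = .id ℝ Y)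
    (g1 : F ∘L M₁ = o₁ ∘L F₁ + S₁) (g2 : F ∘L M₂ = o₂ ∘L F₂ + S₂)
    (g3 : F₁ ∘L N₁ = i₁ ∘L F + S₁') (g4 : F₂ ∘L N₂ = i₂ ∘L F + S₂')
    (hS₁ : S₁.IsApproximable) (hS₂ : S₂.IsApproximable) (hS₁' : S₁'.IsApproximable)
    (hS₂' : S₂'.IsApproximable) : F.IsFredholm := by
  obtain ⟨R₁, K₁, K₁', k1, k1', e1, e1'⟩ := f1.exists_approximable_inverse
  obtain ⟨R₂, K₂, K₂', k2, k2', e2, e2'⟩ := f2.exists_approximable_inverse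
  -- The parametrix of `F` is patched together from those of the pieces: cut off the data, solve
  -- locally, cut off the solutions, and add.
  have r1 : F ∘L (M₁ ∘L R₁ ∘L i₁ + M₂ ∘L R₂ ∘L i₂) = ContinuousLinearMap.id ℝ _ + 0 +
      ((o₁ ∘L K₁ ∘L i₁ + S₁ ∘L (R₁ ∘L i₁)) + (o₂ ∘L K₂ ∘L i₂ + S₂ ∘L (R₂ ∘L i₂))) := by
    rw [ContinuousLinearMap.comp_add, ← ContinuousLinearMap.comp_assoc, g1,
      ← ContinuousLinearMap.comp_assoc F M₂, g2, ContinuousLinearMap.add_comp,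
      ContinuousLinearMap.add_comp, ContinuousLinearMap.comp_assoc o₁,
      ← ContinuousLinearMap.comp_assoc F₁, e1, ContinuousLinearMap.comp_assoc o₂,
      ← ContinuousLinearMap.comp_assoc F₂, e2, ContinuousLinearMap.add_comp,
      ContinuousLinearMap.add_comp, ContinuousLinearMap.id_comp, ContinuousLinearMap.id_comp,
      ContinuousLinearMap.comp_add, ContinuousLinearMap.comp_add, ← hoi, add_zero]
    abel
  have r2 : (M₁ ∘L R₁ ∘L i₁ + M₂ ∘L R₂ ∘L i₂) ∘L F = ContinuousLinearMap.id ℝ _ + 0 +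
      ((M₁ ∘L K₁' ∘L N₁ - M₁ ∘L R₁ ∘L S₁') + (M₂ ∘L K₂' ∘L N₂ - M₂ ∘L R₂ ∘L S₂')) := by
    have g3' := eq_sub_of_add_eq g3.symm
    have g4' := eq_sub_of_add_eq g4.symm
    rw [ContinuousLinearMap.add_comp, ContinuousLinearMap.comp_assoc,
      ContinuousLinearMap.comp_assoc, g3', ContinuousLinearMap.comp_assoc M₂,
      ContinuousLinearMap.comp_assoc, g4', ContinuousLinearMap.comp_sub,
      ContinuousLinearMap.comp_sub, ContinuousLinearMap.comp_sub, ContinuousLinearMap.comp_sub,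
      ← ContinuousLinearMap.comp_assoc R₁, e1', ← ContinuousLinearMap.comp_assoc R₂ F₂, e2',
      ContinuousLinearMap.add_comp, ContinuousLinearMap.add_comp, ContinuousLinearMap.id_comp,
      ContinuousLinearMap.id_comp, ContinuousLinearMap.comp_add, ContinuousLinearMap.comp_add,
      ← hMN, add_zero]
    abel
  refine (isFredholm_of_parametrix (by simp) (by simp) ?_ ?_ r1 r2).1
  · exact (((k1.comp_right _).comp_left _).add (hS₁.comp_right _)).add
      (((k2.comp_right _).comp_left _).add (hS₂.comp_right _))
  · exact (((k1'.comp_right _).comp_left _).sub ((hS₁'.comp_left _).comp_left _)).add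
      (((k2'.comp_right _).comp_left _).sub ((hS₂'.comp_left _).comp_left _))

end AbstractGluing

namespace HilbertPair

section Gluing

variable {H₀ H₁ : Type*} [NormedAddCommGroup H₀] [InnerProductSpace ℝ H₀] [CompleteSpace H₀]
  [NormedAddCommGroup H₁] [InnerProductSpace ℝ H₁] [CompleteSpace H₁] (P : HilbertPair H₀ H₁)
  {a b : ℝ}

theorem bdryOp_eq_add (hab : a < b) (A B : C(Icc a b, H₁ →L[ℝ] H₀)) (𝔸 𝔹 : H₁ →L[ℝ] H₀) :
    P.bdryOp hab A 𝔸 𝔹 = P.bdryOp hab B 𝔸 𝔹 +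
      ContinuousLinearMap.inl ℝ _ _ ∘L mulOp hab (A - B) ∘L P.path a b := by
  ext1 x
  rw [add_apply, bdryOp_apply, bdryOp_apply, ContinuousLinearMap.comp_apply,
    ContinuousLinearMap.comp_apply, ContinuousLinearMap.inl_apply, mulOp_sub, Prod.mk_add_mk,
    add_zero]
  congr 1
  change _ + _ = _ + _ + (mulOp hab A (P.path a b x) - mulOp hab B (P.path a b x))
  change _ = _ + mulOp hab B (P.path a b x) + _
  abel_nf
  rfl

/-- Near a Hessian, the operator `∂ₛ + A` with suitable boundary conditions is Fredholm. -/
theorem IsHessian.exists_isFredholm_near {A₀ : H₁ →L[ℝ] H₀} (h : P.IsHessian A₀) (hab : a < b) :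
    ∃ 𝔹 : H₁ →L[ℝ] H₀, Nonempty (P.SpectralFrame 𝔹) ∧ (A₀.IsInvertible → 𝔹 = A₀) ∧
      ∃ ε : ℝ, 0 < ε ∧ ∀ B : C(Icc a b, H₁ →L[ℝ] H₀), (∀ s, ‖B s - A₀‖ ≤ ε) →
        (P.bdryOp hab B 𝔹 𝔹).IsFredholm := by
  have := P.completeSpace_pathSpace hab
  -- If `A₀` is already invertible, S = 0 is taken, so that the boundary conditions are those of
  -- `A₀` itself. This is needed at the two ends of a path.
  obtain ⟨S, hS, hSi, hS0⟩ : ∃ S : H₀ →L[ℝ] H₀, P.IsSymmetrizable (A₀ + S ∘L P.incl) ∧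
      (A₀ + S ∘L P.incl).IsInvertible ∧ (A₀.IsInvertible → A₀ + S ∘L P.incl = A₀) := by
    by_cases hi : A₀.IsInvertible
    · exact ⟨0, by simpa using h.1, by simpa using hi, fun _ => by simp⟩
    · obtain ⟨S, h1, h2⟩ := IsHessian.exists_add_isInvertible P h
      exact ⟨S, h1, h2, fun h => absurd h hi⟩
  obtain ⟨Φ⟩ := IsSymmetrizable.nonempty_spectralFrame P hS hSi
  set 𝔹 := A₀ + S ∘L P.incl with h𝔹
  obtain ⟨L, hL⟩ := Φ.exists_equiv_bdryOp_const hab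
  set I := ContinuousLinearMap.inl ℝ (PathL2 a b H₀) (P.halfPos 𝔹 × P.halfNeg 𝔹) with hI
  set M := ‖I‖ * ‖P.path a b‖ * ‖L.symm.toContinuousLinearMap‖ with hM
  have hM0 : 0 ≤ M := mul_nonneg (mul_nonneg (ContinuousLinearMap.opNorm_nonneg _)
    (ContinuousLinearMap.opNorm_nonneg _)) (ContinuousLinearMap.opNorm_nonneg _)
  refine ⟨𝔹, ⟨Φ⟩, hS0, 1 / (M + 1), by positivity, fun B hB => ?_⟩
  -- `B` = 𝔹 + (`B` − `A₀`) − S, with S acting through the inclusion: an isomorphism, a term that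
  -- the choice 1/(M + 1) makes small relative to its inverse, and an approximable term.
  have e : P.bdryOp hab B 𝔹 𝔹 = L.toContinuousLinearMap +
      I ∘L mulOp hab (B - .const _ A₀) ∘L P.path a b - I ∘L constOp hab S ∘L P.pathIncl hab := by
    rw [hL, P.bdryOp_eq_add hab B (.const _ 𝔹), ← hI, add_sub_assoc,
      ← ContinuousLinearMap.comp_sub]
    congr 2
    ext1 x
    rw [sub_apply, ContinuousLinearMap.comp_apply, ContinuousLinearMap.comp_apply,
      ContinuousLinearMap.comp_apply, mulOp_eq_iff]
    filter_upwards [Lp.coeFn_sub (mulOp hab (B - .const _ A₀) (P.path a b x))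
        (constOp hab S (P.pathIncl hab x)), mulOp_ae_eq' hab (B - .const _ A₀) (P.path a b x),
      constOp_ae_eq hab S (P.pathIncl hab x), P.pathIncl_ae_eq hab x] with s h1 h2 h3 h4 hs
    rw [h1, Pi.sub_apply, h2 hs, h3, h4]
    simp [h𝔹, sub_sub]
  rw [e, sub_eq_add_neg]
  refine (fredholmIndex_add_small_add (T := L.toContinuousLinearMap)
    (R := L.symm.toContinuousLinearMap) (K₀ := 0) (K₀' := 0) .zero .zero ?_ ?_ ?_ ?_).1
  · refine ContinuousLinearMap.ext fun y => ?_
    simp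
  · refine ContinuousLinearMap.ext fun y => ?_
    simp
  · have h1 : ‖mulOp hab (B - .const _ A₀)‖ ≤ 1 / (M + 1) := by
      refine (norm_mulOp_le hab _).trans ((ContinuousMap.norm_le _ (by positivity)).2 fun s => ?_)
      exact hB s
    have h2 : ‖I ∘L mulOp hab (B - .const _ A₀) ∘L P.path a b‖ ≤
        ‖I‖ * (1 / (M + 1) * ‖P.path a b‖) :=
      (ContinuousLinearMap.opNorm_comp_le _ _).trans (mul_le_mul_of_nonneg_left
        ((ContinuousLinearMap.opNorm_comp_le _ _).trans (mul_le_mul_of_nonneg_right h1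
          (ContinuousLinearMap.opNorm_nonneg _))) (ContinuousLinearMap.opNorm_nonneg _))
    calc _ ≤ ‖I‖ * (1 / (M + 1) * ‖P.path a b‖) * ‖L.symm.toContinuousLinearMap‖ :=
          mul_le_mul_of_nonneg_right h2 (ContinuousLinearMap.opNorm_nonneg _)
      _ = M / (M + 1) := by rw [hM]; ring
      _ < 1 := by rw [div_lt_one (by positivity)]; linarith
  · exact (((P.isApproximable_pathIncl hab).comp_left (constOp hab S)).comp_left I).neg

/-- Multiplication with a cutoff function on the target, for a function which is `1` at the left
end and `0` at the right end of the interval. -/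
noncomputable def cutLeft (hab : a < b) (χ : C(ℝ, ℝ)) (𝔸 𝔹 𝔹' : H₁ →L[ℝ] H₀) :
    PathL2 a b H₀ × P.halfPos 𝔸 × P.halfNeg 𝔹 →L[ℝ]
      PathL2 a b H₀ × P.halfPos 𝔸 × P.halfNeg 𝔹' :=
  (scal H₀ hab χ ∘L ContinuousLinearMap.fst ℝ _ _).prod
    ((ContinuousLinearMap.fst ℝ _ _ ∘L ContinuousLinearMap.snd ℝ _ _).prod 0)

/-- Multiplication with a cutoff function on the target, for a function which is `0` at the left
end and `1` at the right end of the interval. -/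
noncomputable def cutRight (hab : a < b) (χ : C(ℝ, ℝ)) (𝔸 𝔸' 𝔹 : H₁ →L[ℝ] H₀) :
    PathL2 a b H₀ × P.halfPos 𝔸 × P.halfNeg 𝔹 →L[ℝ]
      PathL2 a b H₀ × P.halfPos 𝔸' × P.halfNeg 𝔹 :=
  (scal H₀ hab χ ∘L ContinuousLinearMap.fst ℝ _ _).prod
    ((0 : _ →L[ℝ] P.halfPos 𝔸').prod
      (ContinuousLinearMap.snd ℝ _ _ ∘L ContinuousLinearMap.snd ℝ _ _))

theorem cutLeft_apply (hab : a < b) (χ : C(ℝ, ℝ)) (𝔸 𝔹 𝔹' : H₁ →L[ℝ] H₀)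
    (y : PathL2 a b H₀ × P.halfPos 𝔸 × P.halfNeg 𝔹) :
    P.cutLeft hab χ 𝔸 𝔹 𝔹' y = (scal H₀ hab χ y.1, y.2.1, 0) := rfl

theorem cutRight_apply (hab : a < b) (χ : C(ℝ, ℝ)) (𝔸 𝔸' 𝔹 : H₁ →L[ℝ] H₀)
    (y : PathL2 a b H₀ × P.halfPos 𝔸 × P.halfNeg 𝔹) :
    P.cutRight hab χ 𝔸 𝔸' 𝔹 y = (scal H₀ hab χ y.1, 0, y.2.2) := rfl

theorem scal_opD_congr (hab : a < b) {A A' : C(Icc a b, H₁ →L[ℝ] H₀)} (χ : C(ℝ, ℝ))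
    (h : ∀ s (hs : s ∈ Icc a b), χ s ≠ 0 → A ⟨s, hs⟩ = A' ⟨s, hs⟩) (x : P.pathSpace a b) :
    scal H₀ hab χ (P.opD hab A x) = scal H₀ hab χ (P.opD hab A' x) := by
  change scal H₀ hab χ (P.pathDeriv a b x + mulOp hab A (P.path a b x)) =
    scal H₀ hab χ (P.pathDeriv a b x + mulOp hab A' (P.path a b x))
  rw [map_add, map_add, scal_mulOp_congr hab A A' χ h]

/-- The derivative of a smooth function, as a bundled continuous function. -/
noncomputable def derivC {χ : ℝ → ℝ} (hχ : ContDiff ℝ ∞ χ) : C(ℝ, ℝ) :=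
  ⟨deriv χ, hχ.continuous_deriv (by simp)⟩

/-- Only the values of the path on the support of χ and the boundary condition at a are seen by χx.
So χ intertwines two boundary problems that agree there, whatever their conditions at b, with the
commutator χ' as error. -/
theorem bdryOp_comp_smulPath_left (hab : a < b) {A A' : C(Icc a b, H₁ →L[ℝ] H₀)}
    (𝔸 𝔹 𝔹' : H₁ →L[ℝ] H₀) {χ : ℝ → ℝ} (hχ : ContDiff ℝ ∞ χ) (ha : χ a = 1) (hb : χ b = 0)
    (h : ∀ s (hs : s ∈ Icc a b), χ s ≠ 0 → A ⟨s, hs⟩ = A' ⟨s, hs⟩) :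
    P.bdryOp hab A 𝔸 𝔹 ∘L P.smulPath hab χ hχ =
      P.cutLeft hab ⟨χ, hχ.continuous⟩ 𝔸 𝔹' 𝔹 ∘L P.bdryOp hab A' 𝔸 𝔹' +
        ContinuousLinearMap.inl ℝ _ _ ∘L scal H₀ hab (derivC hχ) ∘L P.pathIncl hab := by
  ext1 x
  rw [ContinuousLinearMap.comp_apply, add_apply, ContinuousLinearMap.comp_apply,
    ContinuousLinearMap.comp_apply, ContinuousLinearMap.comp_apply, bdryOp_apply, bdryOp_apply,
    cutLeft_apply, ContinuousLinearMap.inl_apply, Prod.mk_add_mk, add_zero, opD_smulPath,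
    eval_smulPath, eval_smulPath, P.scal_opD_congr hab ⟨χ, hχ.continuous⟩ h]
  change (_, P.projPos 𝔸 (χ a • _), P.projNeg 𝔹 (χ b • _)) = _
  rw [ha, hb, one_smul, zero_smul, map_zero]
  rfl

theorem bdryOp_comp_smulPath_right (hab : a < b) {A A' : C(Icc a b, H₁ →L[ℝ] H₀)}
    (𝔸 𝔸' 𝔹 : H₁ →L[ℝ] H₀) {χ : ℝ → ℝ} (hχ : ContDiff ℝ ∞ χ) (ha : χ a = 0) (hb : χ b = 1)
    (h : ∀ s (hs : s ∈ Icc a b), χ s ≠ 0 → A ⟨s, hs⟩ = A' ⟨s, hs⟩) :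
    P.bdryOp hab A 𝔸 𝔹 ∘L P.smulPath hab χ hχ =
      P.cutRight hab ⟨χ, hχ.continuous⟩ 𝔸' 𝔸 𝔹 ∘L P.bdryOp hab A' 𝔸' 𝔹 +
        ContinuousLinearMap.inl ℝ _ _ ∘L scal H₀ hab (derivC hχ) ∘L P.pathIncl hab := by
  ext1 x
  rw [ContinuousLinearMap.comp_apply, add_apply, ContinuousLinearMap.comp_apply,
    ContinuousLinearMap.comp_apply, ContinuousLinearMap.comp_apply, bdryOp_apply, bdryOp_apply,
    cutRight_apply, ContinuousLinearMap.inl_apply, Prod.mk_add_mk, add_zero, opD_smulPath,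
    eval_smulPath, eval_smulPath, P.scal_opD_congr hab ⟨χ, hχ.continuous⟩ h]
  change (_, P.projPos 𝔸 (χ a • _), P.projNeg 𝔹 (χ b • _)) = _
  rw [ha, hb, one_smul, zero_smul, map_zero]
  rfl

theorem scal_scal_of_one {H : Type*} [NormedAddCommGroup H] [InnerProductSpace ℝ H]
    [CompleteSpace H] (hab : a < b) {φ ψ : C(ℝ, ℝ)} (h : ∀ s, ψ s ≠ 0 → φ s = 1)
    (f : PathL2 a b H) : scal H hab φ (scal H hab ψ f) = scal H hab ψ f := by
  rw [scal_eq_iff]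
  filter_upwards [scal_ae_eq hab ψ f] with s h1 _
  by_cases h0 : ψ s = 0
  · rw [h1, h0, zero_smul, smul_zero]
  · rw [h s h0, one_smul]

theorem scal_add_scal {H : Type*} [NormedAddCommGroup H] [InnerProductSpace ℝ H]
    [CompleteSpace H] (hab : a < b) {φ ψ : C(ℝ, ℝ)} (h : ∀ s, φ s + ψ s = 1)
    (f : PathL2 a b H) : scal H hab φ f + scal H hab ψ f = f := by
  refine Lp.ext ?_
  filter_upwards [scal_ae_eq hab ψ f, scal_ae_eq hab φ f,
    Lp.coeFn_add (scal H hab φ f) (scal H hab ψ f)] with s h1 h2 h3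
  rw [h3, Pi.add_apply, h1, h2, ← add_smul, h, one_smul]

/-- Weak derivatives are unique: the derivative of the zero path integrates to zero against all test
functions. -/
theorem pathSpace_ext_path {x y : P.pathSpace a b}
    (h : P.path a b x = P.path a b y) : x = y := by
  refine P.pathSpace_ext h (sub_eq_zero.1 ?_)
  rw [← map_sub]
  have h0 : P.path a b (x - y) = 0 := by rw [map_sub, h, sub_self]
  set v := P.pathDeriv a b (x - y) with hv
  have h1 := isOpen_Ioo.ae_eq_zero_of_integral_contDiff_smul_eq_zero (U := Ioo a b)
    (μ := volume.restrict (Icc a b)) (f := v)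
    ((integrableOn_pathL2 v).locallyIntegrable.locallyIntegrableOn _) fun φ f1 f2 f3 => by
      have h2 := (x - y).2 φ f1 f2 f3
      have h3 : ∫ s in Icc a b, deriv φ s • P.incl ((x - y).1.fst s) = 0 := by
        refine integral_eq_zero_of_ae ?_
        filter_upwards [Lp.coeFn_zero H₁ 2 (volume.restrict (Icc a b))] with s hs
        change deriv φ s • P.incl (P.path a b (x - y) s) = 0
        rw [h0, hs]; simp
      rw [h3] at h2
      exact neg_eq_zero.1 h2.symm
  have hIoo : ∀ᵐ s ∂volume.restrict (Icc a b), s ∈ Ioo a b := by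
    rw [← Measure.restrict_congr_set (Ioo_ae_eq_Icc (a := a) (b := b) (μ := volume))]
    exact ae_restrict_mem measurableSet_Ioo
  refine Lp.ext ?_
  filter_upwards [h1, hIoo, Lp.coeFn_zero H₀ 2 (volume.restrict (Icc a b))] with s h2 h3 h4
  rw [h2 h3, h4]; rfl

theorem smulPath_smulPath_of_one (hab : a < b) {φ ψ : ℝ → ℝ} (hφ : ContDiff ℝ ∞ φ)
    (hψ : ContDiff ℝ ∞ ψ) (h : ∀ s, ψ s ≠ 0 → φ s = 1) (x : P.pathSpace a b) :
    P.smulPath hab φ hφ (P.smulPath hab ψ hψ x) = P.smulPath hab ψ hψ x :=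
  P.pathSpace_ext_path (scal_scal_of_one hab (φ := ⟨φ, hφ.continuous⟩)
    (ψ := ⟨ψ, hψ.continuous⟩) h (P.path a b x))

theorem smulPath_add_smulPath (hab : a < b) {φ ψ : ℝ → ℝ} (hφ : ContDiff ℝ ∞ φ)
    (hψ : ContDiff ℝ ∞ ψ) (h : ∀ s, φ s + ψ s = 1) (x : P.pathSpace a b) :
    P.smulPath hab φ hφ x + P.smulPath hab ψ hψ x = x :=
  P.pathSpace_ext_path (scal_add_scal hab (φ := ⟨φ, hφ.continuous⟩)
    (ψ := ⟨ψ, hψ.continuous⟩) h (P.path a b x))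

/-- The Fredholm property is local: it can be checked on two overlapping pieces. -/
theorem isFredholm_bdryOp_of_glue (hab : a < b) {A A₁ A₂ : C(Icc a b, H₁ →L[ℝ] H₀)}
    {𝔸 𝔹 𝔸₂ 𝔹₁ : H₁ →L[ℝ] H₀} {c d : ℝ} (hac : a < c) (hcd : c < d) (hdb : d < b)
    (h1 : ∀ s : Icc a b, (s : ℝ) ≤ d → A s = A₁ s) (h2 : ∀ s : Icc a b, c ≤ s → A s = A₂ s)
    (F1 : (P.bdryOp hab A₁ 𝔸 𝔹₁).IsFredholm) (F2 : (P.bdryOp hab A₂ 𝔸₂ 𝔹).IsFredholm) :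
    (P.bdryOp hab A 𝔸 𝔹).IsFredholm := by
  have := P.completeSpace_pathSpace hab
  -- The overlap [c, d] is cut into thirds. The partition of unity ψ₁ + θ = 1 changes in the middle
  -- third. The wider cutoffs φ₁ and φ₂ are 1 where ψ₁ and θ, respectively, do not vanish; they live
  -- on s ≤ d and on s ≥ c, where the path agrees with A₁ and A₂.
  set c' := c + (d - c) / 3 with hc'
  set d' := c + 2 * (d - c) / 3 with hd'
  have hcc' : c < c' := by rw [hc']; linarith
  have hcd' : c' < d' := by rw [hc', hd']; linarith
  have hdd' : d' < d := by rw [hd']; linarith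
  obtain ⟨θ, sθ, θ0, θ1, -⟩ := exists_smooth_step hcd'
  obtain ⟨θ₁, sθ₁, θ₁0, θ₁1, -⟩ := exists_smooth_step hdd'
  obtain ⟨φ₂, sφ₂, φ₂0, φ₂1, -⟩ := exists_smooth_step hcc'
  set ψ₁ : ℝ → ℝ := fun s => 1 - θ s with hψ₁
  set φ₁ : ℝ → ℝ := fun s => 1 - θ₁ s with hφ₁
  have sψ₁ : ContDiff ℝ ∞ ψ₁ := contDiff_const.sub sθ
  have sφ₁ : ContDiff ℝ ∞ φ₁ := contDiff_const.sub sθ₁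
  have hadd : ∀ s, ψ₁ s + θ s = 1 := fun s => by simp [hψ₁]
  have hψφ₁ : ∀ s, ψ₁ s ≠ 0 → φ₁ s = 1 := fun s hs => by
    have : s ≤ d' := by
      by_contra hcon
      exact hs (by simp [hψ₁, θ1 s (not_le.1 hcon).le])
    simp [hφ₁, θ₁0 s this]
  have hθφ₂ : ∀ s, θ s ≠ 0 → φ₂ s = 1 := fun s hs => by
    refine φ₂1 s ?_
    by_contra hcon
    exact hs (θ0 s (not_le.1 hcon).le)
  have hφ₁d : ∀ s, φ₁ s ≠ 0 → s ≤ d := fun s hs => by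
    by_contra hcon
    exact hs (by simp [hφ₁, θ₁1 s (not_le.1 hcon).le])
  have hφ₂c : ∀ s, φ₂ s ≠ 0 → c ≤ s := fun s hs => by
    by_contra hcon
    exact hs (φ₂0 s (not_le.1 hcon).le)
  have g1 := P.bdryOp_comp_smulPath_left hab (A := A) (A' := A₁) 𝔸 𝔹 𝔹₁ sφ₁
    (by simp [hφ₁, θ₁0 a (by linarith)]) (by simp [hφ₁, θ₁1 b (by linarith)])
    fun s hs h => h1 ⟨s, hs⟩ (hφ₁d s h)
  have g2 := P.bdryOp_comp_smulPath_right hab (A := A) (A' := A₂) 𝔸 𝔸₂ 𝔹 sφ₂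
    (φ₂0 a (by linarith)) (φ₂1 b (by linarith)) fun s hs h => h2 ⟨s, hs⟩ (hφ₂c s h)
  have g3 := P.bdryOp_comp_smulPath_left hab (A := A₁) (A' := A) 𝔸 𝔹₁ 𝔹 sψ₁
    (by simp [hψ₁, θ0 a (by linarith)]) (by simp [hψ₁, θ1 b (by linarith)])
    fun s hs h => (h1 ⟨s, hs⟩ (hφ₁d s (by rw [hψφ₁ s h]; exact one_ne_zero))).symm
  have g4 := P.bdryOp_comp_smulPath_right hab (A := A₂) (A' := A) 𝔸₂ 𝔸 𝔹 sθ
    (θ0 a (by linarith)) (θ1 b (by linarith))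
    fun s hs h => (h2 ⟨s, hs⟩ (hφ₂c s (by rw [hθφ₂ s h]; exact one_ne_zero))).symm
  have hj := P.isApproximable_pathIncl hab
  refine F1.glue F2 ?_ ?_ g1 g2 g3 g4 ((hj.comp_left _).comp_left _) ((hj.comp_left _).comp_left _)
    ((hj.comp_left _).comp_left _) ((hj.comp_left _).comp_left _)
  · refine ContinuousLinearMap.ext fun x => ?_
    rw [add_apply, ContinuousLinearMap.comp_apply, ContinuousLinearMap.comp_apply,
      P.smulPath_smulPath_of_one hab sφ₁ sψ₁ hψφ₁, P.smulPath_smulPath_of_one hab sφ₂ sθ hθφ₂,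
      P.smulPath_add_smulPath hab sψ₁ sθ hadd, ContinuousLinearMap.id_apply]
  · refine ContinuousLinearMap.ext fun y => ?_
    rw [add_apply, ContinuousLinearMap.comp_apply, ContinuousLinearMap.comp_apply,
      cutLeft_apply, cutLeft_apply, cutRight_apply, cutRight_apply,
      scal_scal_of_one hab (φ := ⟨φ₁, sφ₁.continuous⟩) (ψ := ⟨ψ₁, sψ₁.continuous⟩) hψφ₁,
      scal_scal_of_one hab (φ := ⟨φ₂, sφ₂.continuous⟩) (ψ := ⟨θ, sθ.continuous⟩) hθφ₂,
      Prod.mk_add_mk, Prod.mk_add_mk, add_zero, zero_add,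
      scal_add_scal hab (φ := ⟨ψ₁, sψ₁.continuous⟩) (ψ := ⟨θ, sθ.continuous⟩) hadd,
      ContinuousLinearMap.id_apply]

end Gluing

end HilbertPair

/-! ### The Fredholm property of the augmented operators. -/

namespace HilbertPair

section Fredholmness

variable {H₀ H₁ : Type*} [NormedAddCommGroup H₀] [InnerProductSpace ℝ H₀] [CompleteSpace H₀]
  [NormedAddCommGroup H₁] [InnerProductSpace ℝ H₁] [CompleteSpace H₁] (P : HilbertPair H₀ H₁)
  {a b : ℝ}

/-- The path that is frozen outside of `[l, r]`. -/
noncomputable def clampPath (hab : a < b) (A : C(Icc a b, H₁ →L[ℝ] H₀)) (l r : ℝ) :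
    C(Icc a b, H₁ →L[ℝ] H₀) :=
  A.comp ⟨fun s => projIcc a b hab.le (max l (min s r)), by fun_prop⟩

theorem clampPath_apply (hab : a < b) (A : C(Icc a b, H₁ →L[ℝ] H₀)) (l r : ℝ) (s : Icc a b) :
    clampPath hab A l r s = A (projIcc a b hab.le (max l (min s r))) := rfl

theorem clampPath_apply_of_mem (hab : a < b) (A : C(Icc a b, H₁ →L[ℝ] H₀)) {l r : ℝ}
    {s : Icc a b} (h1 : l ≤ s) (h2 : s ≤ r) : clampPath hab A l r s = A s := by
  rw [clampPath_apply, min_eq_left h2, max_eq_right h1, projIcc_val]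

theorem dist_projIcc_max_min_lt (hab : a < b) {l r δ : ℝ} {s : Icc a b} (h1 : s - δ < l)
    (hlr : l ≤ r) (h2 : r < s + δ) (u : ℝ) :
    dist (projIcc a b hab.le (max l (min u r))) s < δ := by
  have h3 : dist (projIcc a b hab.le (max l (min u r))) (projIcc a b hab.le (s : ℝ)) ≤
      |max l (min u r) - s| := abs_projIcc_sub_projIcc hab.le
  rw [projIcc_val] at h3
  refine h3.trans_lt (abs_sub_lt_iff.2 ⟨?_, ?_⟩)
  · have : max l (min u r) ≤ r := max_le hlr (min_le_right _ _)
    linarith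
  · have : l ≤ max l (min u r) := le_max_left _ _
    linarith

/-- On sufficiently short intervals, the operators obtained by freezing the path are Fredholm for
suitable boundary conditions. -/
theorem exists_isFredholm_clampPath (hab : a < b) {A : C(Icc a b, H₁ →L[ℝ] H₀)}
    (hA : ∀ s, P.IsHessian (A s)) : ∃ δ : ℝ, 0 < δ ∧ ∀ s : Icc a b, ∃ 𝔹 : H₁ →L[ℝ] H₀,
      ∀ l r : ℝ, s - δ < l → l ≤ r → r < s + δ →
        (P.bdryOp hab (clampPath hab A l r) 𝔹 𝔹).IsFredholm := by
  choose 𝔹 _ _ ε hε hF using fun s => (hA s).exists_isFredholm_near P hab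
  -- Each Hessian on the path has its own radius ε; the Lebesgue number of the resulting cover gives
  -- one δ for all points.
  obtain ⟨δ, hδ, h⟩ := lebesgue_number_lemma_of_metric (α := Icc a b) (s := univ)
    (c := fun s => {t | ‖A t - A s‖ < ε s}) isCompact_univ
    (fun s => isOpen_lt (by fun_prop) continuous_const)
    fun s _ => mem_iUnion.2 ⟨s, by simpa using hε s⟩
  refine ⟨δ, hδ, fun s => ?_⟩
  obtain ⟨i, hi⟩ := h s (mem_univ _)
  exact ⟨𝔹 i, fun l r h1 h2 h3 => hF i _ fun t =>
    (show ‖A (projIcc a b hab.le (max l (min t r))) - A i‖ < ε i from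
      hi (dist_projIcc_max_min_lt hab h1 h2 h3 t)).le⟩

/-- Unlike in `exists_isFredholm_clampPath`, the boundary operator is the prescribed one, as the end
pieces require; in exchange δ belongs to a single point. -/
theorem IsHessian.exists_isFredholm_clampPath_of_isInvertible (hab : a < b)
    {A : C(Icc a b, H₁ →L[ℝ] H₀)} {s : Icc a b} (hA : P.IsHessian (A s))
    (hs : (A s).IsInvertible) : ∃ δ : ℝ, 0 < δ ∧
      ∀ l r : ℝ, s - δ < l → l ≤ r → r < s + δ →
        (P.bdryOp hab (clampPath hab A l r) (A s) (A s)).IsFredholm := by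
  obtain ⟨𝔹, -, h𝔹, ε, hε, hF⟩ := hA.exists_isFredholm_near P hab
  obtain ⟨δ, hδ, h⟩ := Metric.continuous_iff.1 A.continuous s ε hε
  rw [h𝔹 hs] at hF
  refine ⟨δ, hδ, fun l r h1 h2 h3 => hF _ fun t => ?_⟩
  rw [← dist_eq_norm]
  exact (h _ (dist_projIcc_max_min_lt hab h1 h2 h3 t)).le

/-- The initial piece is lengthened by η at a time: glue the path frozen after t − η with a short
piece frozen outside of a small interval that ends at t. The boundary operator at b is auxiliary and
changes from step to step. -/
theorem exists_isFredholm_clampPath_left (hab : a < b) {A : C(Icc a b, H₁ →L[ℝ] H₀)}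
    (hA : ∀ s, P.IsHessian (A s)) (ha : (A (leftEnd hab)).IsInvertible) {t : ℝ} (hat : a < t)
    (htb : t < b) : ∃ 𝔹 : H₁ →L[ℝ] H₀,
      (P.bdryOp hab (clampPath hab A a t) (A (leftEnd hab)) 𝔹).IsFredholm := by
  obtain ⟨δ, hδ, h1⟩ := P.exists_isFredholm_clampPath hab hA
  obtain ⟨δ', hδ', h2⟩ := (hA (leftEnd hab)).exists_isFredholm_clampPath_of_isInvertible P hab ha
  have hL : ((leftEnd hab : Icc a b) : ℝ) = a := rfl
  -- 2η ≤ δ' lets the first piece have length up to 2η, and η < δ lets the short piece reach t from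
  -- its centre t − η.
  set η := min δ δ' / 2 with hη
  have hη0 : 0 < η := by positivity
  have hηδ : η < δ := by have := min_le_left δ δ'; have : 0 < min δ δ' := by positivity
                         linarith
  have hηδ' : 2 * η ≤ δ' := by have := min_le_right δ δ'; linarith
  have key : ∀ n : ℕ, ∀ t, a < t → t < b → t < a + 2 * η + n * η → ∃ 𝔹 : H₁ →L[ℝ] H₀,
      (P.bdryOp hab (clampPath hab A a t) (A (leftEnd hab)) 𝔹).IsFredholm := by
    intro n
    induction n with
    | zero =>
      intro t hat htb ht
      simp only [CharP.cast_eq_zero, zero_mul, add_zero] at ht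
      exact ⟨_, h2 a t (by linarith) hat.le (by linarith)⟩
    | succ n ih =>
      intro t hat htb ht
      push_cast at ht
      by_cases hlt : t < a + 2 * η + n * η
      · exact ih t hat htb hlt
      have hn : (0 : ℝ) ≤ n * η := by positivity
      obtain ⟨𝔹', F1⟩ := ih (t - η) (by linarith) (by linarith) (by linarith)
      obtain ⟨𝔹, F2⟩ := h1 ⟨t - η, by linarith, by linarith⟩
      -- The two pieces overlap in [t − 3η/2, t − η].
      refine ⟨𝔹, P.isFredholm_bdryOp_of_glue hab (c := t - 2 * η + η / 2) (d := t - η)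
        (A₁ := clampPath hab A a (t - η)) (A₂ := clampPath hab A (t - 2 * η + η / 2) t)
        (by linarith) (by linarith) (by linarith) (fun s hs => ?_) (fun s hs => ?_) F1
        (F2 _ _ ?_ ?_ ?_)⟩
      · rw [clampPath_apply_of_mem hab A s.2.1 (by linarith),
          clampPath_apply_of_mem hab A s.2.1 hs]
      · rw [clampPath_apply, clampPath_apply,
          max_eq_right (le_min s.2.1 hat.le), max_eq_right (le_min hs (by linarith))]
      · change t - η - δ < _
        linarith
      · linarith
      · change t < t - η + δ
        linarith
  obtain ⟨n, hn⟩ := exists_nat_gt ((t - a) / η)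
  rw [div_lt_iff₀ hη0] at hn
  exact key n t hat htb (by linarith)

/-- The augmented operator of a path of Hessians with invertible ends is Fredholm. -/
theorem isFredholm_bdryOp (hab : a < b) {A : C(Icc a b, H₁ →L[ℝ] H₀)}
    (hA : A ∈ P.hessianPathsStar hab) :
    (P.bdryOp hab A (A (leftEnd hab)) (A (rightEnd hab))).IsFredholm := by
  obtain ⟨hA, ha, hb⟩ := hA
  obtain ⟨δ, hδ, h2⟩ := (hA (rightEnd hab)).exists_isFredholm_clampPath_of_isInvertible P hab hb
  have hR : ((rightEnd hab : Icc a b) : ℝ) = b := rfl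
  -- The last piece lives on [l, b], within δ of the invertible end b, and overlaps the initial
  -- piece in [l, t].
  obtain ⟨l, hl1, hl2⟩ := exists_between (max_lt hab (sub_lt_self b hδ))
  obtain ⟨t, ht1, ht2⟩ := exists_between hl2
  rw [max_lt_iff] at hl1
  obtain ⟨𝔹, F1⟩ := P.exists_isFredholm_clampPath_left hab hA ha (hl1.1.trans ht1) ht2
  refine P.isFredholm_bdryOp_of_glue hab hl1.1 ht1 ht2 (fun s hs => ?_) (fun s hs => ?_) F1
    (h2 l b (by linarith) hl2.le (by linarith))
  · rw [clampPath_apply_of_mem hab A s.2.1 hs]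
  · rw [clampPath_apply_of_mem hab A hs s.2.2]

end Fredholmness

end HilbertPair

/-! ### Restriction and concatenation of paths. -/

namespace HilbertPair

section Splitting

variable {H : Type*} [NormedAddCommGroup H] [InnerProductSpace ℝ H] [CompleteSpace H]
  {a b c d : ℝ}

theorem memLp_restrict_subset (h : Icc c d ⊆ Icc a b) (f : PathL2 a b H) :
    MemLp f 2 (volume.restrict (Icc c d)) :=
  (Lp.memLp f).mono_measure (Measure.restrict_mono h le_rfl)

theorem ae_restrict_subset {p : ℝ → Prop} (h : Icc c d ⊆ Icc a b)
    (hp : ∀ᵐ s ∂volume.restrict (Icc a b), p s) : ∀ᵐ s ∂volume.restrict (Icc c d), p s :=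
  ae_mono (Measure.restrict_mono h le_rfl) hp

/-- Restriction of square integrable paths to a subinterval. -/
noncomputable def restrictL2 (H : Type*) [NormedAddCommGroup H] [InnerProductSpace ℝ H]
    [CompleteSpace H] (h : Icc c d ⊆ Icc a b) : PathL2 a b H →L[ℝ] PathL2 c d H :=
  LinearMap.mkContinuous
    { toFun := fun f => (memLp_restrict_subset h f).toLp
      map_add' := fun f g => by
        rw [← MemLp.toLp_add]
        exact MemLp.toLp_congr _ _ (ae_restrict_subset h (Lp.coeFn_add f g))
      map_smul' := fun r f => by
        rw [RingHom.id_apply, ← MemLp.toLp_const_smul]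
        exact MemLp.toLp_congr _ _ (ae_restrict_subset h (Lp.coeFn_smul r f)) } 1 fun f => by
      rw [one_mul]
      change ‖(memLp_restrict_subset h f).toLp‖ ≤ _
      rw [Lp.norm_toLp, Lp.norm_def]
      exact ENNReal.toReal_mono (Lp.eLpNorm_ne_top f)
        (eLpNorm_mono_measure _ (Measure.restrict_mono h le_rfl))

theorem restrictL2_ae_eq (h : Icc c d ⊆ Icc a b) (f : PathL2 a b H) :
    ∀ᵐ s ∂volume.restrict (Icc c d), restrictL2 H h f s = f s :=
  (memLp_restrict_subset h f).coeFn_toLp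

theorem memLp_piecewise (f : PathL2 a c H) (g : PathL2 c b H) :
    MemLp ((Iic c).piecewise f g) 2 (volume.restrict (Icc a b)) := by
  refine MemLp.piecewise measurableSet_Iic ?_ ?_
  · rw [Measure.restrict_restrict measurableSet_Iic]
    refine (Lp.memLp f).mono_measure (Measure.restrict_mono ?_ le_rfl)
    rintro s ⟨h1, h2⟩
    exact ⟨h2.1, h1⟩
  · rw [Measure.restrict_restrict measurableSet_Iic.compl]
    refine (Lp.memLp g).mono_measure (Measure.restrict_mono ?_ le_rfl)
    rintro s ⟨h1, h2⟩
    exact ⟨(not_le.1 (show ¬ s ≤ c from h1)).le, h2.2⟩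

theorem exists_restrictL2_eq (hac : a ≤ c) (hcb : c ≤ b) (f : PathL2 a c H)
    (g : PathL2 c b H) : ∃ k : PathL2 a b H, restrictL2 H (Icc_subset_Icc_right hcb) k = f ∧
      restrictL2 H (Icc_subset_Icc_left hac) k = g := by
  have hk := (memLp_piecewise f g).coeFn_toLp
  refine ⟨(memLp_piecewise f g).toLp, Lp.ext ?_, Lp.ext ?_⟩
  · filter_upwards [restrictL2_ae_eq (Icc_subset_Icc_right hcb) (memLp_piecewise f g).toLp,
      ae_restrict_subset (Icc_subset_Icc_right hcb) hk, ae_mem_Icc a c] with s h1 h2 h3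
    rw [h1, h2, piecewise_eq_of_mem _ _ _ (by exact h3.2)]
  -- The piecewise function takes the left piece at c itself; for the right piece this is a null
  -- set.
  · have hne : ∀ᵐ s ∂(volume : Measure ℝ).restrict (Icc c b), s ≠ c :=
      ae_restrict_of_ae (by simp [ae_iff])
    filter_upwards [restrictL2_ae_eq (Icc_subset_Icc_left hac) (memLp_piecewise f g).toLp,
      ae_restrict_subset (Icc_subset_Icc_left hac) hk, ae_mem_Icc c b, hne] with s h1 h2 h3 h4
    rw [h1, h2, piecewise_eq_of_notMem _ _ _ (by simpa using lt_of_le_of_ne h3.1 h4.symm)]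

theorem ae_of_ae_restrict (hac : a ≤ c) (hcb : c ≤ b) {p : ℝ → Prop}
    (h1 : ∀ᵐ s ∂volume.restrict (Icc a c), p s) (h2 : ∀ᵐ s ∂volume.restrict (Icc c b), p s) :
    ∀ᵐ s ∂volume.restrict (Icc a b), p s := by
  rw [← Icc_union_Icc_eq_Icc hac hcb, ae_restrict_union_iff]
  exact ⟨h1, h2⟩

theorem ext_of_restrictL2 (hac : a ≤ c) (hcb : c ≤ b) {f g : PathL2 a b H}
    (h1 : restrictL2 H (Icc_subset_Icc_right hcb) f = restrictL2 H (Icc_subset_Icc_right hcb) g)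
    (h2 : restrictL2 H (Icc_subset_Icc_left hac) f = restrictL2 H (Icc_subset_Icc_left hac) g) :
    f = g := by
  refine Lp.ext (ae_of_ae_restrict hac hcb ?_ ?_)
  · filter_upwards [restrictL2_ae_eq (Icc_subset_Icc_right hcb) f,
      restrictL2_ae_eq (Icc_subset_Icc_right hcb) g] with s e1 e2
    rw [← e1, ← e2, h1]
  · filter_upwards [restrictL2_ae_eq (Icc_subset_Icc_left hac) f,
      restrictL2_ae_eq (Icc_subset_Icc_left hac) g] with s e1 e2
    rw [← e1, ← e2, h2]

/-- Splitting of square integrable paths at an intermediate point. -/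
noncomputable def splitL2 (H : Type*) [NormedAddCommGroup H] [InnerProductSpace ℝ H]
    [CompleteSpace H] (hac : a ≤ c) (hcb : c ≤ b) :
    PathL2 a b H ≃ₗ[ℝ] PathL2 a c H × PathL2 c b H :=
  LinearEquiv.ofBijective
    ((restrictL2 H (Icc_subset_Icc_right hcb)).toLinearMap.prod
      (restrictL2 H (Icc_subset_Icc_left hac)).toLinearMap)
    ⟨fun _ _ h => ext_of_restrictL2 hac hcb (congrArg Prod.fst h) (congrArg Prod.snd h),
      fun y => by
        obtain ⟨k, h1, h2⟩ := exists_restrictL2_eq hac hcb y.1 y.2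
        exact ⟨k, Prod.ext h1 h2⟩⟩

end Splitting

section Restriction

variable {H₀ H₁ : Type*} [NormedAddCommGroup H₀] [InnerProductSpace ℝ H₀] [CompleteSpace H₀]
  [NormedAddCommGroup H₁] [InnerProductSpace ℝ H₁] [CompleteSpace H₁] (P : HilbertPair H₀ H₁)
  {a b c d : ℝ}

/-- On the subinterval the continuous representative is its value at c plus the primitive of the
derivative, and such a function has that weak derivative. -/
theorem isWeakDeriv_restrictL2 (hab : a < b) (hcd : c < d) (h : Icc c d ⊆ Icc a b)
    (x : P.pathSpace a b) :
    IsWeakDeriv c d (fun s => P.incl (restrictL2 H₁ h (P.path a b x) s))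
      (restrictL2 H₀ h (P.pathDeriv a b x)) := by
  have hc : c ∈ Icc a b := h (left_mem_Icc.2 hcd.le)
  refine IsWeakDeriv.congr_ae (IsWeakDeriv.of_primitive hcd (u := P.rep hab x)
    (v := P.pathDeriv a b x) (c := P.rep hab x c) ((integrableOn_pathL2 _).mono_set h) ?_) ?_
    (restrictL2_ae_eq h _)
  · filter_upwards [ae_mem_Icc c d] with s hs
    exact P.rep_eq_rep_add hab x hc (h hs)
  · filter_upwards [restrictL2_ae_eq h (P.path a b x),
      ae_restrict_subset h (P.rep_ae_eq hab x)] with s h1 h2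
    rw [h1, h2]

/-- Restriction of the elements of `P₁([a, b])` to a subinterval. -/
noncomputable def restrictSpace (hab : a < b) (hcd : c < d) (h : Icc c d ⊆ Icc a b) :
    P.pathSpace a b →L[ℝ] P.pathSpace c d :=
  P.toPathSpace (restrictL2 H₁ h ∘L P.path a b) (restrictL2 H₀ h ∘L P.pathDeriv a b)
    (P.isWeakDeriv_restrictL2 hab hcd h)

theorem path_restrictSpace (hab : a < b) (hcd : c < d) (h : Icc c d ⊆ Icc a b)
    (x : P.pathSpace a b) :
    P.path c d (P.restrictSpace hab hcd h x) = restrictL2 H₁ h (P.path a b x) := rfl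

theorem pathDeriv_restrictSpace (hab : a < b) (hcd : c < d) (h : Icc c d ⊆ Icc a b)
    (x : P.pathSpace a b) :
    P.pathDeriv c d (P.restrictSpace hab hcd h x) = restrictL2 H₀ h (P.pathDeriv a b x) := rfl

theorem rep_restrictSpace (hab : a < b) (hcd : c < d) (h : Icc c d ⊆ Icc a b)
    (x : P.pathSpace a b) {t : ℝ} (ht : t ∈ Icc c d) :
    P.rep hcd (P.restrictSpace hab hcd h x) t = P.rep hab x t := by
  refine P.rep_eq_of_ae hcd _ ((P.continuousOn_rep hab x).mono h) ?_ ht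
  rw [path_restrictSpace]
  filter_upwards [restrictL2_ae_eq h (P.path a b x),
    ae_restrict_subset h (P.rep_ae_eq hab x)] with s h1 h2
  rw [h1, h2]

theorem eval_restrictSpace (hab : a < b) (hcd : c < d) (h : Icc c d ⊆ Icc a b)
    (x : P.pathSpace a b) (t : Icc c d) :
    P.eval hcd t (P.restrictSpace hab hcd h x) = P.eval hab ⟨t, h t.2⟩ x :=
  Subtype.ext (P.rep_restrictSpace hab hcd h x t.2)

theorem opD_restrictSpace (hab : a < b) (hcd : c < d) (h : Icc c d ⊆ Icc a b)
    (A : C(Icc a b, H₁ →L[ℝ] H₀)) (x : P.pathSpace a b) :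
    P.opD hcd (restrictPath A h) (P.restrictSpace hab hcd h x) =
      restrictL2 H₀ h (P.opD hab A x) := by
  change P.pathDeriv c d (P.restrictSpace hab hcd h x) + mulOp hcd (restrictPath A h)
    (P.path c d (P.restrictSpace hab hcd h x)) =
    restrictL2 H₀ h (P.pathDeriv a b x + mulOp hab A (P.path a b x))
  rw [map_add, pathDeriv_restrictSpace, path_restrictSpace]
  congr 1
  rw [mulOp_eq_iff]
  filter_upwards [restrictL2_ae_eq h (P.path a b x),
    restrictL2_ae_eq h (mulOp hab A (P.path a b x)),
    ae_restrict_subset h (mulOp_ae_eq' hab A (P.path a b x))] with s h1 h2 h3 hs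
  rw [h1, h2, h3 (h hs)]
  rfl

/-- Two paths with the same value at an intermediate point can be concatenated. -/
theorem exists_restrictSpace_eq (hac : a < c) (hcb : c < b) (hab : a < b) (x : P.pathSpace a c)
    (y : P.pathSpace c b) (hxy : P.eval hac (rightEnd hac) x = P.eval hcb (leftEnd hcb) y) :
    ∃ z : P.pathSpace a b, P.restrictSpace hab hac (Icc_subset_Icc_right hcb.le) z = x ∧
      P.restrictSpace hab hcb (Icc_subset_Icc_left hac.le) z = y := by
  obtain ⟨f, f1, f2⟩ := exists_restrictL2_eq hac.le hcb.le (P.path a c x) (P.path c b y)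
  obtain ⟨v, v1, v2⟩ := exists_restrictL2_eq hac.le hcb.le (P.pathDeriv a c x) (P.pathDeriv c b y)
  have hrep : P.rep hac x c = P.rep hcb y c := congrArg (Half.val P) hxy
  have hvI : IntegrableOn v (Icc a b) := integrableOn_pathL2 v
  have hv : ∀ s ∈ Icc a b, ∀ t ∈ Icc a b, IntervalIntegrable v volume s t := fun s hs t ht =>
    (intervalIntegrable_iff_integrableOn_Icc_of_le hab.le).2 hvI |>.mono_set (by
      rw [uIcc_of_le hab.le]; exact ordConnected_Icc.uIcc_subset hs ht)
  have e1 : ∀ s ∈ Icc a c, ∫ r in a..s, v r = ∫ r in a..s, P.pathDeriv a c x r := fun s hs => by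
    rw [← v1]
    refine intervalIntegral.integral_congr_ae_restrict ?_
    rw [uIoc_of_le hs.1]
    refine ae_mono (Measure.restrict_mono (Ioc_subset_Icc_self.trans
      (Icc_subset_Icc_right hs.2)) le_rfl) ?_
    filter_upwards [restrictL2_ae_eq (Icc_subset_Icc_right hcb.le) v] with s hs
    exact hs.symm
  have e2 : ∀ s ∈ Icc c b, ∫ r in c..s, v r = ∫ r in c..s, P.pathDeriv c b y r := fun s hs => by
    rw [← v2]
    refine intervalIntegral.integral_congr_ae_restrict ?_
    rw [uIoc_of_le hs.1]
    refine ae_mono (Measure.restrict_mono (Ioc_subset_Icc_self.trans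
      (Icc_subset_Icc_right hs.2)) le_rfl) ?_
    filter_upwards [restrictL2_ae_eq (Icc_subset_Icc_left hac.le) v] with s hs
    exact hs.symm
  -- The concatenated path is a primitive of the concatenated derivative. On the right piece this
  -- holds because the two values at c agree.
  have hw : IsWeakDeriv a b (fun s => P.incl (f s)) v := by
    refine IsWeakDeriv.of_primitive hab (c := P.rep hac x a) hvI
      (ae_of_ae_restrict hac.le hcb.le ?_ ?_)
    · filter_upwards [restrictL2_ae_eq (Icc_subset_Icc_right hcb.le) f, P.rep_ae_eq hac x,
        ae_mem_Icc a c] with s h1 h2 h3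
      rw [← h1, f1, h2, e1 s h3]
      exact P.rep_eq_rep_add hac x (left_mem_Icc.2 hac.le) h3
    · filter_upwards [restrictL2_ae_eq (Icc_subset_Icc_left hac.le) f, P.rep_ae_eq hcb y,
        ae_mem_Icc c b] with s h1 h2 h3
      rw [← h1, f2, h2, ← intervalIntegral.integral_add_adjacent_intervals
        (hv a (left_mem_Icc.2 hab.le) c ⟨hac.le, hcb.le⟩)
        (hv c ⟨hac.le, hcb.le⟩ s ⟨hac.le.trans h3.1, h3.2⟩), e2 s h3,
        e1 c (right_mem_Icc.2 hac.le), ← add_assoc,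
        ← P.rep_eq_rep_add hac x (left_mem_Icc.2 hac.le) (right_mem_Icc.2 hac.le), hrep]
      exact P.rep_eq_rep_add hcb y (left_mem_Icc.2 hcb.le) h3
  refine ⟨⟨WithLp.toLp 2 (f, v), hw⟩, P.pathSpace_ext f1 v1, P.pathSpace_ext f2 v2⟩

end Restriction

end HilbertPair

/-! ### Index of coupled Fredholm operators. -/

section AbstractIndex

variable {X Y Z : Type*} [NormedAddCommGroup X] [NormedSpace ℝ X] [CompleteSpace X]
  [NormedAddCommGroup Y] [NormedSpace ℝ Y] [CompleteSpace Y]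
  [NormedAddCommGroup Z] [NormedSpace ℝ Z] [CompleteSpace Z]

open ContinuousLinearMap in
/-- The index does not change if an operator is composed with a unipotent operator, and if a small
and an approximable operator are added. -/
theorem fredholmIndex_sub_comp_add {F : X →L[ℝ] Y} {R : Y →L[ℝ] X} {K₀ : Y →L[ℝ] Y}
    {K₀' : X →L[ℝ] X} (hK₀ : K₀.IsApproximable) (hK₀' : K₀'.IsApproximable)
    (h : F ∘L R = .id ℝ Y + K₀) (h' : R ∘L F = .id ℝ X + K₀') {M : Y →L[ℝ] Y}
    (hM : M ∘L M = 0) {s K : X →L[ℝ] Y} (hs : ‖s‖ * (‖R‖ * (1 + ‖M‖)) < 1)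
    (hK : K.IsApproximable) : fredholmIndex (F - M ∘L F + s + K) = fredholmIndex F := by
  have hMM : ∀ y, M (M y) = 0 := fun y => DFunLike.congr_fun hM y
  have hFR : ∀ y, F (R y) = y + K₀ y := fun y => DFunLike.congr_fun h y
  have hRF : ∀ x, R (F x) = x + K₀' x := fun x => DFunLike.congr_fun h' x
  -- Since M² = 0, the inverse of 1 − M is 1 + M. So (1 − M)F has the index of `F` and the
  -- parametrix R(1 + M).
  have h1 := (fredholmIndex_add_small_add (T := F - M ∘L F) (R := R ∘L (.id ℝ Y + M))
    (K₀ := (.id ℝ Y - M) ∘L K₀ ∘L (.id ℝ Y + M)) (K₀' := K₀')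
    ((hK₀.comp_right _).comp_left _) hK₀' ?_ ?_ (s := s) ?_ hK).2
  · rw [h1, fredholmIndex_eq_algIndex, fredholmIndex_eq_algIndex]
    refine (LinearMap.algIndex_of_equiv F.toLinearMap (F - M ∘L F).toLinearMap (.refl ℝ X)
      (.ofLinearMap (LinearMap.id - M.toLinearMap) (LinearMap.id + M.toLinearMap) ?_ ?_) ?_).symm
    · ext y
      simp [hMM]
    · ext y
      simp [hMM]
    · intro x
      simp
  · refine ContinuousLinearMap.ext fun y => ?_
    simp only [coe_comp, Function.comp_apply, add_apply, sub_apply, id_apply, map_add, hFR, hMM]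
    abel
  · refine ContinuousLinearMap.ext fun x => ?_
    simp only [coe_comp, Function.comp_apply, add_apply, sub_apply, id_apply, map_add, map_sub,
      hRF, hMM, map_zero]
    abel
  · refine lt_of_le_of_lt (mul_le_mul_of_nonneg_left ?_ (norm_nonneg s)) hs
    refine (opNorm_comp_le _ _).trans (mul_le_mul_of_nonneg_left ?_ (norm_nonneg R))
    refine (norm_add_le _ _).trans ?_
    gcongr
    exact norm_id_le

open ContinuousLinearMap in
theorem ContinuousLinearMap.IsApproximable.prodMap {X' Y' : Type*} [NormedAddCommGroup X']
    [NormedSpace ℝ X'] [NormedAddCommGroup Y'] [NormedSpace ℝ Y'] {K : X →L[ℝ] Y}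
    {K' : X' →L[ℝ] Y'} (hK : K.IsApproximable) (hK' : K'.IsApproximable) :
    (K.prodMap K').IsApproximable := by
  exact (hK.comp_right (fst ℝ X X')).prod (hK'.comp_right (snd ℝ X X'))

theorem fredholmIndex_prodMap {X' Y' : Type*} [NormedAddCommGroup X']
    [NormedSpace ℝ X'] [NormedAddCommGroup Y'] [NormedSpace ℝ Y'] {F : X →L[ℝ] Y}
    {F' : X' →L[ℝ] Y'} (hF : F.IsFredholm) (hF' : F'.IsFredholm) :
    fredholmIndex (F.prodMap F') = fredholmIndex F + fredholmIndex F' := by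
  have := hF.finiteDimensional_coker
  have := hF'.finiteDimensional_coker
  have : FiniteDimensional ℝ F.toLinearMap.ker := hF.finite_ker
  have : FiniteDimensional ℝ F'.toLinearMap.ker := hF'.finite_ker
  exact LinearMap.algIndex_prodMap F.toLinearMap F'.toLinearMap

theorem ContinuousLinearMap.opNorm_prodMap_le {X' Y' : Type*} [NormedAddCommGroup X']
    [NormedSpace ℝ X'] [NormedAddCommGroup Y'] [NormedSpace ℝ Y'] {F : X →L[ℝ] Y}
    {F' : X' →L[ℝ] Y'} {C : ℝ} (hF : ‖F‖ ≤ C) (hF' : ‖F'‖ ≤ C) : ‖F.prodMap F'‖ ≤ C := by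
  have hC : 0 ≤ C := (norm_nonneg F).trans hF
  refine ContinuousLinearMap.opNorm_le_bound _ hC fun x => max_le ?_ ?_
  · exact (F.le_of_opNorm_le hF _).trans (mul_le_mul_of_nonneg_left (le_max_left ‖x.1‖ ‖x.2‖) hC)
  · exact (F'.le_of_opNorm_le hF' _).trans (mul_le_mul_of_nonneg_left (le_max_right ‖x.1‖ ‖x.2‖) hC)

open ContinuousLinearMap in
-- The admissible size of B τ depends on a parametrix of `F` and on the norms of `B` and `p`, but on
-- σ only through ‖σ‖ ≤ 1. Hence ε can be chosen first. The operator B σ p has square zero because p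
-- B = 0.
theorem fredholmIndex_eq_of_forall_exists {F G : X →L[ℝ] Y} (hF : F.IsFredholm) {B : Z →L[ℝ] Y}
    {p : Y →L[ℝ] Z} (hpB : p ∘L B = 0) (h : ∀ ε : ℝ, 0 < ε → ∃ (σ : Z →L[ℝ] Z) (τ : X →L[ℝ] Z)
      (K : X →L[ℝ] Y), ‖σ‖ ≤ 1 ∧ ‖τ‖ ≤ ε ∧ K.IsApproximable ∧
        G = F - (B ∘L σ ∘L p) ∘L F + B ∘L τ + K) : fredholmIndex G = fredholmIndex F := by
  obtain ⟨R, K₀, K₀', hK₀, hK₀', e, e'⟩ := hF.exists_approximable_inverse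
  set C : ℝ := ‖B‖ * (‖R‖ * (1 + ‖B‖ * ‖p‖)) with hC
  have hC0 : 0 ≤ C := by positivity
  obtain ⟨σ, τ, K, hσ, hτ, hK, rfl⟩ := h (1 / (C + 1)) (by positivity)
  refine fredholmIndex_sub_comp_add hK₀ hK₀' e e' (ContinuousLinearMap.ext fun y => ?_) ?_ hK
  · have : p (B (σ (p y))) = 0 := DFunLike.congr_fun hpB (σ (p y))
    change B (σ (p (B (σ (p y))))) = 0
    rw [this, map_zero, map_zero]
  · have h1 : ‖B ∘L σ ∘L p‖ ≤ ‖B‖ * ‖p‖ := by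
      refine (opNorm_comp_le _ _).trans (mul_le_mul_of_nonneg_left ?_ (norm_nonneg B))
      refine (opNorm_comp_le _ _).trans (mul_le_of_le_one_left (norm_nonneg p) hσ)
    have h2 : ‖B ∘L τ‖ ≤ ‖B‖ * (1 / (C + 1)) :=
      (opNorm_comp_le _ _).trans (mul_le_mul_of_nonneg_left hτ (norm_nonneg B))
    calc ‖B ∘L τ‖ * (‖R‖ * (1 + ‖B ∘L σ ∘L p‖))
        ≤ ‖B‖ * (1 / (C + 1)) * (‖R‖ * (1 + ‖B‖ * ‖p‖)) := by gcongr
      _ = C / (C + 1) := by rw [hC]; ring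
      _ < 1 := by rw [div_lt_one (by positivity)]; linarith

open ContinuousLinearMap in
theorem ContinuousLinearMap.IsFredholm.prodMap {X' Y' : Type*} [NormedAddCommGroup X']
    [NormedSpace ℝ X'] [CompleteSpace X'] [NormedAddCommGroup Y'] [NormedSpace ℝ Y']
    [CompleteSpace Y'] {F : X →L[ℝ] Y} {F' : X' →L[ℝ] Y'} (hF : F.IsFredholm)
    (hF' : F'.IsFredholm) : (F.prodMap F').IsFredholm := by
  obtain ⟨R, K, L, hK, hL, e1, e2⟩ := hF.exists_approximable_inverse
  obtain ⟨R', K', L', hK', hL', e1', e2'⟩ := hF'.exists_approximable_inverse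
  refine (isFredholm_of_parametrix (R := R.prodMap R') (s := 0) (s' := 0) (by simp) (by simp)
    (hK.prodMap hK') (hL.prodMap hL') ?_ ?_).1
  · rw [add_zero]
    exact ContinuousLinearMap.ext fun y =>
      Prod.ext (DFunLike.congr_fun e1 y.1) (DFunLike.congr_fun e1' y.2)
  · rw [add_zero]
    exact ContinuousLinearMap.ext fun y =>
      Prod.ext (DFunLike.congr_fun e2 y.1) (DFunLike.congr_fun e2' y.2)

end AbstractIndex

section Coupling

variable {X₁ X₂ L₁ L₂ U V U' V' : Type*} [NormedAddCommGroup X₁] [NormedSpace ℝ X₁]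
  [CompleteSpace X₁] [NormedAddCommGroup X₂] [NormedSpace ℝ X₂] [CompleteSpace X₂]
  [NormedAddCommGroup L₁] [NormedSpace ℝ L₁] [CompleteSpace L₁]
  [NormedAddCommGroup L₂] [NormedSpace ℝ L₂] [CompleteSpace L₂]
  [NormedAddCommGroup U] [NormedSpace ℝ U] [CompleteSpace U]
  [NormedAddCommGroup V] [NormedSpace ℝ V] [CompleteSpace V]
  [NormedAddCommGroup U'] [NormedSpace ℝ U'] [CompleteSpace U']
  [NormedAddCommGroup V'] [NormedSpace ℝ V'] [CompleteSpace V']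

open ContinuousLinearMap in
/-- Two Fredholm operators can be coupled without changing the index by operators which are, up to
small and approximable operators, functions of the other components. -/
theorem fredholmIndex_coupling {F₁ : X₁ →L[ℝ] L₁ × U × V} {F₂ : X₂ →L[ℝ] L₂ × U' × V'}
    (hF₁ : F₁.IsFredholm) (hF₂ : F₂.IsFredholm) (e₁ : X₁ →L[ℝ] U') (e₂ : X₂ →L[ℝ] V)
    (Q₁ : L₁ →L[ℝ] U') (Q₂ : L₂ →L[ℝ] V)
    (h₁ : ∀ ε : ℝ, 0 < ε → ∃ (σ : L₁ →L[ℝ] L₁) (τ κ : X₁ →L[ℝ] L₁), ‖σ‖ ≤ 1 ∧ ‖τ‖ ≤ ε ∧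
      κ.IsApproximable ∧ ∀ x, e₁ x = Q₁ (σ (F₁ x).1) - Q₁ (τ x) + Q₁ (κ x))
    (h₂ : ∀ ε : ℝ, 0 < ε → ∃ (σ : L₂ →L[ℝ] L₂) (τ κ : X₂ →L[ℝ] L₂), ‖σ‖ ≤ 1 ∧ ‖τ‖ ≤ ε ∧
      κ.IsApproximable ∧ ∀ x, e₂ x = Q₂ (σ (F₂ x).1) - Q₂ (τ x) + Q₂ (κ x)) :
    fredholmIndex (F₁.prodMap F₂ - (inr ℝ _ _ ∘L inr ℝ _ _ ∘L inl ℝ _ _ ∘L e₁ ∘L fst ℝ _ _ +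
      inl ℝ _ _ ∘L inr ℝ _ _ ∘L inr ℝ _ _ ∘L e₂ ∘L snd ℝ _ _)) =
      fredholmIndex F₁ + fredholmIndex F₂ := by
  rw [← fredholmIndex_prodMap hF₁ hF₂]
  -- `B` writes only into the boundary slots V and U' that receive coupling terms, while p reads
  -- only the slots L₁ and L₂, so p B = 0.
  obtain ⟨B, hB⟩ : ∃ B : L₁ × L₂ →L[ℝ] (L₁ × U × V) × (L₂ × U' × V'),
      ∀ y, B y = ((0, 0, Q₂ y.2), (0, Q₁ y.1, 0)) :=
    ⟨(inr ℝ _ _ ∘L inr ℝ _ _ ∘L inl ℝ _ _ ∘L Q₁).coprod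
      (inl ℝ _ _ ∘L inr ℝ _ _ ∘L inr ℝ _ _ ∘L Q₂), fun y => by simp⟩
  refine fredholmIndex_eq_of_forall_exists (hF₁.prodMap hF₂) (B := B)
    (p := (fst ℝ _ _).prodMap (fst ℝ _ _)) ?_ fun ε hε => ?_
  · refine ContinuousLinearMap.ext fun y => ?_
    simp [hB]
  · obtain ⟨σ₁, τ₁, κ₁, hσ₁, hτ₁, hκ₁, h₁⟩ := h₁ ε hε
    obtain ⟨σ₂, τ₂, κ₂, hσ₂, hτ₂, hκ₂, h₂⟩ := h₂ ε hε
    refine ⟨σ₁.prodMap σ₂, τ₁.prodMap τ₂, -(B ∘L κ₁.prodMap κ₂),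
      opNorm_prodMap_le hσ₁ hσ₂, opNorm_prodMap_le hτ₁ hτ₂,
      ((hκ₁.prodMap hκ₂).comp_left _).neg, ContinuousLinearMap.ext fun x => ?_⟩
    refine Prod.ext (Prod.ext ?_ (Prod.ext ?_ ?_)) (Prod.ext ?_ (Prod.ext ?_ ?_))
    · simp [hB]
    · simp [hB]
    · simp [hB, h₂]
      abel
    · simp [hB]
    · simp [hB, h₁]
      abel
    · simp [hB]

end Coupling

/-! ### The coupling terms, up to small and approximable errors. -/

namespace HilbertPair

section Index

variable {H₀ H₁ : Type*} [NormedAddCommGroup H₀] [InnerProductSpace ℝ H₀] [CompleteSpace H₀]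
  [NormedAddCommGroup H₁] [InnerProductSpace ℝ H₁] [CompleteSpace H₁] (P : HilbertPair H₀ H₁)
  {a b c : ℝ}

theorem norm_scal_comp_mulOp_le (hab : a < b) {χ : C(ℝ, ℝ)} (h1 : ∀ s, |χ s| ≤ 1)
    {B : C(Icc a b, H₁ →L[ℝ] H₀)} {ε : ℝ} (hε : 0 ≤ ε)
    (h2 : ∀ s (hs : s ∈ Icc a b), χ s ≠ 0 → ‖B ⟨s, hs⟩‖ ≤ ε) :
    ‖scal H₀ hab χ ∘L mulOp hab B‖ ≤ ε := by
  refine ContinuousLinearMap.opNorm_le_bound _ hε fun f => ?_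
  refine Lp.norm_le_mul_norm_of_ae_le_mul ?_
  rw [ContinuousLinearMap.comp_apply]
  filter_upwards [scal_ae_eq hab χ (mulOp hab B f), mulOp_ae_eq' hab B f, ae_mem_Icc a b]
    with s e1 e2 hs
  rw [e1, e2 hs, norm_smul]
  by_cases h0 : χ s = 0
  · rw [h0, norm_zero, zero_mul]; positivity
  · calc ‖χ s‖ * ‖B ⟨s, hs⟩ (f s)‖ ≤ 1 * (ε * ‖f s‖) :=
        mul_le_mul (h1 s) ((B ⟨s, hs⟩).le_of_opNorm_le (h2 s hs h0) _) (norm_nonneg _) zero_le_one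
      _ = ε * ‖f s‖ := one_mul _

/-- Freezing the coefficients at 𝔸 after cutting off: the first term is a function of (∂ₛ + A)x, the
second is small where `A` is close to 𝔸 on the support of χ, the third is approximable. -/
theorem opD_const_smulPath (hab : a < b) (A : C(Icc a b, H₁ →L[ℝ] H₀)) (𝔸 : H₁ →L[ℝ] H₀)
    {χ : ℝ → ℝ} (hχ : ContDiff ℝ ∞ χ) (x : P.pathSpace a b) :
    P.opD hab (.const _ 𝔸) (P.smulPath hab χ hχ x) =
      scal H₀ hab ⟨χ, hχ.continuous⟩ (P.opD hab A x) -
      scal H₀ hab ⟨χ, hχ.continuous⟩ (mulOp hab (A - .const _ 𝔸) (P.path a b x)) +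
      scal H₀ hab (derivC hχ) (P.pathIncl hab x) := by
  rw [opD_smulPath]
  change scal H₀ hab _ (P.pathDeriv a b x + mulOp hab (.const _ 𝔸) (P.path a b x)) + _ =
    scal H₀ hab _ (P.pathDeriv a b x + mulOp hab A (P.path a b x)) - _ + _
  rw [mulOp_sub, sub_apply, map_add, map_add, map_sub]
  congr 1
  abel

namespace SpectralFrame

variable {P} {𝔸 : H₁ →L[ℝ] H₀}

/-- The positive part of the right end value of a path is determined by its image under `∂ₛ + A`
up to an operator that factors over the inclusion of the path space into `L²` and an operator that
is small if `A` is near `𝔸` near the right end. -/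
theorem exists_projPos_eval_right (Φ : P.SpectralFrame 𝔸) (hab : a < b) :
    ∃ Q : PathL2 a b H₀ →L[ℝ] P.halfPos 𝔸, ∀ (A : C(Icc a b, H₁ →L[ℝ] H₀)) (χ : ℝ → ℝ)
      (hχ : ContDiff ℝ ∞ χ), χ a = 0 → χ b = 1 → ∀ x : P.pathSpace a b,
      P.projPos 𝔸 (P.eval hab (rightEnd hab) x) =
        Q (scal H₀ hab ⟨χ, hχ.continuous⟩ (P.opD hab A x)) -
        Q (scal H₀ hab ⟨χ, hχ.continuous⟩ (mulOp hab (A - .const _ 𝔸) (P.path a b x))) +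
        Q (scal H₀ hab (derivC hχ) (P.pathIncl hab x)) := by
  obtain ⟨L, hL⟩ := Φ.exists_equiv_bdryOp_const hab
  have hLa : ∀ x, L x = P.bdryOp hab (.const _ 𝔸) 𝔸 𝔸 x := fun x => DFunLike.congr_fun hL x
  -- Q solves the constant coefficient problem with zero boundary data and reads off the positive
  -- part at b. It depends neither on the path nor on the cutoff function.
  refine ⟨P.projPos 𝔸 ∘L P.eval hab (rightEnd hab) ∘L L.symm.toContinuousLinearMap ∘L
    ContinuousLinearMap.inl ℝ _ _, fun A χ hχ ha hb x => ?_⟩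
  rw [← map_sub, ← map_add, ← P.opD_const_smulPath hab A 𝔸 hχ x]
  set y := P.smulPath hab χ hχ x with hy
  set z := L.symm (P.opD hab (.const _ 𝔸) y, 0, 0) with hz
  change _ = P.projPos 𝔸 (P.eval hab (rightEnd hab) z)
  have hya : P.eval hab (leftEnd hab) y = 0 := by
    rw [hy, eval_smulPath, show χ (leftEnd hab) = 0 from ha, zero_smul]
  have hyb : P.eval hab (rightEnd hab) y = P.eval hab (rightEnd hab) x := by
    rw [hy, eval_smulPath, show χ (rightEnd hab) = 1 from hb, one_smul]
  have hLz : P.bdryOp hab (.const _ 𝔸) 𝔸 𝔸 z = (P.opD hab (.const _ 𝔸) y, 0, 0) := by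
    rw [← hLa, hz, ContinuousLinearEquiv.apply_symm_apply]
  rw [bdryOp_apply, Prod.mk.injEq, Prod.mk.injEq] at hLz
  -- χx and the solution z satisfy the same equation and have zero positive part at a, so their
  -- difference has zero positive part at b; the negative parts at b may differ.
  have h := Φ.projPos_eval_right_eq_zero hab (x := y - z) (by rw [map_sub, hLz.1, sub_self])
    (by rw [map_sub, map_sub, hLz.2.1, hya, map_zero, sub_self])
  rw [map_sub, map_sub, hyb] at h
  exact sub_eq_zero.1 h

/-- The negative part of the left end value of a path is determined by its image under `∂ₛ + A`
up to an operator that factors over the inclusion of the path space into `L²` and an operator that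
is small if `A` is near `𝔸` near the left end. -/
theorem exists_projNeg_eval_left (Φ : P.SpectralFrame 𝔸) (hab : a < b) :
    ∃ Q : PathL2 a b H₀ →L[ℝ] P.halfNeg 𝔸, ∀ (A : C(Icc a b, H₁ →L[ℝ] H₀)) (χ : ℝ → ℝ)
      (hχ : ContDiff ℝ ∞ χ), χ a = 1 → χ b = 0 → ∀ x : P.pathSpace a b,
      P.projNeg 𝔸 (P.eval hab (leftEnd hab) x) =
        Q (scal H₀ hab ⟨χ, hχ.continuous⟩ (P.opD hab A x)) -
        Q (scal H₀ hab ⟨χ, hχ.continuous⟩ (mulOp hab (A - .const _ 𝔸) (P.path a b x))) +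
        Q (scal H₀ hab (derivC hχ) (P.pathIncl hab x)) := by
  obtain ⟨L, hL⟩ := Φ.exists_equiv_bdryOp_const hab
  have hLa : ∀ x, L x = P.bdryOp hab (.const _ 𝔸) 𝔸 𝔸 x := fun x => DFunLike.congr_fun hL x
  refine ⟨P.projNeg 𝔸 ∘L P.eval hab (leftEnd hab) ∘L L.symm.toContinuousLinearMap ∘L
    ContinuousLinearMap.inl ℝ _ _, fun A χ hχ ha hb x => ?_⟩
  rw [← map_sub, ← map_add, ← P.opD_const_smulPath hab A 𝔸 hχ x]
  set y := P.smulPath hab χ hχ x with hy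
  set z := L.symm (P.opD hab (.const _ 𝔸) y, 0, 0) with hz
  change _ = P.projNeg 𝔸 (P.eval hab (leftEnd hab) z)
  have hya : P.eval hab (leftEnd hab) y = P.eval hab (leftEnd hab) x := by
    rw [hy, eval_smulPath, show χ (leftEnd hab) = 1 from ha, one_smul]
  have hyb : P.eval hab (rightEnd hab) y = 0 := by
    rw [hy, eval_smulPath, show χ (rightEnd hab) = 0 from hb, zero_smul]
  have hLz : P.bdryOp hab (.const _ 𝔸) 𝔸 𝔸 z = (P.opD hab (.const _ 𝔸) y, 0, 0) := by
    rw [← hLa, hz, ContinuousLinearEquiv.apply_symm_apply]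
  rw [bdryOp_apply, Prod.mk.injEq, Prod.mk.injEq] at hLz
  have h := Φ.projNeg_eval_left_eq_zero hab (x := y - z) (by rw [map_sub, hLz.1, sub_self])
    (by rw [map_sub, map_sub, hLz.2.2, hyb, map_zero, sub_self])
  rw [map_sub, map_sub, hya] at h
  exact sub_eq_zero.1 h

/-- By continuity, a cutoff supported close enough to b makes the term with A − 𝔸 as small as
desired. Its derivative may become large, but it occurs only in the approximable term, whose norm is
irrelevant. -/
theorem exists_projPos_eval_right_approx (Φ : P.SpectralFrame 𝔸) (hab : a < b) :
    ∃ Q : PathL2 a b H₀ →L[ℝ] P.halfPos 𝔸, ∀ A : C(Icc a b, H₁ →L[ℝ] H₀),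
      A (rightEnd hab) = 𝔸 → ∀ ε : ℝ, 0 < ε → ∃ (σ : PathL2 a b H₀ →L[ℝ] PathL2 a b H₀)
      (τ κ : P.pathSpace a b →L[ℝ] PathL2 a b H₀), ‖σ‖ ≤ 1 ∧ ‖τ‖ ≤ ε ∧ κ.IsApproximable ∧
      ∀ x, P.projPos 𝔸 (P.eval hab (rightEnd hab) x) = Q (σ (P.opD hab A x)) - Q (τ x) + Q (κ x) := by
  obtain ⟨Q, hQ⟩ := Φ.exists_projPos_eval_right hab
  refine ⟨Q, fun A hA ε hε => ?_⟩
  set C : ℝ := ‖P.path a b‖ + 1 with hC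
  have hC0 : 0 < C := add_pos_of_nonneg_of_pos (ContinuousLinearMap.opNorm_nonneg _) one_pos
  have hε' : 0 < ε / C := by positivity
  obtain ⟨η, hη, h1⟩ := Metric.continuous_iff.1 A.continuous (rightEnd hab) _ hε'
  obtain ⟨l, hl1, hl2⟩ := exists_between (max_lt hab (sub_lt_self b hη))
  rw [max_lt_iff] at hl1
  obtain ⟨χ, sχ, χ0, χ1, χle⟩ := exists_smooth_step hl2
  set t := scal H₀ hab ⟨χ, sχ.continuous⟩ ∘L mulOp hab (A - .const _ 𝔸) with ht
  have n : ‖t‖ ≤ ε / C := norm_scal_comp_mulOp_le hab χle hε'.le fun s hs h0 => by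
    have : l < s := by
      by_contra hcon
      exact h0 (χ0 s (not_lt.1 hcon))
    have h3 := h1 ⟨s, hs⟩ (by
      change |s - b| < η
      rw [abs_lt]
      constructor <;> linarith [hs.2])
    rw [dist_eq_norm, hA] at h3
    exact h3.le
  refine ⟨_, t ∘L P.path a b, scal H₀ hab (derivC sχ) ∘L P.pathIncl hab,
    norm_scal_le hab _ zero_le_one fun s _ => χle s, ?_,
    (P.isApproximable_pathIncl hab).comp_left _, hQ A χ sχ (χ0 a hl1.1.le) (χ1 b le_rfl)⟩
  calc _ ≤ ‖t‖ * ‖P.path a b‖ := ContinuousLinearMap.opNorm_comp_le _ _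
    _ ≤ ε / C * C := mul_le_mul n (by rw [hC]; linarith) (ContinuousLinearMap.opNorm_nonneg _) hε'.le
    _ = ε := div_mul_cancel₀ _ hC0.ne'

theorem exists_projNeg_eval_left_approx (Φ : P.SpectralFrame 𝔸) (hab : a < b) :
    ∃ Q : PathL2 a b H₀ →L[ℝ] P.halfNeg 𝔸, ∀ A : C(Icc a b, H₁ →L[ℝ] H₀),
      A (leftEnd hab) = 𝔸 → ∀ ε : ℝ, 0 < ε → ∃ (σ : PathL2 a b H₀ →L[ℝ] PathL2 a b H₀)
      (τ κ : P.pathSpace a b →L[ℝ] PathL2 a b H₀), ‖σ‖ ≤ 1 ∧ ‖τ‖ ≤ ε ∧ κ.IsApproximable ∧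
      ∀ x, P.projNeg 𝔸 (P.eval hab (leftEnd hab) x) = Q (σ (P.opD hab A x)) - Q (τ x) + Q (κ x) := by
  obtain ⟨Q, hQ⟩ := Φ.exists_projNeg_eval_left hab
  refine ⟨Q, fun A hA ε hε => ?_⟩
  set C : ℝ := ‖P.path a b‖ + 1 with hC
  have hC0 : 0 < C := add_pos_of_nonneg_of_pos (ContinuousLinearMap.opNorm_nonneg _) one_pos
  have hε' : 0 < ε / C := by positivity
  obtain ⟨η, hη, h1⟩ := Metric.continuous_iff.1 A.continuous (leftEnd hab) _ hε'
  obtain ⟨r, hr1, hr2⟩ := exists_between (lt_min hab (lt_add_of_pos_right a hη))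
  rw [lt_min_iff] at hr2
  obtain ⟨θ, sθ, θ0, θ1, θle⟩ := exists_smooth_step (neg_lt_neg hr1)
  -- A reflected step function: 1 at a and zero from r on.
  set χ : ℝ → ℝ := fun s => θ (-s) with hχ
  have sχ : ContDiff ℝ ∞ χ := sθ.comp contDiff_neg
  have χle : ∀ s, |χ s| ≤ 1 := fun s => θle (-s)
  set t := scal H₀ hab ⟨χ, sχ.continuous⟩ ∘L mulOp hab (A - .const _ 𝔸) with ht
  have n : ‖t‖ ≤ ε / C := norm_scal_comp_mulOp_le hab χle hε'.le fun s hs h0 => by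
    have : s < r := by
      by_contra hcon
      exact h0 (θ0 (-s) (neg_le_neg (not_lt.1 hcon)))
    have h3 := h1 ⟨s, hs⟩ (by
      change |s - a| < η
      rw [abs_lt]
      constructor <;> linarith [hs.1])
    rw [dist_eq_norm, hA] at h3
    exact h3.le
  refine ⟨_, t ∘L P.path a b, scal H₀ hab (derivC sχ) ∘L P.pathIncl hab,
    norm_scal_le hab _ zero_le_one fun s _ => χle s, ?_,
    (P.isApproximable_pathIncl hab).comp_left _, hQ A χ sχ (θ1 (-a) le_rfl) (θ0 (-b) (neg_le_neg hr2.1.le))⟩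
  calc _ ≤ ‖t‖ * ‖P.path a b‖ := ContinuousLinearMap.opNorm_comp_le _ _
    _ ≤ ε / C * C := mul_le_mul n (by rw [hC]; linarith) (ContinuousLinearMap.opNorm_nonneg _) hε'.le
    _ = ε := div_mul_cancel₀ _ hC0.ne'

end SpectralFrame

end Index

end HilbertPair

/-! ### Additivity of the index under concatenation. -/

namespace HilbertPair

section Concatenation

variable {H₀ H₁ : Type*} [NormedAddCommGroup H₀] [InnerProductSpace ℝ H₀] [CompleteSpace H₀]
  [NormedAddCommGroup H₁] [InnerProductSpace ℝ H₁] [CompleteSpace H₁] (P : HilbertPair H₀ H₁)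
  {a b c : ℝ} {𝔸 : H₁ →L[ℝ] H₀}

/-- The operator on pairs of paths on adjacent intervals with the transmission condition at the
common end point split according to the spectral projections of `𝔸`. -/
noncomputable def coupledOp (hac : a < c) (hcb : c < b) (A : C(Icc a c, H₁ →L[ℝ] H₀))
    (B : C(Icc c b, H₁ →L[ℝ] H₀)) (𝔸₀ 𝔸 𝔹 : H₁ →L[ℝ] H₀) :
    P.pathSpace a c × P.pathSpace c b →L[ℝ] (PathL2 a c H₀ × P.halfPos 𝔸₀ × P.halfNeg 𝔸) ×
      (PathL2 c b H₀ × P.halfPos 𝔸 × P.halfNeg 𝔹) :=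
  (P.bdryOp hac A 𝔸₀ 𝔸).prodMap (P.bdryOp hcb B 𝔸 𝔹) -
    (ContinuousLinearMap.inr ℝ _ _ ∘L ContinuousLinearMap.inr ℝ _ _ ∘L
      ContinuousLinearMap.inl ℝ _ _ ∘L (P.projPos 𝔸 ∘L P.eval hac (rightEnd hac)) ∘L
        ContinuousLinearMap.fst ℝ _ _ +
    ContinuousLinearMap.inl ℝ _ _ ∘L ContinuousLinearMap.inr ℝ _ _ ∘L
      ContinuousLinearMap.inr ℝ _ _ ∘L (P.projNeg 𝔸 ∘L P.eval hcb (leftEnd hcb)) ∘L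
        ContinuousLinearMap.snd ℝ _ _)

/-- The coupling terms turn the separate boundary values π_- x(c) and π_+ y(c) into the two parts of
the jump x(c) − y(c). -/
theorem coupledOp_apply (hac : a < c) (hcb : c < b) (A : C(Icc a c, H₁ →L[ℝ] H₀))
    (B : C(Icc c b, H₁ →L[ℝ] H₀)) (𝔸₀ 𝔸 𝔹 : H₁ →L[ℝ] H₀)
    (x : P.pathSpace a c × P.pathSpace c b) : P.coupledOp hac hcb A B 𝔸₀ 𝔸 𝔹 x =
      ((P.opD hac A x.1, P.projPos 𝔸₀ (P.eval hac (leftEnd hac) x.1),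
        P.projNeg 𝔸 (P.eval hac (rightEnd hac) x.1 - P.eval hcb (leftEnd hcb) x.2)),
      (P.opD hcb B x.2, -P.projPos 𝔸 (P.eval hac (rightEnd hac) x.1 - P.eval hcb (leftEnd hcb) x.2),
        P.projNeg 𝔹 (P.eval hcb (rightEnd hcb) x.2))) := by
  obtain ⟨x, y⟩ := x
  rw [map_sub, map_sub, neg_sub]
  simp [coupledOp, bdryOp_apply]

/-- The transmission condition, split according to the spectral projections of `𝔸`. -/
noncomputable def SpectralFrame.couplingEquiv {P : HilbertPair H₀ H₁} (Φ : P.SpectralFrame 𝔸)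
    (L L' E E' : Type*) [AddCommGroup L] [Module ℝ L] [AddCommGroup L'] [Module ℝ L']
    [AddCommGroup E] [Module ℝ E] [AddCommGroup E'] [Module ℝ E'] :
    (((L × L') × (E × E')) × P.Half) ≃ₗ[ℝ] (L × E × P.halfNeg 𝔸) × (L' × P.halfPos 𝔸 × E') where
  toFun y := ((y.1.1.1, y.1.2.1, P.projNeg 𝔸 y.2), (y.1.1.2, -P.projPos 𝔸 y.2, y.1.2.2))
  map_add' y z := by
    simp only [Prod.fst_add, Prod.snd_add, map_add, neg_add, Prod.mk_add_mk]
  map_smul' r y := by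
    simp only [Prod.smul_fst, Prod.smul_snd, map_smul, RingHom.id_apply, Prod.smul_mk, smul_neg]
  invFun w := (((w.1.1, w.2.1), (w.1.2.1, w.2.2.2)), (w.1.2.2 : P.Half) - (w.2.2.1 : P.Half))
  left_inv y := by
    refine Prod.ext rfl ?_
    change (P.projNeg 𝔸 y.2 : P.Half) - ((-P.projPos 𝔸 y.2 : P.halfPos 𝔸) : P.Half) = y.2
    rw [Submodule.coe_neg, sub_neg_eq_add, add_comm, Φ.projPos_add_projNeg]
  right_inv w := by
    have h1 : P.projNeg 𝔸 ((w.1.2.2 : P.Half) - (w.2.2.1 : P.Half)) = w.1.2.2 := by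
      rw [map_sub, Φ.projNeg_coe, Φ.projNeg_coe_halfPos, sub_zero]
    have h2 : -P.projPos 𝔸 ((w.1.2.2 : P.Half) - (w.2.2.1 : P.Half)) = w.2.2.1 := by
      rw [map_sub, Φ.projPos_coe, Φ.projPos_coe_halfNeg, zero_sub, neg_neg]
    exact Prod.ext (Prod.ext rfl (Prod.ext rfl h1)) (Prod.ext rfl (Prod.ext h2 rfl))

/-- P₁([a, b]) is the kernel of the jump map on pairs of paths, so `algIndex_of_constraint` adds the
jump to the target without changing the index. Splitting H_{1/2} by the projections of 𝔸 identifies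
the enlarged operator with the coupled one. -/
theorem fredholmIndex_bdryOp_eq_coupledOp (hab : a < b) (hac : a < c) (hcb : c < b)
    (A : C(Icc a b, H₁ →L[ℝ] H₀)) (𝔸₀ 𝔹 : H₁ →L[ℝ] H₀) (Φ : P.SpectralFrame 𝔸) :
    fredholmIndex (P.bdryOp hab A 𝔸₀ 𝔹) =
      fredholmIndex (P.coupledOp hac hcb (restrictPath A (Icc_subset_Icc_right hcb.le))
        (restrictPath A (Icc_subset_Icc_left hac.le)) 𝔸₀ 𝔸 𝔹) := by
  set A₁ := restrictPath A (Icc_subset_Icc_right hcb.le) with hA₁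
  set A₂ := restrictPath A (Icc_subset_Icc_left hac.le) with hA₂
  set ρ₁ := P.restrictSpace hab hac (Icc_subset_Icc_right hcb.le)
  set ρ₂ := P.restrictSpace hab hcb (Icc_subset_Icc_left hac.le)
  set δ : P.pathSpace a c × P.pathSpace c b →L[ℝ] P.Half :=
    P.eval hac (rightEnd hac) ∘L ContinuousLinearMap.fst ℝ _ _ -
      P.eval hcb (leftEnd hcb) ∘L ContinuousLinearMap.snd ℝ _ _ with hδ
  have hδa : ∀ x, δ x = P.eval hac (rightEnd hac) x.1 - P.eval hcb (leftEnd hcb) x.2 :=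
    fun x => rfl
  set F : P.pathSpace a c × P.pathSpace c b →L[ℝ]
      (PathL2 a c H₀ × PathL2 c b H₀) × (P.halfPos 𝔸₀ × P.halfNeg 𝔹) :=
    ((P.opD hac A₁).prodMap (P.opD hcb A₂)).prod
      ((P.projPos 𝔸₀ ∘L P.eval hac (leftEnd hac)).prodMap
        (P.projNeg 𝔹 ∘L P.eval hcb (rightEnd hcb))) with hF
  have hFa : ∀ x, F x = ((P.opD hac A₁ x.1, P.opD hcb A₂ x.2),
    (P.projPos 𝔸₀ (P.eval hac (leftEnd hac) x.1),
      P.projNeg 𝔹 (P.eval hcb (rightEnd hcb) x.2))) := fun x => rfl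
  have h1 := LinearMap.algIndex_of_constraint (P.bdryOp hab A 𝔸₀ 𝔹).toLinearMap
    (ρ₁.prod ρ₂).toLinearMap ?_ δ.toLinearMap ?_ ?_ F.toLinearMap
    ((splitL2 H₀ hac.le hcb.le).prodCongr (.refl ℝ (P.halfPos 𝔸₀ × P.halfNeg 𝔹))) ?_
  · rw [fredholmIndex_eq_algIndex, fredholmIndex_eq_algIndex, ← h1]
    refine LinearMap.algIndex_of_equiv _ _ (.refl ℝ _)
      (Φ.couplingEquiv (PathL2 a c H₀) (PathL2 c b H₀) (P.halfPos 𝔸₀) (P.halfNeg 𝔹)) fun x => ?_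
    exact P.coupledOp_apply hac hcb A₁ A₂ 𝔸₀ 𝔸 𝔹 x
  · intro x y hxy
    have e1 : ρ₁ x = ρ₁ y := congrArg Prod.fst hxy
    have e2 : ρ₂ x = ρ₂ y := congrArg Prod.snd hxy
    exact P.pathSpace_ext_path (ext_of_restrictL2 hac.le hcb.le
      (congrArg (P.path a c) e1) (congrArg (P.path c b) e2))
  · intro h
    -- Every h in H_{1/2} is a jump: keep the left path zero and extend −h to the right of c.
    refine ⟨(0, -P.halfExt hcb h), ?_⟩
    change δ (0, -P.halfExt hcb h) = h
    rw [hδa, map_zero, map_neg, zero_sub, neg_neg]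
    exact P.eval_halfExt hcb h
  · ext ⟨x, y⟩
    rw [LinearMap.mem_ker, LinearMap.mem_range]
    change (∃ z, (ρ₁ z, ρ₂ z) = (x, y)) ↔ δ (x, y) = 0
    rw [hδa, sub_eq_zero]
    constructor
    · rintro ⟨z, hz⟩
      rw [Prod.mk.injEq] at hz
      rw [← hz.1, ← hz.2, eval_restrictSpace, eval_restrictSpace]
      rfl
    · intro h
      obtain ⟨z, h1, h2⟩ := P.exists_restrictSpace_eq hac hcb hab x y h
      exact ⟨z, Prod.ext h1 h2⟩
  · intro x
    change F (ρ₁ x, ρ₂ x) = ((restrictL2 H₀ _ (P.opD hab A x), restrictL2 H₀ _ (P.opD hab A x)),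
      (P.projPos 𝔸₀ (P.eval hab (leftEnd hab) x), P.projNeg 𝔹 (P.eval hab (rightEnd hab) x)))
    rw [hFa, hA₁, hA₂, opD_restrictSpace, opD_restrictSpace, eval_restrictSpace,
      eval_restrictSpace]
    rfl

/-- Both paths have the value 𝔸 at c, so each coupling term is a function of the L² component of its
own operator up to small and approximable errors. -/
theorem fredholmIndex_coupledOp (hac : a < c) (hcb : c < b) {A : C(Icc a c, H₁ →L[ℝ] H₀)}
    {B : C(Icc c b, H₁ →L[ℝ] H₀)} {𝔸₀ 𝔹 : H₁ →L[ℝ] H₀} (Φ : P.SpectralFrame 𝔸)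
    (hA : A (rightEnd hac) = 𝔸) (hB : B (leftEnd hcb) = 𝔸)
    (F₁ : (P.bdryOp hac A 𝔸₀ 𝔸).IsFredholm) (F₂ : (P.bdryOp hcb B 𝔸 𝔹).IsFredholm) :
    fredholmIndex (P.coupledOp hac hcb A B 𝔸₀ 𝔸 𝔹) =
      fredholmIndex (P.bdryOp hac A 𝔸₀ 𝔸) + fredholmIndex (P.bdryOp hcb B 𝔸 𝔹) := by
  have := P.completeSpace_pathSpace hac
  have := P.completeSpace_pathSpace hcb
  obtain ⟨Q₁, hQ₁⟩ := Φ.exists_projPos_eval_right_approx hac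
  obtain ⟨Q₂, hQ₂⟩ := Φ.exists_projNeg_eval_left_approx hcb
  exact fredholmIndex_coupling F₁ F₂ _ _ Q₁ Q₂ (hQ₁ A hA) (hQ₂ B hB)

/-- Additivity of the index under concatenation of paths. -/
theorem fredholmIndex_bdryOp_add (hab : a < b) (hac : a < c) (hcb : c < b)
    {A : C(Icc a b, H₁ →L[ℝ] H₀)} {𝔸₀ 𝔹 : H₁ →L[ℝ] H₀}
    (Φ : P.SpectralFrame (A ⟨c, hac.le, hcb.le⟩))
    (F₁ : (P.bdryOp hac (restrictPath A (Icc_subset_Icc_right hcb.le)) 𝔸₀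
      (A ⟨c, hac.le, hcb.le⟩)).IsFredholm)
    (F₂ : (P.bdryOp hcb (restrictPath A (Icc_subset_Icc_left hac.le))
      (A ⟨c, hac.le, hcb.le⟩) 𝔹).IsFredholm) :
    fredholmIndex (P.bdryOp hab A 𝔸₀ 𝔹) =
      fredholmIndex (P.bdryOp hac (restrictPath A (Icc_subset_Icc_right hcb.le)) 𝔸₀
        (A ⟨c, hac.le, hcb.le⟩)) +
      fredholmIndex (P.bdryOp hcb (restrictPath A (Icc_subset_Icc_left hac.le))
        (A ⟨c, hac.le, hcb.le⟩) 𝔹) := by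
  rw [P.fredholmIndex_bdryOp_eq_coupledOp hab hac hcb A 𝔸₀ 𝔹 Φ]
  exact P.fredholmIndex_coupledOp hac hcb Φ rfl rfl F₁ F₂

end Concatenation

end HilbertPair

theorem mainTheorem4 {H₀ H₁ : Type*}
    [NormedAddCommGroup H₀] [InnerProductSpace ℝ H₀] [CompleteSpace H₀]
    [NormedAddCommGroup H₁] [InnerProductSpace ℝ H₁] [CompleteSpace H₁]
    (P : HilbertPair H₀ H₁) {T : ℝ} (hT : 0 < T)
    (A : C(Icc (-T) T, H₁ →L[ℝ] H₀))
    (hA : A ∈ P.hessianPathsStar (neg_lt_self hT))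
    (hA0 : (A ⟨0, neg_nonpos.2 hT.le, hT.le⟩).IsInvertible) :
    (P.augmented (neg_lt_self hT) A).IsFredholm ∧
    (P.augmented (neg_lt_zero.2 hT)
      (HilbertPair.restrictPath A (Icc_subset_Icc_right hT.le))).IsFredholm ∧
    (P.augmented hT
      (HilbertPair.restrictPath A (Icc_subset_Icc_left (neg_nonpos.2 hT.le)))).IsFredholm ∧
    fredholmIndex (P.augmented (neg_lt_self hT) A) =
      fredholmIndex (P.augmented (neg_lt_zero.2 hT)
        (HilbertPair.restrictPath A (Icc_subset_Icc_right hT.le))) +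
      fredholmIndex (P.augmented hT
        (HilbertPair.restrictPath A (Icc_subset_Icc_left (neg_nonpos.2 hT.le)))) := by
  have hr : HilbertPair.restrictPath A (Icc_subset_Icc_right hT.le) ∈
      P.hessianPathsStar (neg_lt_zero.2 hT) := ⟨fun s => hA.1 _, hA.2.1, hA0⟩
  have hl : HilbertPair.restrictPath A (Icc_subset_Icc_left (neg_nonpos.2 hT.le)) ∈
      P.hessianPathsStar hT := ⟨fun s => hA.1 _, hA0, hA.2.2⟩
  -- `augmented` is by definition `bdryOp` with the end values of the path as boundary operators.
  -- For both halves one of these is A(0).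
  have F := P.isFredholm_bdryOp _ hA
  have F₁ := P.isFredholm_bdryOp _ hr
  have F₂ := P.isFredholm_bdryOp _ hl
  obtain ⟨Φ⟩ := (hA.1 ⟨0, neg_nonpos.2 hT.le, hT.le⟩).1.nonempty_spectralFrame P hA0
  exact ⟨F, F₁, F₂, P.fredholmIndex_bdryOp_add (neg_lt_self hT) (neg_lt_zero.2 hT) hT Φ F₁ F₂⟩
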